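/- Let $\mathit{TG}$ be the triangular grid in the plane: its vertices are the points of $\mathbb Z+e^{2\pi i/6}\mathbb Z\subset\mathbb C$, two of them being adjacent if they are at distance $1$. Let $D\subset\mathbb C$ be a bounded domain whose boundary is a simple closed curve that is a union of edges of $\mathit{TG}$, and let $\bar v_0$ and $v_{\mathrm{end}}$ be the midpoints of two distinct edges on $\partial D$. Let $A_+$ (respectively $A_-$) be the positively (respectively negatively) oriented closed arc of $\partial D$ from $\bar v_0$ to $v_{\mathrm{end}}$. The harmonic explorer in $(D,\bar v_0,v_{\mathrm{end}})$ is the following random path. Let $X_1,X_2,\dots$ be independent random variables, uniform in $[0,1]$. Let $V_0$ be the set of vertices of $\mathit{TG}$ on $\partial D$, and let $\mathfrak h_0:V_0\to\{0,1\}$ be $1$ on $V_0\cap A_+$ and $0$ on $V_0\cap A_-$. Given $\bar v_n$ and $\mathfrak h_n:V_n\to\{0,1\}$, where $n=0$, or $n\ge1$ and $\bar v_n\notin\partial D$, let $T_{n+1}$ be the triangle of $\mathit{TG}$ that has $\bar v_n$ on its boundary and that lies in $D$ if $n=0$, and does not contain $\bar v_{n-1}$ if $n\ge1$. Let $v_{n+1}$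 be the vertex of $T_{n+1}$ that is not on the edge containing $\bar v_n$, and let $p_{n+1}$ be the value at $v_{n+1}$ of the discrete harmonic extension of $\mathfrak h_n$, i.e. of the bounded function on the vertices of $\mathit{TG}$ that equals $\mathfrak h_n$ on $V_n$ and whose value at each other vertex is the mean of its values at the six neighbors. If $X_{n+1}\le p_{n+1}$, let $\bar v_{n+1}$ be the midpoint of the edge of $T_{n+1}$ on the positively oriented arc of $\partial T_{n+1}$ from $v_{n+1}$ to $\bar v_n$; otherwise let $\bar v_{n+1}$ be the midpoint of the edge of $T_{n+1}$ on the positively oriented arc from $\bar v_n$ to $v_{n+1}$. Let $V_{n+1}=V_n\cup\{v_{n+1}\}$, let $\mathfrak h_{n+1}=\mathfrak h_n$ on $V_n$, and let $\mathfrak h_{n+1}(v_{n+1})=\mathbf 1_{X_{n+1}\le p_{n+1}}$ if $v_{n+1}\notin V_n$. The process stops at the first $N\ge1$ with $\bar v_N\in\partial D$ (almost surely $N<\infty$ and $\bar v_N=v_{\mathrm{end}}$). Its path $\gamma[0,N]$ is the union of the segments from $\bar v_n$ to the center of $T_{n+1}$ and from the center of $T_{n+1}$ to $\bar v_{n+1}$,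 $0\le n<N$. Proposition 6.3. There are universal constants $\hat c>0$ and $C<\infty$ such that the following holds for every such $(D,\bar v_0,v_{\mathrm{end}})$. Let $z\in\mathbb C$ and $0<r<R<\infty$, and write $B(z,\rho)$ for the open ball of radius $\rho$ centered at $z$. Suppose that $B(z,r)$ intersects $\partial D$ and that there is no connected component of $B(z,R)\cap D$ whose boundary intersects both $A_-$ and $A_+$. Then $$\mathbf P\bigl[\gamma[0,N]\cap B(z,r)\neq\varnothing\bigr]\le C\,(r/R)^{\hat c}.$$ -/

import Mathlib

open MeasureTheory ProbabilityTheory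

namespace HarmonicExplorer

noncomputable section

/-! ## The triangular grid -/

/-- Vertices of the triangular grid `TG`: `(a, b)` stands for the point
`a + b * exp (2πi/6)` of the plane. -/
abbrev Vertex : Type := ℤ × ℤ

/-- The point of the complex plane at which a vertex of the grid sits. -/
def pt (v : Vertex) : ℂ :=
  (v.1 : ℂ) + (v.2 : ℂ) * Complex.exp (2 * Real.pi * Complex.I / 6)

/-- The six steps to neighbouring vertices; their images under `pt` are the sixth roots of
unity. -/
def dirs : Finset Vertex := {(1, 0), (0, 1), (-1, 1), (-1, 0), (0, -1), (1, -1)}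

/-- Two vertices of `TG` are adjacent if their difference is a sixth root of unity. -/
def Adj (u v : Vertex) : Prop := v - u ∈ dirs

/-- The third vertex of the triangle of `TG` that lies to the left of the directed edge from `u`
to `v`, that is, `u + exp (2πi/6) * (v - u)`. -/
def apex (u v : Vertex) : Vertex :=
  (u.1 - (v.2 - u.2), u.2 + (v.1 - u.1) + (v.2 - u.2))

/-- The midpoint of an edge. -/
def mid (u v : Vertex) : ℂ := (pt u + pt v) / 2

/-- The center of the triangle of `TG` to the left of the directed edge from `u` to `v`. -/
def center (u v : Vertex) : ℂ := (pt u + pt v + pt (apex u v)) / 3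

/-- `f` is a bounded function on the vertices of `TG` which agrees with `h` on `V` and is
discrete harmonic at every vertex outside `V`. -/
def IsHarmonicExtension (V : Set Vertex) (h f : Vertex → ℝ) : Prop :=
  (∃ M : ℝ, ∀ v, |f v| ≤ M) ∧ (∀ v ∈ V, f v = h v) ∧
    ∀ v ∉ V, f v = (∑ d ∈ dirs, f (v + d)) / 6

open Classical in
/-- The discrete harmonic extension of `h|_V`. (It exists and is unique if `V` is nonempty and
`h` is bounded on `V`.) -/
def harmonicExtension (V : Set Vertex) (h : Vertex → ℝ) : Vertex → ℝ :=
  if hf : ∃ f, IsHarmonicExtension V h f then hf.choose else 0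

/-! ## Grid domains with two marked boundary edges -/

/-- A triple `(D, v₀, v_end)`: a bounded domain `D` in the plane whose boundary is a simple closed
curve that is a union of edges of `TG`, and the midpoints `v₀`, `v_end` of two distinct edges
on `∂D`.

The boundary vertices are listed as `vert 0, vert 1, …, vert len = vert 0`, in the positive
orientation of `∂D` (`D` is to the left of each boundary edge), beginning with the edge
`[vert 0, vert 1]` that carries `v₀`; the edge that carries `v_end` is
`[vert last, vert (last + 1)]`. -/
structure MarkedDomain where
  /-- the domain `D` -/
  D : Set ℂ
  /-- the number of edges of `∂D` -/
  len : ℕ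
  /-- the successive vertices of `∂D` (only the indices `0, …, len` matter) -/
  vert : ℕ → Vertex
  /-- the index of the edge that carries `v_end` -/
  last : ℕ
  isOpen : IsOpen D
  isConnected : IsConnected D
  isBounded : Bornology.IsBounded D
  three_le_len : 3 ≤ len
  vert_len : vert len = vert 0
  injOn : Set.InjOn vert (Set.Iio len)
  adj : ∀ i < len, Adj (vert i) (vert (i + 1))
  frontier_eq : frontier D = ⋃ i ∈ Set.Iio len, segment ℝ (pt (vert i)) (pt (vert (i + 1)))
  center_mem : ∀ i < len, center (vert i) (vert (i + 1)) ∈ D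
  one_le_last : 1 ≤ last
  last_lt : last < len

namespace MarkedDomain

variable (M : MarkedDomain)

/-- The starting point `v₀`. -/
def start : ℂ := mid (M.vert 0) (M.vert 1)

/-- The end point `v_end`. -/
def finish : ℂ := mid (M.vert M.last) (M.vert (M.last + 1))

/-- The positively oriented arc `A₊` of `∂D` from `v₀` to `v_end`. -/
def arcPlus : Set ℂ :=
  segment ℝ M.start (pt (M.vert 1)) ∪
    (⋃ i ∈ Set.Ico 1 M.last, segment ℝ (pt (M.vert i)) (pt (M.vert (i + 1)))) ∪
    segment ℝ (pt (M.vert M.last)) M.finish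

/-- The negatively oriented arc `A₋` of `∂D` from `v₀` to `v_end`. -/
def arcMinus : Set ℂ :=
  segment ℝ M.finish (pt (M.vert (M.last + 1))) ∪
    (⋃ i ∈ Set.Ico (M.last + 1) M.len, segment ℝ (pt (M.vert i)) (pt (M.vert (i + 1)))) ∪
    segment ℝ (pt (M.vert M.len)) M.start

end MarkedDomain

/-! ## The harmonic explorer -/

/-- The state of the harmonic explorer after `n` steps. The current position is the midpoint of
the edge `[tail, head]`, directed so that the next triangle to be explored is the one to the left
of the directed edge from `tail` to `head`. `known` is the set `V_n` of vertices whose color is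
determined, and `color` restricted to `known` is the function `𝔥_n` (`1` is black, `0` is
white). -/
structure State where
  tail : Vertex
  head : Vertex
  known : Set Vertex
  color : Vertex → ℝ

namespace State

/-- The current position `v̄_n`. -/
def pos (s : State) : ℂ := mid s.tail s.head

/-- The vertex `v_{n+1}` of the next triangle that is not on the current edge. -/
def next (s : State) : Vertex := apex s.tail s.head

/-- The value `p_{n+1}` at `v_{n+1}` of the discrete harmonic extension of `𝔥_n`. -/
def prob (s : State) : ℝ := harmonicExtension s.known s.color s.next

open Classical in
/-- One step, with coin `x`. The next triangle has the vertices `tail`, `head`, `next` in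
counterclockwise order. If `x ≤ p`, then the path leaves it through the edge `[next, tail]`, on
the positively oriented arc from `next` to the current position, and otherwise through
`[head, next]`; an undetermined `next` receives the color `1_{x ≤ p}`. -/
def step (s : State) (x : ℝ) : State where
  tail := if x ≤ s.prob then s.tail else s.next
  head := if x ≤ s.prob then s.next else s.head
  known := insert s.next s.known
  color := if s.next ∈ s.known then s.color
    else Function.update s.color s.next (if x ≤ s.prob then 1 else 0)

end State

namespace MarkedDomain

variable (M : MarkedDomain)

open Classical in
/-- The initial state: the position is `v₀`, the vertices on `∂D` are colored, with color `1` on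
`A₊` and `0` on `A₋`. -/
def init : State where
  tail := M.vert 0
  head := M.vert 1
  known := {v | pt v ∈ frontier M.D}
  color := fun v => if pt v ∈ M.arcPlus then 1 else 0

open Classical in
/-- The state after `n` steps when the coins `X₁, X₂, …` take the values `x 0, x 1, …`. The
process stops at the first `n ≥ 1` for which the position `v̄_n` is on `∂D`. -/
def run (x : ℕ → ℝ) : ℕ → State
  | 0 => M.init
  | n + 1 =>
    if 1 ≤ n ∧ (run x n).pos ∈ frontier M.D then run x n else (run x n).step (x n)

/-- The trace `γ[0, N]` of the harmonic explorer path: the union, over the steps `n → n + 1`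
performed before the process stops, of the segments from `v̄_n` to the center of the triangle
explored in this step and from there to `v̄_{n+1}`. -/
def trace (x : ℕ → ℝ) : Set ℂ :=
  ⋃ n ∈ {n : ℕ | ¬ (1 ≤ n ∧ (M.run x n).pos ∈ frontier M.D)},
    segment ℝ (M.run x n).pos (center (M.run x n).tail (M.run x n).head) ∪
      segment ℝ (center (M.run x n).tail (M.run x n).head) (M.run x (n + 1)).pos

end MarkedDomain

end

end HarmonicExplorer

namespace HarmonicExplorer

/-! ### The lattice -/

/-! A triangle explored well inside `B(z,R)` lies in a component of `B(z,R) ∩ D` that misses one of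
the two arcs. An approach to `z` therefore takes place on one of two sides, and each side is treated
separately. Fix a side, let `Q` be the vertices in components that do not see the other arc, and
normalize the harmonic extension of the current colours to vanish on the arc that may be seen. The
observable is the flux of this function through the edges from `Q` to that arc in a ball around a
lattice point `o` near `z`. It is a nonnegative linear functional of the harmonic extension, hence a
martingale (`Consistent.flux_eq`). The maximal inequality `measureReal_hits_le` then bounds the
probability of an approach, since the flux is small at the start and at least `1` at an approach.

Small at the start (`HarmonicOn.flux_le`): the function, extended by zero off `Q`, vanishes
somewhere on every hexagon around `o` up to radius `R`, because the arc runs from near `o` to beyond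
that radius. Caccioppoli's inequality, together with Poincaré's inequality on hexagons, gives a
hole-filling estimate: the energy in a ball is at most `864/865` of the energy in a ball of about
twice the radius. So the energy decays like a power of the scale, and by Cauchy–Schwarz so does the
flux.

Large at an approach (`exists_flux_lower_bound`): on the far side of the path the function is `1`,
on the arc it is `0`. On each hexagon of radius `s` between the two scales there is a lattice arc of
length at most `6 * s` in `Q`, from the boundary to a far vertex, that does not cross the path
(`Crossing.exists_arc`). The rise from `0` to `1` costs energy `1 / (6 * s)`, and the sum over `s`
exceeds any constant if the annulus is wide enough. Caccioppoli's identity bounds this energy by a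
constant plus twice the flux.

The topology is done modulo two. The dual path of the exploration, closed up through the boundary
arc and the small ball, is a cycle, so it is the set of edges along which a two-colouring of the
vertices changes (`exists_separating_potential`). It crosses each hexagon inside `Q` an odd number
of times (`Crossing.odd_crossings`), whereas without the desired arc the crossings would pair off.

Below the scale of the mesh, the path can come very close to the boundary only near a marked
midpoint, and both of these are outside `B(z,R)` (`le_three_mul`). -/

theorem mem_dirs {d : Vertex} : d ∈ dirs ↔ (d.1 = 1 ∧ d.2 = 0) ∨ (d.1 = 0 ∧ d.2 = 1) ∨
    (d.1 = -1 ∧ d.2 = 1) ∨ (d.1 = -1 ∧ d.2 = 0) ∨ (d.1 = 0 ∧ d.2 = -1) ∨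
    (d.1 = 1 ∧ d.2 = -1) := by
  obtain ⟨a, b⟩ := d
  simp [dirs]

theorem adj_iff {u v : Vertex} : Adj u v ↔ (v.1 = u.1 + 1 ∧ v.2 = u.2) ∨
    (v.1 = u.1 ∧ v.2 = u.2 + 1) ∨ (v.1 = u.1 - 1 ∧ v.2 = u.2 + 1) ∨ (v.1 = u.1 - 1 ∧ v.2 = u.2) ∨
    (v.1 = u.1 ∧ v.2 = u.2 - 1) ∨ (v.1 = u.1 + 1 ∧ v.2 = u.2 - 1) := by
  unfold Adj
  rw [mem_dirs]
  simp only [Prod.fst_sub, Prod.snd_sub]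
  omega

theorem Adj.symm {u v : Vertex} (h : Adj u v) : Adj v u := by
  rw [adj_iff] at *; omega

theorem adj_comm {u v : Vertex} : Adj u v ↔ Adj v u := ⟨Adj.symm, Adj.symm⟩

instance (u v : Vertex) : Decidable (Adj u v) := by unfold Adj; infer_instance

theorem apex_fst (u v : Vertex) : (apex u v).1 = u.1 - (v.2 - u.2) := rfl
theorem apex_snd (u v : Vertex) : (apex u v).2 = u.2 + (v.1 - u.1) + (v.2 - u.2) := rfl

theorem Adj.apex_right {u v : Vertex} (h : Adj u v) : Adj v (apex u v) := by
  rw [adj_iff] at *; simp only [apex_fst, apex_snd]; omega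

theorem Adj.apex_left {u v : Vertex} (h : Adj u v) : Adj u (apex u v) := by
  rw [adj_iff] at *; simp only [apex_fst, apex_snd]; omega

theorem apex_apex (u v : Vertex) : apex v (apex u v) = u := by
  ext <;> simp only [apex_fst, apex_snd] <;> ring

theorem apex_apex' (u v : Vertex) : apex (apex u v) u = v := by
  ext <;> simp only [apex_fst, apex_snd] <;> ring

/-- The graph distance of `v` from the origin in `TG`. -/
def hexNorm (v : Vertex) : ℕ := max (max v.1.natAbs v.2.natAbs) (v.1 + v.2).natAbs

theorem hexNorm_le_succ_of_adj {o u v : Vertex} (h : Adj u v) :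
    hexNorm (v - o) ≤ hexNorm (u - o) + 1 := by
  rw [adj_iff] at h
  simp only [hexNorm, Prod.fst_sub, Prod.snd_sub]
  omega

theorem hexNorm_le_iff {v : Vertex} {s : ℕ} : hexNorm v ≤ s ↔
    (-s ≤ v.1 ∧ v.1 ≤ s) ∧ (-s ≤ v.2 ∧ v.2 ≤ s) ∧ (-s ≤ v.1 + v.2 ∧ v.1 + v.2 ≤ s) := by
  unfold hexNorm; omega

theorem hexNorm_eq_iff {v : Vertex} {s : ℕ} : hexNorm v = s ↔
    ((-s ≤ v.1 ∧ v.1 ≤ s) ∧ (-s ≤ v.2 ∧ v.2 ≤ s) ∧ (-s ≤ v.1 + v.2 ∧ v.1 + v.2 ≤ s)) ∧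
    (v.1 = s ∨ v.1 = -s ∨ v.2 = s ∨ v.2 = -s ∨ v.1 + v.2 = s ∨ v.1 + v.2 = -s) := by
  unfold hexNorm; omega

/-- Adjacent vertices on a common hexagon bound one triangle inside and one outside. -/
theorem hexNorm_apex_of_eq {o u v : Vertex} {s : ℕ} (h : Adj u v) (hu : hexNorm (u - o) = s)
    (hv : hexNorm (v - o) = s) :
    (hexNorm (apex u v - o) ≤ s ∧ ¬ hexNorm (apex v u - o) ≤ s) ∨
    (¬ hexNorm (apex u v - o) ≤ s ∧ hexNorm (apex v u - o) ≤ s) := by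
  rw [adj_iff] at h
  rw [hexNorm_eq_iff] at hu hv
  simp only [hexNorm_le_iff, Prod.fst_sub, Prod.snd_sub, apex_fst, apex_snd] at *
  obtain ⟨a, b⟩ := u
  obtain ⟨a', b'⟩ := v
  simp only at *
  rcases h with ⟨rfl, rfl⟩ | ⟨rfl, rfl⟩ | ⟨rfl, rfl⟩ | ⟨rfl, rfl⟩ | ⟨rfl, rfl⟩ | ⟨rfl, rfl⟩ <;>
    omega

/-! ### Potentials modulo two -/

theorem exists_int_primitive (g : ℤ → ZMod 2) : ∃ f : ℤ → ZMod 2, ∀ a, f (a + 1) = f a + g a := by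
  refine ⟨fun a => if 0 ≤ a then ∑ i ∈ Finset.range a.toNat, g i
    else ∑ i ∈ Finset.range (-a).toNat, g (-1 - i), fun a => ?_⟩
  beta_reduce
  rcases lt_trichotomy a (-1) with h | h | h
  · have h1 : (-a).toNat = (-(a + 1)).toNat + 1 := by omega
    rw [if_neg (by omega), if_neg (by omega), h1, Finset.sum_range_succ]
    have h2 : (-1 - ((-(a + 1)).toNat : ℤ)) = a := by omega
    rw [h2, add_assoc, CharTwo.add_self_eq_zero, add_zero]
  · subst h
    simp [CharTwo.add_self_eq_zero]
  · have h1 : (a + 1).toNat = a.toNat + 1 := by omega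
    rw [if_pos (by omega), if_pos (by omega), h1, Finset.sum_range_succ]
    congr 2
    omega

/-- The sum of a `1`-form modulo two over the boundary of a face. The face `(v, false)` is the
upward and `(v, true)` the downward triangle of the cell with lower left corner `v`. -/
def coboundary (θ : Vertex → Vertex → ZMod 2) (F : Vertex × Bool) : ZMod 2 :=
  if F.2 then θ (F.1.1 + 1, F.1.2) (F.1.1, F.1.2 + 1) + θ (F.1.1 + 1, F.1.2) (F.1.1 + 1, F.1.2 + 1)
      + θ (F.1.1, F.1.2 + 1) (F.1.1 + 1, F.1.2 + 1)
  else θ F.1 (F.1.1 + 1, F.1.2) + θ F.1 (F.1.1, F.1.2 + 1) + θ (F.1.1 + 1, F.1.2) (F.1.1, F.1.2 + 1)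

/-- A closed form on the simply connected lattice is exact. The potential is obtained by integrating
along the horizontal axis and then along the columns. Vertical edges hold by construction,
horizontal ones by induction on the height, and diagonal ones from the upward triangles. -/
theorem exists_potential (θ : Vertex → Vertex → ZMod 2) (hs : ∀ u v, θ u v = θ v u)
    (h : ∀ F, coboundary θ F = 0) :
    ∃ H : Vertex → ZMod 2, ∀ u v, Adj u v → H u + H v = θ u v := by
  obtain ⟨f, hf⟩ := exists_int_primitive fun a => θ (a, 0) (a + 1, 0)
  choose col hcol using fun a : ℤ => exists_int_primitive fun b => θ (a, b) (a, b + 1)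
  have two : ∀ x : ZMod 2, x + x = 0 := CharTwo.add_self_eq_zero
  let H : Vertex → ZMod 2 := fun v => f v.1 + col v.1 v.2 + col v.1 0
  have hv : ∀ a b : ℤ, H (a, b + 1) = H (a, b) + θ (a, b) (a, b + 1) := by
    intro a b
    simp only [H, hcol]
    ring
  -- The two triangles of a cell share the diagonal, which cancels modulo two.
  have face : ∀ a b : ℤ, θ (a, b) (a + 1, b) + θ (a + 1, b) (a + 1, b + 1) =
      θ (a, b) (a, b + 1) + θ (a, b + 1) (a + 1, b + 1) := by
    intro a b
    have h1 := h ((a, b), false)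
    have h2 := h ((a, b), true)
    simp only [coboundary, if_true, Bool.false_eq_true, if_false] at h1 h2
    generalize θ (a, b) (a + 1, b) = x1 at *
    generalize θ (a + 1, b) (a + 1, b + 1) = x2 at *
    generalize θ (a, b) (a, b + 1) = x3 at *
    generalize θ (a, b + 1) (a + 1, b + 1) = x4 at *
    generalize θ (a + 1, b) (a, b + 1) = x5 at *
    revert x1 x2 x3 x4 x5
    decide
  have hh : ∀ a b : ℤ, H (a + 1, b) = H (a, b) + θ (a, b) (a + 1, b) := by
    intro a b
    induction b using Int.induction_on with
    | zero =>
      simp only [H, hf]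
      have := two (col a 0)
      have := two (col (a + 1) 0)
      linear_combination this - two (col a 0)
    | succ b ih =>
      rw [hv, hv, ih]
      linear_combination face a b
    | pred b ih =>
      have h1 := hv a (-b - 1)
      have h2 := hv (a + 1) (-b - 1)
      have h3 := face a (-b - 1)
      rw [sub_add_cancel] at h1 h2 h3
      rw [h1, h2] at ih
      linear_combination ih - h3
  have hd : ∀ a b : ℤ, H (a + 1, b) = H (a, b + 1) + θ (a + 1, b) (a, b + 1) := by
    intro a b
    have h1 := h ((a, b), false)
    simp only [coboundary, Bool.false_eq_true, if_false] at h1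
    rw [hh, hv]
    linear_combination h1 - two (θ (a, b) (a, b + 1)) - two (θ (a + 1, b) (a, b + 1))
  refine ⟨H, fun u v huv => ?_⟩
  obtain ⟨a, b⟩ := u
  obtain ⟨a', b'⟩ := v
  rw [adj_iff] at huv
  simp only at huv
  rcases huv with ⟨rfl, rfl⟩ | ⟨rfl, rfl⟩ | ⟨rfl, rfl⟩ | ⟨rfl, rfl⟩ | ⟨rfl, rfl⟩ | ⟨rfl, rfl⟩
  · rw [hh]; linear_combination two (H (a, b'))
  · rw [hv]; linear_combination two (H (a', b))
  · have := hd (a - 1) b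
    rw [sub_add_cancel] at this
    rw [this]; linear_combination two (H (a - 1, b + 1))
  · have := hh (a - 1) b'
    rw [sub_add_cancel] at this
    rw [this, hs]; linear_combination two (H (a - 1, b'))
  · have := hv a' (b - 1)
    rw [sub_add_cancel] at this
    rw [this, hs]; linear_combination two (H (a', b - 1))
  · have := hd a (b - 1)
    rw [sub_add_cancel] at this
    rw [this, hs]; linear_combination two (H (a, b))

/-- The `1`-form modulo two dual to a single edge. -/
def edgeInd (p q u v : Vertex) : ZMod 2 := if (u = p ∧ v = q) ∨ (u = q ∧ v = p) then 1 else 0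

theorem edgeInd_symm (p q u v : Vertex) : edgeInd p q u v = edgeInd p q v u := by
  unfold edgeInd
  congr 1
  apply propext
  tauto

/-- The face to the left of a directed edge. -/
def leftFace (u v : Vertex) : Vertex × Bool :=
  if v.1 = u.1 + 1 ∧ v.2 = u.2 then (u, false)
  else if v.1 = u.1 ∧ v.2 = u.2 + 1 then ((u.1 - 1, u.2), true)
  else if v.1 = u.1 - 1 ∧ v.2 = u.2 + 1 then ((u.1 - 1, u.2), false)
  else if v.1 = u.1 - 1 ∧ v.2 = u.2 then ((u.1 - 1, u.2 - 1), true)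
  else if v.1 = u.1 ∧ v.2 = u.2 - 1 then ((u.1, u.2 - 1), false)
  else ((u.1, u.2 - 1), true)

theorem leftFace_eq (a b c d : ℤ) :
    (c = a + 1 ∧ d = b → leftFace (a, b) (c, d) = ((a, b), false)) ∧
    (c = a ∧ d = b + 1 → leftFace (a, b) (c, d) = ((a - 1, b), true)) ∧
    (c = a - 1 ∧ d = b + 1 → leftFace (a, b) (c, d) = ((a - 1, b), false)) ∧
    (c = a - 1 ∧ d = b → leftFace (a, b) (c, d) = ((a - 1, b - 1), true)) ∧
    (c = a ∧ d = b - 1 → leftFace (a, b) (c, d) = ((a, b - 1), false)) ∧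
    (c = a + 1 ∧ d = b - 1 → leftFace (a, b) (c, d) = ((a, b - 1), true)) := by
  simp only [leftFace]
  refine ⟨?_, ?_, ?_, ?_, ?_, ?_⟩ <;> intro h <;> split_ifs <;> first | rfl | (exfalso; omega)

theorem leftFace_apex {u v : Vertex} (h : Adj u v) : leftFace v (apex u v) = leftFace u v := by
  rw [adj_iff] at h
  obtain ⟨a, b⟩ := u
  obtain ⟨c, d⟩ := v
  simp only at h
  obtain ⟨p1, p2, p3, p4, p5, p6⟩ := leftFace_eq a b c d
  obtain ⟨q1, q2, q3, q4, q5, q6⟩ := leftFace_eq c d (a - (d - b)) (b + (c - a) + (d - b))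
  simp only [apex]
  rcases h with h | h | h | h | h | h
  · rw [p1 h, q3 (by omega)]; congr 2 <;> omega
  · rw [p2 h, q4 (by omega)]; congr 2 <;> omega
  · rw [p3 h, q5 (by omega)]; congr 2 <;> omega
  · rw [p4 h, q6 (by omega)]; congr 2 <;> omega
  · rw [p5 h, q1 (by omega)]; congr 2 <;> omega
  · rw [p6 h, q2 (by omega)]; congr 2 <;> omega

theorem leftFace_apex' {u v : Vertex} (h : Adj u v) : leftFace (apex u v) u = leftFace u v := by
  rw [← leftFace_apex h, ← leftFace_apex h.apex_right, apex_apex]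

theorem edgeInd_comm (p q u v : Vertex) : edgeInd q p u v = edgeInd p q u v := by
  unfold edgeInd
  congr 1
  apply propext
  tauto

/-- The three directions in the hypothesis represent every undirected edge once; the opposite ones
follow from the symmetry of `edgeInd`. -/
theorem coboundary_edgeInd_aux {p q : Vertex} (F : Vertex × Bool)
    (h : (q.1 = p.1 + 1 ∧ q.2 = p.2) ∨ (q.1 = p.1 ∧ q.2 = p.2 + 1) ∨
      (q.1 = p.1 - 1 ∧ q.2 = p.2 + 1)) :
    coboundary (edgeInd p q) F =
      (if F = leftFace p q then 1 else 0) + (if F = leftFace q p then 1 else 0) := by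
  obtain ⟨⟨x, y⟩, F⟩ := F
  obtain ⟨a, b⟩ := p
  obtain ⟨a', b'⟩ := q
  simp only at h
  have key : ∀ {a b c d x y z w : ℤ} (Q : Prop) [Decidable Q],
      ((((x = a ∧ y = b) ∧ z = c ∧ w = d) ∨ ((x = c ∧ y = d) ∧ z = a ∧ w = b)) ↔ Q) →
      edgeInd (a, b) (c, d) (x, y) (z, w) = if Q then 1 else 0 := by
    intro a b c d x y z w Q _ h
    simp only [edgeInd, Prod.mk.injEq, h]
  have key0 : ∀ {a b c d x y z w : ℤ},
      ¬ (((x = a ∧ y = b) ∧ z = c ∧ w = d) ∨ ((x = c ∧ y = d) ∧ z = a ∧ w = b)) →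
      edgeInd (a, b) (c, d) (x, y) (z, w) = 0 := by
    intro a b c d x y z w h
    simp only [edgeInd, Prod.mk.injEq, h, if_false]
  rcases h with ⟨rfl, rfl⟩ | ⟨rfl, rfl⟩ | ⟨rfl, rfl⟩
  · have e1 : leftFace (a, b') (a + 1, b') = ((a, b'), false) :=
      (leftFace_eq a b' (a + 1) b').1 (by omega)
    have e2 : leftFace (a + 1, b') (a, b') = ((a, b' - 1), true) := by
      rw [(leftFace_eq (a + 1) b' a b').2.2.2.1 (by omega)]
      congr 2 <;> omega
    rw [e1, e2]
    cases F <;> simp only [coboundary, Prod.mk.injEq, Bool.false_eq_true, if_false, if_true,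
      and_true, and_false, reduceCtorEq]
    · rw [show edgeInd (a, b') (a + 1, b') (x, y) (x + 1, y) = _ from key (x = a ∧ y = b') (by omega),
        show edgeInd (a, b') (a + 1, b') (x, y) (x, y + 1) = 0 from key0 (by omega),
        show edgeInd (a, b') (a + 1, b') (x + 1, y) (x, y + 1) = 0 from key0 (by omega)]
      simp
    · rw [show edgeInd (a, b') (a + 1, b') (x + 1, y) (x, y + 1) = 0 from key0 (by omega),
        show edgeInd (a, b') (a + 1, b') (x + 1, y) (x + 1, y + 1) = 0 from key0 (by omega),
        show edgeInd (a, b') (a + 1, b') (x, y + 1) (x + 1, y + 1) = _ from key (x = a ∧ y = b' - 1) (by omega)]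
      simp
  · have e1 : leftFace (a', b) (a', b + 1) = ((a' - 1, b), true) :=
      (leftFace_eq a' b a' (b + 1)).2.1 (by omega)
    have e2 : leftFace (a', b + 1) (a', b) = ((a', b), false) := by
      rw [(leftFace_eq a' (b + 1) a' b).2.2.2.2.1 (by omega)]
      congr 2 <;> omega
    rw [e1, e2]
    cases F <;> simp only [coboundary, Prod.mk.injEq, Bool.false_eq_true, if_false, if_true,
      and_true, and_false, reduceCtorEq]
    · rw [show edgeInd (a', b) (a', b + 1) (x, y) (x + 1, y) = 0 from key0 (by omega),
        show edgeInd (a', b) (a', b + 1) (x, y) (x, y + 1) = _ from key (x = a' ∧ y = b) (by omega),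
        show edgeInd (a', b) (a', b + 1) (x + 1, y) (x, y + 1) = 0 from key0 (by omega)]
      simp
    · rw [show edgeInd (a', b) (a', b + 1) (x + 1, y) (x, y + 1) = 0 from key0 (by omega),
        show edgeInd (a', b) (a', b + 1) (x + 1, y) (x + 1, y + 1) = _ from key (x = a' - 1 ∧ y = b) (by omega),
        show edgeInd (a', b) (a', b + 1) (x, y + 1) (x + 1, y + 1) = 0 from key0 (by omega)]
      simp
  · have e1 : leftFace (a, b) (a - 1, b + 1) = ((a - 1, b), false) :=
      (leftFace_eq a b (a - 1) (b + 1)).2.2.1 (by omega)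
    have e2 : leftFace (a - 1, b + 1) (a, b) = ((a - 1, b), true) := by
      rw [(leftFace_eq (a - 1) (b + 1) a b).2.2.2.2.2 (by omega)]
      congr 2 <;> omega
    rw [e1, e2]
    cases F <;> simp only [coboundary, Prod.mk.injEq, Bool.false_eq_true, if_false, if_true,
      and_true, and_false, reduceCtorEq]
    · rw [show edgeInd (a, b) (a - 1, b + 1) (x, y) (x + 1, y) = 0 from key0 (by omega),
        show edgeInd (a, b) (a - 1, b + 1) (x, y) (x, y + 1) = 0 from key0 (by omega),
        show edgeInd (a, b) (a - 1, b + 1) (x + 1, y) (x, y + 1) = _ from key (x = a - 1 ∧ y = b) (by omega)]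
      simp
    · rw [show edgeInd (a, b) (a - 1, b + 1) (x + 1, y) (x, y + 1) = _ from key (x = a - 1 ∧ y = b) (by omega),
        show edgeInd (a, b) (a - 1, b + 1) (x + 1, y) (x + 1, y + 1) = 0 from key0 (by omega),
        show edgeInd (a, b) (a - 1, b + 1) (x, y + 1) (x + 1, y + 1) = 0 from key0 (by omega)]
      simp

/-- This makes dual paths telescope: in a sum over successively crossed edges only the first and the
last face survive. -/
theorem coboundary_edgeInd {p q : Vertex} (h : Adj p q) (F : Vertex × Bool) :
    coboundary (edgeInd p q) F =
      (if F = leftFace p q then 1 else 0) + (if F = leftFace q p then 1 else 0) := by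
  rw [adj_iff] at h
  by_cases h' : (q.1 = p.1 + 1 ∧ q.2 = p.2) ∨ (q.1 = p.1 ∧ q.2 = p.2 + 1) ∨
      (q.1 = p.1 - 1 ∧ q.2 = p.2 + 1)
  · exact coboundary_edgeInd_aux F h'
  · have : edgeInd p q = edgeInd q p := by
      funext u v; exact (edgeInd_comm _ _ _ _).symm
    rw [this, coboundary_edgeInd_aux F (by omega), add_comm]

theorem coboundary_add (θ θ' : Vertex → Vertex → ZMod 2) (F : Vertex × Bool) :
    coboundary (θ + θ') F = coboundary θ F + coboundary θ' F := by
  unfold coboundary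
  split_ifs <;> simp only [Pi.add_apply] <;> ring

theorem coboundary_sum {ι : Type*} (s : Finset ι) (θ : ι → Vertex → Vertex → ZMod 2)
    (F : Vertex × Bool) : coboundary (∑ i ∈ s, θ i) F = ∑ i ∈ s, coboundary (θ i) F := by
  classical
  induction s using Finset.induction_on with
  | empty => simp [coboundary]
  | insert a s ha ih => rw [Finset.sum_insert ha, Finset.sum_insert ha, coboundary_add, ih]

/-- Two faces are joined by a dual path that crosses only edges which touch `S`. -/
def FaceLinked (S : Set Vertex) (F G : Vertex × Bool) : Prop :=
  ∃ θ : Vertex → Vertex → ZMod 2, (∀ u v, θ u v = θ v u) ∧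
    (∀ u v, u ∉ S → v ∉ S → θ u v = 0) ∧
    ∀ K, coboundary θ K = (if K = F then 1 else 0) + (if K = G then 1 else 0)

theorem FaceLinked.refl (S : Set Vertex) (F : Vertex × Bool) : FaceLinked S F F :=
  ⟨0, fun _ _ => rfl, fun _ _ _ _ => rfl, fun K => by
    rw [CharTwo.add_self_eq_zero]; simp [coboundary]⟩

theorem FaceLinked.symm {S : Set Vertex} {F G : Vertex × Bool} (h : FaceLinked S F G) :
    FaceLinked S G F := by
  obtain ⟨θ, h1, h2, h3⟩ := h
  exact ⟨θ, h1, h2, fun K => by rw [h3, add_comm]⟩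

theorem FaceLinked.trans {S : Set Vertex} {F G K : Vertex × Bool} (h : FaceLinked S F G)
    (h' : FaceLinked S G K) : FaceLinked S F K := by
  obtain ⟨θ, h1, h2, h3⟩ := h
  obtain ⟨θ', h1', h2', h3'⟩ := h'
  refine ⟨θ + θ', fun u v => ?_, fun u v hu hv => ?_, fun L => ?_⟩
  · simp only [Pi.add_apply]; rw [h1, h1']
  · simp only [Pi.add_apply]; rw [h2 u v hu hv, h2' u v hu hv, add_zero]
  · rw [coboundary_add, h3, h3']
    linear_combination CharTwo.add_self_eq_zero (if L = G then (1 : ZMod 2) else 0)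

theorem faceLinked_of_adj {S : Set Vertex} {u v : Vertex} (h : Adj u v) (hS : u ∈ S ∨ v ∈ S) :
    FaceLinked S (leftFace u v) (leftFace v u) := by
  refine ⟨edgeInd u v, edgeInd_symm u v, fun x y hx hy => ?_, coboundary_edgeInd h⟩
  unfold edgeInd
  rw [if_neg]
  rintro (⟨rfl, rfl⟩ | ⟨rfl, rfl⟩) <;> tauto

theorem faceLinked_turn {S : Set Vertex} {u v : Vertex} (h : Adj u v) (hS : u ∈ S) :
    FaceLinked S (leftFace u v) (leftFace u (apex u v)) := by
  have := faceLinked_of_adj (S := S) h.apex_left (Or.inl hS)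
  rw [leftFace_apex' h] at this
  exact this.symm

/-- Iterating `apex u` runs through the six neighbours of `u`, and consecutive faces around `u` are
separated by an edge that ends at `u`. -/
theorem faceLinked_around {S : Set Vertex} {u v w : Vertex} (hv : Adj u v) (hw : Adj u w)
    (hS : u ∈ S) : FaceLinked S (leftFace u v) (leftFace u w) := by
  have h1 := faceLinked_turn hv hS
  have h2 := faceLinked_turn hv.apex_left hS
  have h3 := faceLinked_turn hv.apex_left.apex_left hS
  have h4 := faceLinked_turn hv.apex_left.apex_left.apex_left hS
  have h5 := faceLinked_turn hv.apex_left.apex_left.apex_left.apex_left hS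
  have hcases : w = v ∨ w = apex u v ∨ w = apex u (apex u v) ∨ w = apex u (apex u (apex u v)) ∨
      w = apex u (apex u (apex u (apex u v))) ∨
      w = apex u (apex u (apex u (apex u (apex u v)))) := by
    rw [adj_iff] at hv hw
    simp only [Prod.ext_iff, apex_fst, apex_snd]
    obtain ⟨a, b⟩ := u
    obtain ⟨c, d⟩ := v
    obtain ⟨e, f⟩ := w
    simp only at *
    rcases hv with ⟨rfl, rfl⟩ | ⟨rfl, rfl⟩ | ⟨rfl, rfl⟩ | ⟨rfl, rfl⟩ | ⟨rfl, rfl⟩ | ⟨rfl, rfl⟩ <;>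
    rcases hw with ⟨rfl, rfl⟩ | ⟨rfl, rfl⟩ | ⟨rfl, rfl⟩ | ⟨rfl, rfl⟩ | ⟨rfl, rfl⟩ | ⟨rfl, rfl⟩ <;>
    omega
  rcases hcases with rfl | rfl | rfl | rfl | rfl | rfl
  · exact FaceLinked.refl _ _
  · exact h1
  · exact h1.trans h2
  · exact (h1.trans h2).trans h3
  · exact ((h1.trans h2).trans h3).trans h4
  · exact (((h1.trans h2).trans h3).trans h4).trans h5

/-- Two vertices of `S` are joined by a path in `S`. -/
def LinkedIn (S : Set Vertex) : Vertex → Vertex → Prop :=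
  Relation.ReflTransGen fun u v => Adj u v ∧ v ∈ S

/-- The dual path follows the path in `S` by turning around each of its vertices. The face to the
left of an edge touches both ends, so the change from one vertex to the next crosses nothing. -/
theorem faceLinked_of_linkedIn {S : Set Vertex} {u v u' v' : Vertex} (hu : u ∈ S)
    (h : LinkedIn S u v) (hu' : Adj u u') (hv' : Adj v v') :
    FaceLinked S (leftFace u u') (leftFace v v') := by
  have hv : v ∈ S := by
    induction h with
    | refl => exact hu
    | tail _ h _ => exact h.2
  induction h generalizing v' with
  | refl => exact faceLinked_around hu' hv' hu
  | @tail v w huv hvw ih =>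
    have hvS : v ∈ S := by
      cases huv with
      | refl => exact hu
      | tail _ h => exact h.2
    refine (ih hvw.1 hvS).trans ?_
    rw [← leftFace_apex hvw.1]
    exact faceLinked_around hvw.1.apex_right hv' hv

/-- The colouring modulo two of the vertices on the two sides of a dual path which is closed up
through faces touching `S`. -/
theorem exists_separating_potential {S : Set Vertex} {t h : ℕ → Vertex} {n : ℕ}
    (hadj : ∀ i ≤ n, Adj (t i) (h i))
    (hstep : ∀ i < n, (t (i + 1) = t i ∧ h (i + 1) = apex (t i) (h i)) ∨
      (t (i + 1) = apex (t i) (h i) ∧ h (i + 1) = h i))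
    {x : Vertex} (hx : x = t 0 ∨ x = h 0) (hxS : x ∈ S)
    (hlink : LinkedIn S x (apex (t n) (h n))) :
    ∃ H : Vertex → ZMod 2, ∀ u v, Adj u v → u ∉ S → v ∉ S →
      H u + H v = ∑ i ∈ Finset.range (n + 1), edgeInd (t i) (h i) u v := by
  -- The return path, from the face behind the first edge to the face ahead of the last one; both
  -- touch a vertex of `S`.
  have hL : FaceLinked S (leftFace (h 0) (t 0)) (leftFace (t n) (h n)) := by
    have hn := hadj n le_rfl
    have h0 := hadj 0 (Nat.zero_le _)
    have e1 : leftFace (t n) (h n) = leftFace (apex (t n) (h n)) (t n) := (leftFace_apex' hn).symm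
    rw [e1]
    rcases hx with rfl | rfl
    · rw [← leftFace_apex h0.symm]
      exact faceLinked_of_linkedIn hxS hlink h0.symm.apex_right hn.apex_left.symm
    · exact faceLinked_of_linkedIn hxS hlink h0.symm hn.apex_left.symm
  obtain ⟨θ, hs, h0, hb⟩ := hL
  have hγ : ∀ k ≤ n, ∀ K, ∑ i ∈ Finset.range (k + 1), coboundary (edgeInd (t i) (h i)) K =
      (if K = leftFace (h 0) (t 0) then 1 else 0) + (if K = leftFace (t k) (h k) then 1 else 0) := by
    intro k hk K
    induction k with
    | zero => simp [coboundary_edgeInd (hadj 0 hk), add_comm]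
    | succ k ih =>
      rw [Finset.sum_range_succ, ih (by omega), coboundary_edgeInd (hadj (k + 1) hk)]
      -- The face behind the next edge is the triangle just traversed, so the sum telescopes.
      have : leftFace (h (k + 1)) (t (k + 1)) = leftFace (t k) (h k) := by
        have ha := hadj k (by omega)
        rcases hstep k (by omega) with ⟨e1, e2⟩ | ⟨e1, e2⟩
        · rw [e1, e2, leftFace_apex' ha]
        · rw [e1, e2, leftFace_apex ha]
      rw [this]
      linear_combination CharTwo.add_self_eq_zero (if K = leftFace (t k) (h k) then (1 : ZMod 2) else 0)
  obtain ⟨H, hH⟩ := exists_potential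
    (∑ i ∈ Finset.range (n + 1), edgeInd (t i) (h i) + θ)
    (fun u v => by
      simp only [Pi.add_apply, Finset.sum_apply]
      rw [hs u v]
      congr 1
      exact Finset.sum_congr rfl fun i _ => edgeInd_symm _ _ _ _)
    (fun K => by
      rw [coboundary_add, coboundary_sum, hγ n le_rfl, hb, CharTwo.add_self_eq_zero])
  refine ⟨H, fun u v huv hu hv => ?_⟩
  rw [hH u v huv]
  simp only [Pi.add_apply, Finset.sum_apply]
  rw [h0 u v hu hv, add_zero]

/-! ### Hexagons -/

/-- The vertices of the hexagon of radius `s` around the origin, in counterclockwise order. -/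
def hexPoint (s j : ℤ) : Vertex :=
  if j ≤ s then (s - j, j) else if j ≤ 2 * s then (s - j, s) else if j ≤ 3 * s then (-s, 3 * s - j)
  else if j ≤ 4 * s then (j - 4 * s, 3 * s - j) else if j ≤ 5 * s then (j - 4 * s, -s)
  else (s, j - 6 * s)

/-- The position of a vertex on its hexagon. -/
def hexIndex (s : ℤ) (v : Vertex) : ℤ :=
  if 0 < v.1 ∧ 0 ≤ v.2 then v.2 else if v.1 ≤ 0 ∧ 0 < v.1 + v.2 then s - v.1
  else if v.1 < 0 then 3 * s - v.2 else if v.1 + v.2 < 0 then 4 * s + v.1 else 6 * s + v.2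

/-- `v` lies on the hexagon of radius `s` around the origin. -/
def OnHex (s : ℤ) (v : Vertex) : Prop :=
  ((-s ≤ v.1 ∧ v.1 ≤ s) ∧ (-s ≤ v.2 ∧ v.2 ≤ s) ∧ (-s ≤ v.1 + v.2 ∧ v.1 + v.2 ≤ s)) ∧
    (v.1 = s ∨ v.1 = -s ∨ v.2 = s ∨ v.2 = -s ∨ v.1 + v.2 = s ∨ v.1 + v.2 = -s)

theorem hexPoint_cases (s j : ℤ) : (j ≤ s ∧ hexPoint s j = (s - j, j)) ∨
    (s < j ∧ j ≤ 2 * s ∧ hexPoint s j = (s - j, s)) ∨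
    (2 * s < j ∧ j ≤ 3 * s ∧ hexPoint s j = (-s, 3 * s - j)) ∨
    (3 * s < j ∧ j ≤ 4 * s ∧ hexPoint s j = (j - 4 * s, 3 * s - j)) ∨
    (4 * s < j ∧ j ≤ 5 * s ∧ hexPoint s j = (j - 4 * s, -s)) ∨
    (5 * s < j ∨ s < 0) ∧ hexPoint s j = (s, j - 6 * s) := by
  unfold hexPoint
  split_ifs <;> simp <;> omega

theorem onHex_hexPoint {s j : ℤ} (hs : 0 < s) (h0 : 0 ≤ j) (h6 : j ≤ 6 * s) :
    OnHex s (hexPoint s j) := by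
  unfold OnHex
  rcases hexPoint_cases s j with h | h | h | h | h | h
  · rw [h.2]; omega
  · rw [h.2.2]; omega
  · rw [h.2.2]; omega
  · rw [h.2.2]; omega
  · rw [h.2.2]; omega
  · rw [h.2]; omega

theorem hexIndex_hexPoint {s j : ℤ} (hs : 0 < s) (h0 : 0 ≤ j) (h6 : j < 6 * s) :
    hexIndex s (hexPoint s j) = j := by
  unfold hexIndex
  rcases hexPoint_cases s j with h | h | h | h | h | h
  · rw [h.2]; simp only; split_ifs <;> omega
  · rw [h.2.2]; simp only; split_ifs <;> omega
  · rw [h.2.2]; simp only; split_ifs <;> omega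
  · rw [h.2.2]; simp only; split_ifs <;> omega
  · rw [h.2.2]; simp only; split_ifs <;> omega
  · rw [h.2]; simp only; split_ifs <;> omega

theorem hexIndex_mem {s : ℤ} {v : Vertex} (hs : 0 < s) (h : OnHex s v) :
    0 ≤ hexIndex s v ∧ hexIndex s v < 6 * s := by
  unfold OnHex at h
  unfold hexIndex
  split_ifs <;> omega

theorem hexPoint_hexIndex {s : ℤ} {v : Vertex} (hs : 0 < s) (h : OnHex s v) :
    hexPoint s (hexIndex s v) = v := by
  unfold OnHex at h
  unfold hexIndex hexPoint
  obtain ⟨a, b⟩ := v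
  simp only at *
  split_ifs <;> first | (exfalso; omega) | (refine Prod.ext ?_ ?_ <;> simp only <;> omega)

theorem adj_hexPoint {s j : ℤ} (hs : 0 < s) (h0 : 0 ≤ j) (h6 : j < 6 * s) :
    Adj (hexPoint s j) (hexPoint s (j + 1)) := by
  rw [adj_iff]
  rcases hexPoint_cases s j with h | h | h | h | h | h <;>
  rcases hexPoint_cases s (j + 1) with h' | h' | h' | h' | h' | h' <;>
  · simp only [h, h', and_true, true_and]
    try omega

/-- A hexagon is an induced cycle: no edge of the grid is a chord of it. The last two alternatives
are the place where the numbering closes up. -/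
theorem hexIndex_of_adj {s : ℤ} {u v : Vertex} (hs : 0 < s) (hu : OnHex s u) (hv : OnHex s v)
    (h : Adj u v) : hexIndex s v = hexIndex s u + 1 ∨ hexIndex s u = hexIndex s v + 1 ∨
      (hexIndex s v = 0 ∧ hexIndex s u = 6 * s - 1) ∨
      (hexIndex s u = 0 ∧ hexIndex s v = 6 * s - 1) := by
  rw [adj_iff] at h
  unfold OnHex at hu hv
  obtain ⟨a, b⟩ := u
  obtain ⟨c, d⟩ := v
  simp only [hexIndex] at *
  rcases h with ⟨rfl, rfl⟩ | ⟨rfl, rfl⟩ | ⟨rfl, rfl⟩ | ⟨rfl, rfl⟩ | ⟨rfl, rfl⟩ | ⟨rfl, rfl⟩ <;>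
  split_ifs <;> omega

theorem onHex_iff {o v : Vertex} {s : ℕ} : OnHex s (v - o) ↔ hexNorm (v - o) = s :=
  hexNorm_eq_iff.symm

/-- A hexagon is a cycle of length `6 * s`, which can be traversed from any of its vertices. -/
theorem exists_hexCycle {o x : Vertex} {s : ℕ} (hs : 0 < s) (hx : hexNorm (x - o) = s) :
    ∃ C : ℕ → Vertex, C 0 = x ∧ C (6 * s) = x ∧ (∀ j < 6 * s, Adj (C j) (C (j + 1))) ∧
      (∀ j ≤ 6 * s, hexNorm (C j - o) = s) ∧
      (∀ i j, i < 6 * s → j < 6 * s → C i = C j → i = j) ∧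
      (∀ v, hexNorm (v - o) = s → ∃ j < 6 * s, C j = v) ∧
      ∀ u v, Adj u v → hexNorm (u - o) = s → hexNorm (v - o) = s →
        ∃ j < 6 * s, (u = C j ∧ v = C (j + 1)) ∨ (u = C (j + 1) ∧ v = C j) := by
  have hs' : (0 : ℤ) < s := by omega
  rw [← onHex_iff] at hx
  set k := hexIndex s (x - o) with hk
  obtain ⟨hk0, hk6⟩ := hexIndex_mem hs' hx
  rw [← hk] at hk0 hk6
  -- Rotating the numbering by the index of `x`, modulo `6 * s`, makes the cycle start at `x`.
  let r : ℕ → ℤ := fun j => if k + j < 6 * s then k + j else k + j - 6 * s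
  have hr : ∀ j : ℕ, r j = if k + j < 6 * s then k + j else k + j - 6 * s := fun _ => rfl
  have r0 : ∀ j : ℕ, j ≤ 6 * s → 0 ≤ r j ∧ r j < 6 * s := by
    intro j hj; rw [hr]; split_ifs <;> omega
  have hwrap : hexPoint s (6 * s) = hexPoint s 0 := by
    unfold hexPoint
    split_ifs <;> first | (exfalso; omega) | (refine Prod.ext ?_ ?_ <;> simp only <;> omega)
  have hsucc : ∀ j : ℕ, j < 6 * s → hexPoint s (r (j + 1)) = hexPoint s (r j + 1) := by
    intro j hj
    by_cases h : r j + 1 = 6 * s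
    · rw [h, hwrap]
      congr 1
      rw [hr] at h ⊢
      push_cast
      split_ifs at h ⊢ <;> omega
    · congr 1
      rw [hr] at h ⊢
      rw [hr]
      push_cast
      split_ifs at h ⊢ <;> omega
  have hidx : ∀ j : ℕ, j ≤ 6 * s → hexIndex s (hexPoint s (r j)) = r j :=
    fun j hj => hexIndex_hexPoint hs' (r0 j hj).1 (r0 j hj).2
  have hsurj : ∀ i : ℤ, 0 ≤ i → i < 6 * s → ∃ j : ℕ, j < 6 * s ∧ r j = i := by
    intro i h0 h6
    by_cases h : k ≤ i
    · refine ⟨(i - k).toNat, by omega, ?_⟩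
      rw [hr]; split_ifs <;> omega
    · refine ⟨(i - k + 6 * s).toNat, by omega, ?_⟩
      rw [hr]; split_ifs <;> omega
  refine ⟨fun j => o + hexPoint s (r j), ?_, ?_, ?_, ?_, ?_, ?_, ?_⟩
  · have : r 0 = k := by rw [hr]; split_ifs <;> omega
    simp only [this, hk]
    rw [hexPoint_hexIndex hs' hx]; abel
  · have : r (6 * s) = k := by rw [hr]; push_cast; split_ifs <;> omega
    simp only [this, hk]
    rw [hexPoint_hexIndex hs' hx]; abel
  · intro j hj
    have := adj_hexPoint hs' (r0 j hj.le).1 (r0 j hj.le).2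
    rw [← hsucc j hj] at this
    unfold Adj at *
    rwa [add_sub_add_left_eq_sub]
  · intro j hj
    rw [← onHex_iff, add_sub_cancel_left]
    exact onHex_hexPoint hs' (r0 j hj).1 (r0 j hj).2.le
  · intro i j hi hj h
    have := congrArg (hexIndex s) (add_left_cancel h)
    rw [hidx i hi.le, hidx j hj.le, hr, hr] at this
    split_ifs at this <;> omega
  · intro v hv
    rw [← onHex_iff] at hv
    obtain ⟨j, hj, e⟩ := hsurj _ (hexIndex_mem hs' hv).1 (hexIndex_mem hs' hv).2
    refine ⟨j, hj, ?_⟩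
    simp only [e]
    rw [hexPoint_hexIndex hs' hv]; abel
  · intro u v huv hu hv
    rw [← onHex_iff] at hu hv
    have hadj : Adj (u - o) (v - o) := by unfold Adj at *; rwa [sub_sub_sub_cancel_right]
    have key : ∀ u v : Vertex, OnHex s (u - o) → OnHex s (v - o) →
        (hexIndex s (v - o) = hexIndex s (u - o) + 1 ∨
          (hexIndex s (v - o) = 0 ∧ hexIndex s (u - o) = 6 * s - 1)) →
        ∃ j < 6 * s, u = o + hexPoint s (r j) ∧ v = o + hexPoint s (r (j + 1)) := by
      intro u v hu hv h
      obtain ⟨j, hj, e⟩ := hsurj _ (hexIndex_mem hs' hu).1 (hexIndex_mem hs' hu).2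
      refine ⟨j, hj, ?_, ?_⟩
      · rw [e, hexPoint_hexIndex hs' hu]; abel
      · rw [hsucc j hj, e]
        rcases h with h | h
        · rw [← h, hexPoint_hexIndex hs' hv]; abel
        · rw [h.2, sub_add_cancel, hwrap, ← h.1, hexPoint_hexIndex hs' hv]; abel
    rcases hexIndex_of_adj hs' hu hv hadj with h | h | h | h
    · obtain ⟨j, hj, h⟩ := key u v hu hv (Or.inl h); exact ⟨j, hj, Or.inl h⟩
    · obtain ⟨j, hj, h⟩ := key v u hv hu (Or.inl h); exact ⟨j, hj, Or.inr ⟨h.2, h.1⟩⟩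
    · obtain ⟨j, hj, h⟩ := key u v hu hv (Or.inr h); exact ⟨j, hj, Or.inl h⟩
    · obtain ⟨j, hj, h⟩ := key v u hv hu (Or.inr h); exact ⟨j, hj, Or.inr ⟨h.2, h.1⟩⟩

theorem exists_adj_hexNorm_lt {o v : Vertex} (h : hexNorm (v - o) ≠ 0) :
    ∃ w, Adj v w ∧ hexNorm (w - o) + 1 = hexNorm (v - o) := by
  obtain ⟨a, b⟩ := v
  obtain ⟨p, q⟩ := o
  have key : ∀ c d : ℤ, Adj (a, b) (c, d) →
      hexNorm ((c, d) - (p, q)) + 1 = hexNorm ((a, b) - (p, q)) →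
      ∃ w, Adj (a, b) w ∧ hexNorm (w - (p, q)) + 1 = hexNorm ((a, b) - (p, q)) :=
    fun c d h1 h2 => ⟨_, h1, h2⟩
  simp only [adj_iff, hexNorm, Prod.fst_sub, Prod.snd_sub] at *
  by_cases h1 : p < a ∧ q ≤ b
  · exact key (a - 1) b (by omega) (by omega)
  by_cases h2 : a < p ∧ b ≤ q
  · exact key (a + 1) b (by omega) (by omega)
  by_cases h3 : p ≤ a ∧ b < q
  · by_cases h4 : p = a
    · exact key a (b + 1) (by omega) (by omega)
    · exact key (a - 1) (b + 1) (by omega) (by omega)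
  · by_cases h4 : p = a
    · exact key a (b - 1) (by omega) (by omega)
    · exact key (a + 1) (b - 1) (by omega) (by omega)

/-- Every vertex has a neighbour one step closer to `o`, so descending paths to `o` stay in the
ball. -/
theorem linkedIn_ball {S : Set Vertex} {o : Vertex} {m : ℕ} (hS : ∀ v, hexNorm (v - o) ≤ m → v ∈ S)
    {u v : Vertex} (hu : hexNorm (u - o) ≤ m) (hv : hexNorm (v - o) ≤ m) : LinkedIn S u v := by
  have key : ∀ k : ℕ, ∀ v, hexNorm (v - o) = k → k ≤ m → LinkedIn S o v ∧ LinkedIn S v o := by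
    intro k
    induction k with
    | zero =>
      intro v hv _
      have : v = o := by
        unfold hexNorm at hv
        simp only [Prod.fst_sub, Prod.snd_sub] at hv
        ext <;> omega
      subst this
      exact ⟨Relation.ReflTransGen.refl, Relation.ReflTransGen.refl⟩
    | succ k ih =>
      intro v hv hk
      obtain ⟨w, hw, hw'⟩ := exists_adj_hexNorm_lt (o := o) (v := v) (by omega)
      obtain ⟨h1, h2⟩ := ih w (by omega) (by omega)
      exact ⟨h1.tail ⟨hw.symm, hS v (by omega)⟩, Relation.ReflTransGen.head ⟨hw, hS w (by omega)⟩ h2⟩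
  exact (key _ u rfl hu).2.trans (key _ v rfl hv).1

/-! ### Exploration paths that come close to a point -/

/-- A path of edges `{a i, b i}`, each reached from the previous one through the triangle with the
additional vertex `c i`, which starts outside the ball of radius `R` around `o` and reaches the
ball of radius `m`. The vertices in `Bd` form the part of the boundary that has the colour of the
`b i`, and inside the ball of radius `R` this is the only part of the boundary of `Q`. -/
structure Crossing (o : Vertex) (m R n : ℕ) (a b c : ℕ → Vertex) (Q Bd : Set Vertex) : Prop where
  adj : ∀ i ≤ n, Adj (a i) (b i)
  orient : (∀ i, c i = apex (a i) (b i)) ∨ ∀ i, c i = apex (b i) (a i)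
  step : ∀ i < n, (a (i + 1) = a i ∧ b (i + 1) = c i) ∨ (a (i + 1) = c i ∧ b (i + 1) = b i)
  inj : ∀ i ≤ n, ∀ j ≤ n, a i = a j → b i = b j → i = j
  a_notMem : ∀ i ≤ n, a i ∉ Bd
  a_ne_b : ∀ i ≤ n, ∀ j ≤ n, a i ≠ b j
  lt_a : ∀ i ≤ n, m < hexNorm (a i - o)
  lt_b : ∀ i ≤ n, m < hexNorm (b i - o)
  start : R < hexNorm (a 0 - o)
  hit : hexNorm (c n - o) ≤ m
  mem_Q : a n ∈ Q
  Q_disj : ∀ x ∈ Q, x ∉ Bd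
  Q_step : ∀ x ∈ Q, ∀ y, Adj x y → hexNorm (y - o) ≤ R → y ∈ Q ∨ y ∈ Bd
  b_zero : b 0 ∈ Bd
  lt_b_zero : R ≤ hexNorm (b 0 - o)
  linked : ∀ x ∈ Bd, LinkedIn Bd (b 0) x
  touch : ∃ x ∈ Bd, hexNorm (x - o) ≤ m

theorem LinkedIn.mono {S T : Set Vertex} (h : S ⊆ T) {u v : Vertex} (huv : LinkedIn S u v) :
    LinkedIn T u v :=
  Relation.ReflTransGen.mono (r := fun u v => Adj u v ∧ v ∈ S)
    (fun _ _ h' => ⟨h'.1, h h'.2⟩) _ _ huv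

theorem edgeInd_eq_zero {p q u v : Vertex} (h : ¬ ((u = p ∧ v = q) ∨ (u = q ∧ v = p))) :
    edgeInd p q u v = 0 := if_neg h

theorem edgeInd_self (p q : Vertex) : edgeInd p q p q = 1 := if_pos (Or.inl ⟨rfl, rfl⟩)

-- `U` and `V` are the distances from `o` of the ends of an edge, `W` and `D` those of the third
-- vertices of the triangles before and after it. Whether the current triangle lies in the ball
-- changes exactly when the crossed edge lies on the hexagon of radius `s`; `P` and `P'` record
-- membership in `Q` before and after the step.
open Classical in
theorem crossing_parity {U V W D s : ℕ} {P P' : Prop}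
    (hQ : U ≤ s → V ≤ s → W ≤ s → (P ↔ P'))
    (hc : U = s → V = s → (D ≤ s ∧ ¬ W ≤ s) ∨ (¬ D ≤ s ∧ W ≤ s))
    (h1 : W ≤ U + 1) (h2 : W ≤ V + 1) (h3 : V ≤ U + 1) (h4 : U ≤ V + 1) (h5 : D ≤ U + 1)
    (h6 : D ≤ V + 1) :
    (if U ≤ s ∧ V ≤ s ∧ W ≤ s ∧ P then (1 : ZMod 2) else 0) +
      (if U = s ∧ V = s ∧ P' then 1 else 0) = if U ≤ s ∧ V ≤ s ∧ D ≤ s ∧ P' then 1 else 0 := by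
  by_cases hUV : U = s ∧ V = s
  · obtain ⟨rfl, rfl⟩ := hUV
    rcases hc rfl rfl with h | h
    · simp [h.1, h.2]
    · have := hQ le_rfl le_rfl h.2
      by_cases hP : P
      · simp only [le_refl, h.1, h.2, ← this, hP, true_and, and_true, if_true, if_false]
        rfl
      · simp only [← this, hP, and_false, if_false, add_zero]
  · by_cases h : U ≤ s ∧ V ≤ s
    · have hW : W ≤ s := by omega
      have hD : D ≤ s := by omega
      have := hQ h.1 h.2 hW
      have hUV' : ¬ (U = s ∧ V = s ∧ P') := fun h => hUV ⟨h.1, h.2.1⟩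
      simp only [h.1, h.2, hW, hD, this, true_and, if_neg hUV', add_zero]
    · rw [if_neg (by tauto), if_neg (by omega), if_neg (by tauto), add_zero]

namespace Crossing

variable {o : Vertex} {m R n : ℕ} {a b c : ℕ → Vertex} {Q Bd : Set Vertex}

theorem adj_c (K : Crossing o m R n a b c Q Bd) {i : ℕ} (hi : i ≤ n) :
    Adj (a i) (c i) ∧ Adj (b i) (c i) := by
  have := K.adj i hi
  rcases K.orient with h | h
  · rw [h]; exact ⟨this.apex_left, this.apex_right⟩
  · rw [h]; exact ⟨this.symm.apex_right, this.symm.apex_left⟩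

/-- The path is closed up through vertices of `S`: its first edge has the end `b 0` in `Bd`, the set
`Bd` reaches the small ball, and the ball contains the last new vertex `c n`. -/
theorem exists_potential_aux (K : Crossing o m R n a b c Q Bd) :
    ∃ H : Vertex → ZMod 2, ∀ u v, Adj u v → u ∉ Bd → v ∉ Bd → m < hexNorm (u - o) →
      m < hexNorm (v - o) → H u + H v = ∑ i ∈ Finset.range (n + 1), edgeInd (a i) (b i) u v := by
  let S : Set Vertex := Bd ∪ {v | hexNorm (v - o) ≤ m}
  have hlink : LinkedIn S (b 0) (c n) := by
    obtain ⟨x, hx, hxm⟩ := K.touch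
    exact ((K.linked x hx).mono Set.subset_union_left).trans
      (linkedIn_ball (fun v hv => Or.inr hv) hxm K.hit)
  have hb : b 0 ∈ S := Or.inl K.b_zero
  have fin : ∀ {H : Vertex → ZMod 2} {f : ℕ → Vertex → Vertex → ZMod 2},
      (∀ u v, Adj u v → u ∉ S → v ∉ S → H u + H v = ∑ i ∈ Finset.range (n + 1), f i u v) →
      ∀ u v, Adj u v → u ∉ Bd → v ∉ Bd → m < hexNorm (u - o) →
      m < hexNorm (v - o) → H u + H v = ∑ i ∈ Finset.range (n + 1), f i u v := by
    intro H f h u v huv hu hv hu' hv'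
    refine h u v huv ?_ ?_ <;> rintro (h | h)
    exacts [hu h, absurd h (not_le.2 hu'), hv h, absurd h (not_le.2 hv')]
  rcases K.orient with h | h
  · obtain ⟨H, hH⟩ := exists_separating_potential (S := S) K.adj
      (fun i hi => by rw [← h]; exact K.step i hi) (Or.inr rfl) hb (by rw [← h]; exact hlink)
    exact ⟨H, fin (f := fun i => edgeInd (a i) (b i)) hH⟩
  · obtain ⟨H, hH⟩ := exists_separating_potential (S := S) (fun i hi => (K.adj i hi).symm)
      (fun i hi => by rw [← h]; have := K.step i hi; tauto) (Or.inl rfl) hb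
      (by rw [← h]; exact hlink)
    refine ⟨H, fin (f := fun i => edgeInd (a i) (b i)) fun u v huv hu hv => ?_⟩
    rw [hH u v huv hu hv]
    exact Finset.sum_congr rfl fun i _ => edgeInd_comm _ _ _ _

/-- A colouring modulo two that separates the two sides of the path. -/
theorem exists_potential (K : Crossing o m R n a b c Q Bd) :
    ∃ H : Vertex → ZMod 2, (∀ i ≤ n, H (a i) = 0) ∧ (∀ i ≤ n, b i ∉ Bd → H (b i) = 1) ∧
      ∀ u v, Adj u v → u ∉ Bd → v ∉ Bd → m < hexNorm (u - o) → m < hexNorm (v - o) →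
        H u ≠ H v → ∃ i ≤ n, (u = a i ∧ v = b i) ∨ (u = b i ∧ v = a i) := by
  obtain ⟨H, hH⟩ := K.exists_potential_aux
  have two : ∀ x : ZMod 2, x + x = 0 := CharTwo.add_self_eq_zero
  -- Successive `a i` are equal or adjacent. An edge between two of them is never crossed, since
  -- crossed edges have one end among the `b j`.
  have ha : ∀ i ≤ n, H (a i) = H (a 0) := by
    intro i hi
    induction i with
    | zero => rfl
    | succ i ih =>
      rw [← ih (by omega)]
      rcases K.step i hi with h | h
      · rw [h.1]
      · have hadj : Adj (a i) (a (i + 1)) := by rw [h.1]; exact (K.adj_c (by omega)).1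
        have := hH _ _ hadj (K.a_notMem i (by omega)) (K.a_notMem _ hi) (K.lt_a i (by omega))
          (K.lt_a _ hi)
        rw [Finset.sum_eq_zero] at this
        · linear_combination this - two (H (a i))
        · intro j hj
          rw [Finset.mem_range] at hj
          apply edgeInd_eq_zero
          rintro (⟨_, h'⟩ | ⟨h', _⟩)
          · exact K.a_ne_b _ hi j (by omega) h'
          · exact K.a_ne_b i (by omega) j (by omega) h'
  refine ⟨fun v => H v + H (a 0), fun i hi => by simp only [ha i hi, two], fun i hi hb => ?_,
    fun u v huv hu hv hu' hv' hne => ?_⟩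
  · have := hH _ _ (K.adj i hi) (K.a_notMem i hi) hb (K.lt_a i hi) (K.lt_b i hi)
    -- The edge `{a i, b i}` is crossed only once, so its two ends have different colours.
    rw [Finset.sum_eq_single_of_mem i (Finset.mem_range.2 (by omega)), edgeInd_self, ha i hi] at this
    · linear_combination this
    · intro j hj hji
      rw [Finset.mem_range] at hj
      apply edgeInd_eq_zero
      rintro (⟨h1, h2⟩ | ⟨h1, h2⟩)
      · exact hji (K.inj i hi j (by omega) h1 h2).symm
      · exact K.a_ne_b i hi j (by omega) h1
  · by_contra hcon
    push Not at hcon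
    have := hH u v huv hu hv hu' hv'
    rw [Finset.sum_eq_zero] at this
    · apply hne
      linear_combination this - two (H v)
    · intro i hi
      rw [Finset.mem_range] at hi
      obtain ⟨h1, h2⟩ := hcon i (by omega)
      apply edgeInd_eq_zero
      rintro (⟨h, h'⟩ | ⟨h, h'⟩)
      exacts [h1 h h', h2 h h']

open Classical in
/-- The path crosses each hexagon around `o` an odd number of times inside `Q`. -/
theorem odd_crossings (K : Crossing o m R n a b c Q Bd) {s : ℕ} (hms : m < s) (hsR : s ≤ R) :
    ∑ i ∈ Finset.range (n + 1), (if hexNorm (a i - o) = s ∧ hexNorm (b i - o) = s ∧ a i ∈ Q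
      then (1 : ZMod 2) else 0) = 1 := by
  -- `f i` indicates that the `i`-th triangle lies in the ball of radius `s`, with its far vertex in
  -- `Q`. It is `0` at the start and `1` at the end, and each crossing counted in the sum flips it.
  let f : ℕ → ZMod 2 := fun i => if hexNorm (a i - o) ≤ s ∧ hexNorm (b i - o) ≤ s ∧
    hexNorm (c i - o) ≤ s ∧ a i ∈ Q then 1 else 0
  have key : ∀ k ≤ n, ∑ i ∈ Finset.range (k + 1), (if hexNorm (a i - o) = s ∧
      hexNorm (b i - o) = s ∧ a i ∈ Q then (1 : ZMod 2) else 0) = f k := by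
    intro k hk
    induction k with
    | zero =>
      have := K.start
      simp only [f, zero_add, Finset.sum_range_one]
      rw [if_neg (by omega), if_neg (by omega)]
    | succ k ih =>
      rw [Finset.sum_range_succ, ih (by omega)]
      simp only [f]
      have hak := K.adj k (by omega)
      have hak' := K.adj (k + 1) hk
      have hac := K.adj_c (i := k) (by omega)
      have hac' := K.adj_c hk
      -- In both orientations and for both kinds of turn, the vertex dropped in the step and the new
      -- vertex are the apexes on the two sides of edge `k + 1`.
      have hap : (c (k + 1) = apex (a (k + 1)) (b (k + 1)) ∧
            ((a (k + 1) = a k ∧ b (k + 1) = c k ∧ b k = apex (b (k + 1)) (a (k + 1))) ∨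
             (a (k + 1) = c k ∧ b (k + 1) = b k ∧ a k = apex (b (k + 1)) (a (k + 1))))) ∨
          (c (k + 1) = apex (b (k + 1)) (a (k + 1)) ∧
            ((a (k + 1) = a k ∧ b (k + 1) = c k ∧ b k = apex (a (k + 1)) (b (k + 1))) ∨
             (a (k + 1) = c k ∧ b (k + 1) = b k ∧ a k = apex (a (k + 1)) (b (k + 1))))) := by
        rcases K.orient with h | h
        · left
          refine ⟨h _, ?_⟩
          rcases K.step k (by omega) with ⟨h1, h2⟩ | ⟨h1, h2⟩
          · left; refine ⟨h1, h2, ?_⟩; rw [h1, h2, h, apex_apex']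
          · right; refine ⟨h1, h2, ?_⟩; rw [h1, h2, h, apex_apex]
        · right
          refine ⟨h _, ?_⟩
          rcases K.step k (by omega) with ⟨h1, h2⟩ | ⟨h1, h2⟩
          · left; refine ⟨h1, h2, ?_⟩; rw [h1, h2, h, apex_apex]
          · right; refine ⟨h1, h2, ?_⟩; rw [h1, h2, h, apex_apex']
      have hQ : hexNorm (a k - o) ≤ s → hexNorm (a (k + 1) - o) ≤ s → (a k ∈ Q ↔ a (k + 1) ∈ Q) := by
        intro h1 h2
        rcases K.step k (by omega) with ⟨h, -⟩ | ⟨h, -⟩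
        · rw [h]
        · have : Adj (a k) (a (k + 1)) := by rw [h]; exact hac.1
          constructor
          · intro hq
            exact (K.Q_step _ hq _ this (by omega)).resolve_right (K.a_notMem _ hk)
          · intro hq
            exact (K.Q_step _ hq _ this.symm (by omega)).resolve_right (K.a_notMem _ (by omega))
      have n1 := hexNorm_le_succ_of_adj (o := o) hak'
      have n2 := hexNorm_le_succ_of_adj (o := o) hak'.symm
      have n3 := hexNorm_le_succ_of_adj (o := o) hac'.1
      have n4 := hexNorm_le_succ_of_adj (o := o) hac'.2
      have hcirc := hexNorm_apex_of_eq (o := o) (s := s) hak'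
      -- `w` is the vertex dropped in the step, so that the old triangle has the vertices `a (k +
      -- 1)`, `b (k + 1)` and `w`.
      have hXY : ∀ w, (w = a k ∨ w = b k) →
          (if hexNorm (a k - o) ≤ s ∧ hexNorm (b k - o) ≤ s ∧ hexNorm (c k - o) ≤ s ∧ a k ∈ Q
            then (1 : ZMod 2) else 0) = (if hexNorm (a (k + 1) - o) ≤ s ∧
              hexNorm (b (k + 1) - o) ≤ s ∧ hexNorm (w - o) ≤ s ∧ a k ∈ Q then 1 else 0) →
          Adj (a (k + 1)) w → Adj (b (k + 1)) w →
          (hexNorm (a (k + 1) - o) ≤ s → hexNorm (w - o) ≤ s → hexNorm (a k - o) ≤ s) →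
          (hexNorm (a (k + 1) - o) = s → hexNorm (b (k + 1) - o) = s →
            (hexNorm (c (k + 1) - o) ≤ s ∧ ¬ hexNorm (w - o) ≤ s) ∨
            (¬ hexNorm (c (k + 1) - o) ≤ s ∧ hexNorm (w - o) ≤ s)) →
          (if hexNorm (a k - o) ≤ s ∧ hexNorm (b k - o) ≤ s ∧ hexNorm (c k - o) ≤ s ∧ a k ∈ Q
            then (1 : ZMod 2) else 0) + (if hexNorm (a (k + 1) - o) = s ∧
              hexNorm (b (k + 1) - o) = s ∧ a (k + 1) ∈ Q then 1 else 0) =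
          if hexNorm (a (k + 1) - o) ≤ s ∧ hexNorm (b (k + 1) - o) ≤ s ∧
            hexNorm (c (k + 1) - o) ≤ s ∧ a (k + 1) ∈ Q then 1 else 0 := by
        intro w _ e h1 h2 hle hc
        rw [e]
        exact crossing_parity (fun hu hv hw => hQ (hle hu hw) hu) hc
          (hexNorm_le_succ_of_adj h1) (hexNorm_le_succ_of_adj h2) n1 n2 n3 n4
      rcases hap with ⟨e, ⟨e1, e2, e3⟩ | ⟨e1, e2, e3⟩⟩ | ⟨e, ⟨e1, e2, e3⟩ | ⟨e1, e2, e3⟩⟩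
      · refine hXY (b k) (Or.inr rfl) ?_ (by rw [e1]; exact hak) (by rw [e2]; exact hac.2.symm)
          (by rw [e1]; exact fun h _ => h) (fun h h' => by rw [e, e3]; exact hcirc h h')
        rw [e1, e2]; exact if_congr ⟨fun h => ⟨h.1, h.2.2.1, h.2.1, h.2.2.2⟩,
          fun h => ⟨h.1, h.2.2.1, h.2.1, h.2.2.2⟩⟩ rfl rfl
      · refine hXY (a k) (Or.inl rfl) ?_ (by rw [e1]; exact hac.1.symm) (by rw [e2]; exact hak.symm)
          (fun _ h => h) (fun h h' => by rw [e, e3]; exact hcirc h h')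
        rw [e1, e2]; exact if_congr ⟨fun h => ⟨h.2.2.1, h.2.1, h.1, h.2.2.2⟩,
          fun h => ⟨h.2.2.1, h.2.1, h.1, h.2.2.2⟩⟩ rfl rfl
      · refine hXY (b k) (Or.inr rfl) ?_ (by rw [e1]; exact hak) (by rw [e2]; exact hac.2.symm)
          (by rw [e1]; exact fun h _ => h) (fun h h' => by rw [e, e3]; exact (hcirc h h').symm.imp And.symm And.symm)
        rw [e1, e2]; exact if_congr ⟨fun h => ⟨h.1, h.2.2.1, h.2.1, h.2.2.2⟩,
          fun h => ⟨h.1, h.2.2.1, h.2.1, h.2.2.2⟩⟩ rfl rfl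
      · refine hXY (a k) (Or.inl rfl) ?_ (by rw [e1]; exact hac.1.symm) (by rw [e2]; exact hak.symm)
          (fun _ h => h) (fun h h' => by rw [e, e3]; exact (hcirc h h').symm.imp And.symm And.symm)
        rw [e1, e2]; exact if_congr ⟨fun h => ⟨h.2.2.1, h.2.1, h.1, h.2.2.2⟩,
          fun h => ⟨h.2.2.1, h.2.1, h.1, h.2.2.2⟩⟩ rfl rfl
  rw [key n le_rfl]
  have := K.adj_c (le_refl n)
  have h1 := hexNorm_le_succ_of_adj (o := o) this.1.symm
  have h2 := hexNorm_le_succ_of_adj (o := o) this.2.symm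
  have := K.hit
  exact if_pos ⟨by omega, by omega, by omega, K.mem_Q⟩

end Crossing

/-- A discrete intermediate value theorem: the distance from `o` changes by at most one along an
edge. -/
theorem exists_hexNorm_eq_of_linkedIn {S : Set Vertex} {o u x : Vertex} {s : ℕ}
    (h : LinkedIn S u x) (hu : u ∈ S) (hsu : s ≤ hexNorm (u - o)) (hx : hexNorm (x - o) ≤ s) :
    ∃ y ∈ S, hexNorm (y - o) = s := by
  induction h using Relation.ReflTransGen.head_induction_on with
  | refl => exact ⟨x, hu, le_antisymm hx hsu⟩
  | @head u w huw _ ih =>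
    by_cases h : hexNorm (u - o) = s
    · exact ⟨u, hu, h⟩
    · have := hexNorm_le_succ_of_adj (o := o) huw.1.symm
      exact ih huw.2 (by omega)

namespace Crossing

variable {o : Vertex} {m R n : ℕ} {a b c : ℕ → Vertex} {Q Bd : Set Vertex}

/-- On each hexagon between the two balls, there is an arc in the part of `Q` to the side of the
`a i`, from `Bd` to one of the `a i`. -/
theorem exists_arc (K : Crossing o m R n a b c Q Bd) {H : Vertex → ZMod 2}
    (Ha : ∀ i ≤ n, H (a i) = 0) (Hb : ∀ i ≤ n, b i ∉ Bd → H (b i) = 1)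
    (He : ∀ u v, Adj u v → u ∉ Bd → v ∉ Bd → m < hexNorm (u - o) → m < hexNorm (v - o) →
        H u ≠ H v → ∃ i ≤ n, (u = a i ∧ v = b i) ∨ (u = b i ∧ v = a i))
    {s : ℕ} (hms : m < s) (hsR : s ≤ R) :
    ∃ (C : ℕ → Vertex) (k : ℕ), 1 ≤ k ∧ k ≤ 6 * s ∧ C 0 ∈ Bd ∧
      (∀ j, 1 ≤ j → j ≤ k → C j ∈ Q ∧ H (C j) = 0) ∧ (∃ i ≤ n, C k = a i) ∧
      (∀ j < k, Adj (C j) (C (j + 1))) ∧ (∀ j ≤ k, hexNorm (C j - o) = s) ∧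
      ∀ i ≤ k, ∀ j ≤ k, C i = C j → i = j := by
  classical
  obtain ⟨x, hx, hxm⟩ := K.touch
  obtain ⟨y, hy, hys⟩ := exists_hexNorm_eq_of_linkedIn (K.linked x hx) K.b_zero
    (hsR.trans K.lt_b_zero) (hxm.trans hms.le)
  obtain ⟨C, C0, C6, Cadj, Cnorm, Cinj, -, Cedge⟩ := exists_hexCycle (by omega) hys
  rw [← C0] at hy
  have C6' : C (6 * s) = C 0 := by rw [C6, C0]
  have Cinj' : ∀ i j, 0 < i → 0 < j → i ≤ 6 * s → j ≤ 6 * s → C i = C j → i = j := by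
    intro i j hi hj hi' hj' h
    rcases eq_or_lt_of_le hi' with rfl | hi'' <;> rcases eq_or_lt_of_le hj' with rfl | hj''
    · rfl
    · rw [C6'] at h; have := Cinj 0 j (by omega) hj'' h; omega
    · rw [C6'] at h; have := Cinj i 0 hi'' (by omega) h; omega
    · exact Cinj i j hi'' hj'' h
  -- Without such an arc, each maximal run of vertices of the cycle in the far part `Y` of `Q` has
  -- either crossings at both ends or boundary vertices at both ends. The number of crossings would
  -- then be even.
  by_contra hcon
  let Y : ℕ → Prop := fun j => C j ∈ Q ∧ H (C j) = 0
  let isA : ℕ → Prop := fun j => ∃ i ≤ n, C j = a i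
  have hYBd : ∀ j, Y j → C j ∉ Bd := fun j h => K.Q_disj _ h.1
  have fwd : ∀ l k, l < k → k ≤ 6 * s → C l ∈ Bd → (∀ i, l < i → i ≤ k → Y i) → ¬ isA k := by
    intro l k hlk hk hl hY hA
    refine hcon ⟨fun j => C (l + j), k - l, by omega, by omega, hl,
      fun j h1 h2 => hY _ (by omega) (by omega), ?_, fun j hj => Cadj _ (by omega),
      fun j hj => Cnorm _ (by omega), fun i hi j hj h => ?_⟩
    · simp only; rw [show l + (k - l) = k by omega]; exact hA
    · have hk6 : k < 6 * s := by
        rcases eq_or_lt_of_le hk with rfl | h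
        · exact absurd (by rw [C6']; exact hy) (hYBd _ (hY _ hlk le_rfl))
        · exact h
      have := Cinj _ _ (by omega) (by omega) h
      omega
  -- The same exclusion as `fwd`, with the hexagon traversed in the other direction.
  have bwd : ∀ l k, l < k → k ≤ 6 * s → C k ∈ Bd → (∀ i, l ≤ i → i < k → Y i) → ¬ isA l := by
    intro l k hlk hk hl hY hA
    refine hcon ⟨fun j => C (k - j), k - l, by omega, by omega, hl,
      fun j h1 h2 => hY _ (by omega) (by omega), ?_, fun j hj => ?_,
      fun j hj => Cnorm _ (by omega), fun i hi j hj h => ?_⟩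
    · simp only; rw [show k - (k - l) = l by omega]; exact hA
    · have := (Cadj (k - (j + 1)) (by omega)).symm
      rwa [show k - (j + 1) + 1 = k - j by omega] at this
    · have hl0 : 0 < l := by
        rcases Nat.eq_zero_or_pos l with rfl | h
        · exact absurd hy (hYBd _ (hY _ le_rfl hlk))
        · exact h
      have := Cinj' _ _ (by omega) (by omega) (by omega) (by omega) h
      omega
  let cross : ℕ → Prop := fun j => ∃ i ≤ n, a i ∈ Q ∧
    ((a i = C j ∧ b i = C (j + 1)) ∨ (a i = C (j + 1) ∧ b i = C j))
  have hbY : ∀ j, ∀ i ≤ n, b i = C j → ¬ Y j := by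
    intro j i hi h hY
    have := Hb i hi (by rw [h]; exact hYBd j hY)
    rw [h, hY.2] at this
    exact absurd this (by decide)
  have cross_cases : ∀ j, cross j → (Y j ∧ ¬ Y (j + 1) ∧ isA j) ∨ (¬ Y j ∧ Y (j + 1) ∧ isA (j + 1)) := by
    rintro j ⟨i, hi, hQ, ⟨h1, h2⟩ | ⟨h1, h2⟩⟩
    · left
      exact ⟨⟨h1 ▸ hQ, h1 ▸ Ha i hi⟩, hbY _ i hi h2, i, hi, h1.symm⟩
    · right
      exact ⟨hbY _ i hi h2, ⟨h1 ▸ hQ, h1 ▸ Ha i hi⟩, i, hi, h1.symm⟩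
  -- Leaving `Y` without crossing the path means stepping onto `Bd`: a step inside `Q` that changes
  -- `H` crosses an edge of the path.
  have noncross : ∀ j < 6 * s, ¬ cross j → (Y j → ¬ Y (j + 1) → C (j + 1) ∈ Bd) ∧
      (¬ Y j → Y (j + 1) → C j ∈ Bd) := by
    intro j hj hc
    have key : ∀ u v, Adj u v → hexNorm (u - o) = s → hexNorm (v - o) = s → u ∈ Q → H u = 0 →
        ¬ (v ∈ Q ∧ H v = 0) → (∀ i ≤ n, u = a i → v = b i → cross j) → v ∈ Bd := by
      intro u v huv hu hv huQ huH hvY hc'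
      by_contra hvB
      have hvQ := (K.Q_step u huQ v huv (by omega)).resolve_right hvB
      obtain ⟨i, hi, ⟨h1, h2⟩ | ⟨h1, h2⟩⟩ := He u v huv (K.Q_disj _ huQ) hvB (by omega) (by omega)
        (fun h => hvY ⟨hvQ, by rw [← h, huH]⟩)
      · exact hc (hc' i hi h1 h2)
      · exact hvY ⟨hvQ, by rw [h2]; exact Ha i hi⟩
    constructor
    · intro h1 h2
      exact key _ _ (Cadj j hj) (Cnorm j hj.le) (Cnorm _ hj) h1.1 h1.2 h2
        fun i hi e₁ e₂ => ⟨i, hi, e₁ ▸ h1.1, Or.inl ⟨e₁.symm, e₂.symm⟩⟩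
    · intro h1 h2
      exact key _ _ (Cadj j hj).symm (Cnorm _ hj) (Cnorm j hj.le) h2.1 h2.2 h1
        fun i hi e₁ e₂ => ⟨i, hi, e₁ ▸ h2.1, Or.inr ⟨e₁.symm, e₂.symm⟩⟩
  let P : ℕ → ZMod 2 := fun j => ∑ j' ∈ Finset.range j, if cross j' then 1 else 0
  -- Double counting: each path edge on the hexagon is one edge of the cycle, and no edge of the
  -- cycle is used by two indices of the path.
  have hP : P (6 * s) = 1 := by
    rw [← K.odd_crossings hms hsR]
    simp only [P]
    have h1 : ∀ j ∈ Finset.range (6 * s), (if cross j then (1 : ZMod 2) else 0) =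
        ∑ i ∈ Finset.range (n + 1), if a i ∈ Q ∧
          ((a i = C j ∧ b i = C (j + 1)) ∨ (a i = C (j + 1) ∧ b i = C j)) then 1 else 0 := by
      intro j _
      by_cases hc : cross j
      · rw [if_pos hc]
        obtain ⟨i, hi, hQ, h⟩ := hc
        rw [Finset.sum_eq_single_of_mem i (Finset.mem_range.2 (by omega)), if_pos ⟨hQ, h⟩]
        intro i' hi' hne
        rw [Finset.mem_range] at hi'
        rw [if_neg]
        rintro ⟨-, h'⟩
        rcases h with ⟨e1, e2⟩ | ⟨e1, e2⟩ <;> rcases h' with ⟨e3, e4⟩ | ⟨e3, e4⟩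
        · exact hne (K.inj _ (by omega) _ hi (e3.trans e1.symm) (e4.trans e2.symm))
        · exact K.a_ne_b i hi i' (by omega) (e1.trans e4.symm)
        · exact K.a_ne_b i hi i' (by omega) (e1.trans e4.symm)
        · exact hne (K.inj _ (by omega) _ hi (e3.trans e1.symm) (e4.trans e2.symm))
      · rw [if_neg hc, Finset.sum_eq_zero]
        intro i hi
        rw [Finset.mem_range] at hi
        rw [if_neg]
        rintro ⟨h1, h2⟩
        exact hc ⟨i, by omega, h1, h2⟩
    rw [Finset.sum_congr rfl h1, Finset.sum_comm]
    refine Finset.sum_congr rfl fun i hi => ?_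
    rw [Finset.mem_range] at hi
    split_ifs with h
    · obtain ⟨j, hj, hje⟩ := Cedge _ _ (K.adj i (by omega)) h.1 h.2.1
      rw [Finset.sum_eq_single_of_mem j (Finset.mem_range.2 hj), if_pos ⟨h.2.2, hje⟩]
      intro j' hj' hne
      rw [Finset.mem_range] at hj'
      rw [if_neg]
      rintro ⟨-, h'⟩
      have hs1 : 0 < s := by omega
      rcases hje with ⟨e1, e2⟩ | ⟨e1, e2⟩ <;> rcases h' with ⟨e3, e4⟩ | ⟨e3, e4⟩
      · exact hne (Cinj _ _ hj' hj (e3.symm.trans e1))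
      -- Two different positions traversing one edge in opposite directions would make a cycle of
      -- length two, but `6 * s` is at least six.
      · have e5 := e3.symm.trans e1
        have e6 := e4.symm.trans e2
        rcases Nat.eq_zero_or_pos j with rfl | h0
        · have h7 := Cinj' (j' + 1) (6 * s) (by omega) (by omega) (by omega) le_rfl
            (e5.trans C6'.symm)
          have := Cinj' j' (0 + 1) (by omega) (by omega) (by omega) (by omega) e6
          omega
        · have h7 := Cinj' (j' + 1) j (by omega) h0 (by omega) (by omega) e5
          rcases Nat.eq_zero_or_pos j' with rfl | h0'
          · have := Cinj' (6 * s) (j + 1) (by omega) (by omega) le_rfl (by omega)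
              (C6'.trans e6)
            omega
          · have := Cinj' j' (j + 1) h0' (by omega) (by omega) (by omega) e6
            omega
      · have e5 := e4.symm.trans e2
        have e6 := e3.symm.trans e1
        rcases Nat.eq_zero_or_pos j with rfl | h0
        · have h7 := Cinj' (j' + 1) (6 * s) (by omega) (by omega) (by omega) le_rfl
            (e5.trans C6'.symm)
          have := Cinj' j' (0 + 1) (by omega) (by omega) (by omega) (by omega) e6
          omega
        · have h7 := Cinj' (j' + 1) j (by omega) h0 (by omega) (by omega) e5
          rcases Nat.eq_zero_or_pos j' with rfl | h0'
          · have := Cinj' (6 * s) (j + 1) (by omega) (by omega) le_rfl (by omega)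
              (C6'.trans e6)
            omega
          · have := Cinj' j' (j + 1) h0' (by omega) (by omega) (by omega) e6
            omega
      · exact hne (Cinj _ _ hj' hj (e4.symm.trans e2))
    · rw [Finset.sum_eq_zero]
      intro j hj
      rw [Finset.mem_range] at hj
      rw [if_neg]
      rintro ⟨hQ, h'⟩
      apply h
      rcases h' with ⟨e3, e4⟩ | ⟨e3, e4⟩
      · rw [e3, e4]; exact ⟨Cnorm _ hj.le, Cnorm _ hj, e3 ▸ hQ⟩
      · rw [e3, e4]; exact ⟨Cnorm _ hj, Cnorm _ hj.le, e3 ▸ hQ⟩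
  have hPsucc : ∀ j, P (j + 1) = P j + if cross j then 1 else 0 := fun j => Finset.sum_range_succ _ _
  -- The parity is even outside `Y`. Inside `Y` it is even if the current run was entered from `Bd`,
  -- and odd if it was entered by a crossing, in which case the run starts at some `a i`.
  have inv : ∀ j ≤ 6 * s, (¬ Y j → P j = 0) ∧ (Y j →
      (P j = 0 ∧ ∃ l < j, C l ∈ Bd ∧ ∀ i, l < i → i ≤ j → Y i) ∨
      (P j = 1 ∧ ∃ l, l ≤ j ∧ isA l ∧ ∀ i, l ≤ i → i ≤ j → Y i)) := by
    intro j hj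
    induction j with
    | zero => exact ⟨fun _ => by simp [P], fun h => absurd hy (hYBd 0 h)⟩
    | succ j ih =>
      obtain ⟨ih1, ih2⟩ := ih (by omega)
      by_cases hc : cross j
      · rw [hPsucc, if_pos hc]
        rcases cross_cases j hc with ⟨h1, h2, h3⟩ | ⟨h1, h2, h3⟩
        · refine ⟨fun _ => ?_, fun h => absurd h h2⟩
          rcases ih2 h1 with ⟨_, l, hl, hlB, hlY⟩ | ⟨h, _⟩
          · exact absurd h3 (fwd l j hl (by omega) hlB hlY)
          · rw [h]; rfl
        · refine ⟨fun h => absurd h2 h, fun _ => Or.inr ⟨by rw [ih1 h1, zero_add], j + 1, le_rfl, h3,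
            fun i hi hi' => ?_⟩⟩
          rw [le_antisymm hi' hi]; exact h2
      · rw [hPsucc, if_neg hc, add_zero]
        obtain ⟨nc1, nc2⟩ := noncross j (by omega) hc
        have ext : ∀ {p : ℕ → Prop}, (∀ i, p i → i ≤ j → Y i) → Y (j + 1) →
            ∀ i, p i → i ≤ j + 1 → Y i := by
          intro p h1 h2 i hi hi'
          rcases Nat.lt_or_ge i (j + 1) with h | h
          · exact h1 i hi (by omega)
          · rw [le_antisymm hi' h]; exact h2
        by_cases hYj : Y j
        · refine ⟨fun h => ?_, fun h => ?_⟩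
          · rcases ih2 hYj with ⟨h', _⟩ | ⟨_, l, hl, hlA, hlY⟩
            · exact h'
            · exact absurd hlA (bwd l (j + 1) (by omega) hj (nc1 hYj h)
                fun i h1 h2 => hlY i h1 (by omega))
          · rcases ih2 hYj with ⟨h', l, hl, hlB, hlY⟩ | ⟨h', l, hl, hlA, hlY⟩
            · exact Or.inl ⟨h', l, by omega, hlB, ext hlY h⟩
            · exact Or.inr ⟨h', l, by omega, hlA, ext hlY h⟩
        · refine ⟨fun _ => ih1 hYj, fun h => Or.inl ⟨ih1 hYj, j, by omega, nc2 hYj h, fun i h1 h2 => ?_⟩⟩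
          rw [le_antisymm h2 h1]; exact h
  have := (inv (6 * s) le_rfl).1 fun h => hYBd _ h (by rw [C6']; exact hy)
  rw [hP] at this
  exact absurd this (by decide)

end Crossing

/-! ### Discrete Dirichlet forms -/

/-- The ball of radius `R` around `o` in the graph distance of `TG`. -/
noncomputable def hexBall (o : Vertex) (R : ℕ) : Finset Vertex :=
  (Finset.Icc (o.1 - R) (o.1 + R) ×ˢ Finset.Icc (o.2 - R) (o.2 + R)).filter
    fun v => hexNorm (v - o) ≤ R

theorem mem_hexBall {o v : Vertex} {R : ℕ} : v ∈ hexBall o R ↔ hexNorm (v - o) ≤ R := by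
  simp only [hexBall, Finset.mem_filter, Finset.mem_product, Finset.mem_Icc, and_iff_right_iff_imp,
    hexNorm_le_iff, Prod.fst_sub, Prod.snd_sub]
  omega

theorem card_hexBall_le (o : Vertex) (R : ℕ) : (hexBall o R).card ≤ (2 * R + 1) ^ 2 := by
  refine (Finset.card_filter_le _ _).trans ?_
  rw [Finset.card_product, Int.card_Icc, Int.card_Icc, sq]
  apply le_of_eq
  congr 1 <;> omega

theorem adj_add {x d : Vertex} (hd : d ∈ dirs) : Adj x (x + d) := by
  unfold Adj; rwa [add_sub_cancel_left]

theorem card_dirs : dirs.card = 6 := rfl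

theorem sum_adj_eq {Z : Finset Vertex} {x : Vertex} (h : ∀ d ∈ dirs, x + d ∈ Z) (F : Vertex → ℝ) :
    ∑ y ∈ Z, (if Adj x y then F y else 0) = ∑ d ∈ dirs, F (x + d) := by
  rw [← Finset.sum_filter]
  symm
  refine Finset.sum_nbij' (fun d => x + d) (fun y => y - x) ?_ ?_ ?_ ?_ ?_
  · exact fun d hd => Finset.mem_filter.2 ⟨h d hd, adj_add hd⟩
  · exact fun y hy => (Finset.mem_filter.1 hy).2
  · exact fun d _ => add_sub_cancel_left _ _
  · exact fun y _ => add_sub_cancel _ _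
  · exact fun d _ => rfl

theorem sum_adj_le {Z : Finset Vertex} {x : Vertex} (F : Vertex → ℝ) (hF : ∀ y, 0 ≤ F y) :
    ∑ y ∈ Z, (if Adj x y then F y else 0) ≤ ∑ d ∈ dirs, F (x + d) := by
  classical
  rw [← sum_adj_eq (Z := Z ∪ dirs.image (x + ·)) (fun d hd =>
    Finset.mem_union_right _ (Finset.mem_image_of_mem _ hd))]
  refine Finset.sum_le_sum_of_subset_of_nonneg Finset.subset_union_left fun y _ _ => ?_
  split_ifs
  exacts [hF y, le_rfl]

/-- The discrete form of the identity behind Caccioppoli's inequality. -/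
theorem caccioppoli (Z : Finset Vertex) (κ : Vertex → Vertex → ℝ) (hκ : ∀ x y, κ x y = κ y x)
    (φ u : Vertex → ℝ) :
    ∑ x ∈ Z, ∑ y ∈ Z, κ x y * (φ x * u x - φ y * u y) ^ 2 =
      ∑ x ∈ Z, ∑ y ∈ Z, κ x y * (u x * u y * (φ x - φ y) ^ 2) +
        2 * ∑ x ∈ Z, φ x ^ 2 * (u x * ∑ y ∈ Z, κ x y * (u x - u y)) := by
  have h1 : ∑ x ∈ Z, φ x ^ 2 * (u x * ∑ y ∈ Z, κ x y * (u x - u y)) =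
      ∑ x ∈ Z, ∑ y ∈ Z, κ x y * (φ x ^ 2 * u x * (u x - u y)) := by
    refine Finset.sum_congr rfl fun x _ => ?_
    rw [Finset.mul_sum, Finset.mul_sum]
    exact Finset.sum_congr rfl fun y _ => by ring
  have h2 : ∑ x ∈ Z, ∑ y ∈ Z, κ x y * (φ x ^ 2 * u x * (u x - u y)) =
      ∑ x ∈ Z, ∑ y ∈ Z, κ x y * (φ y ^ 2 * u y * (u y - u x)) := by
    rw [Finset.sum_comm]
    exact Finset.sum_congr rfl fun x _ => Finset.sum_congr rfl fun y _ => by rw [hκ]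
  have h3 : ∑ x ∈ Z, ∑ y ∈ Z, κ x y * (φ x * u x - φ y * u y) ^ 2 =
      ∑ x ∈ Z, ∑ y ∈ Z, κ x y * (u x * u y * (φ x - φ y) ^ 2) +
        (∑ x ∈ Z, ∑ y ∈ Z, κ x y * (φ x ^ 2 * u x * (u x - u y)) +
          ∑ x ∈ Z, ∑ y ∈ Z, κ x y * (φ y ^ 2 * u y * (u y - u x))) := by
    simp only [← Finset.sum_add_distrib]
    exact Finset.sum_congr rfl fun x _ => Finset.sum_congr rfl fun y _ => by ring
  linarith

/-- The function that is `1` on `[0, r]`, vanishes on `[2 * r, ∞)` and is linear in between. -/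
noncomputable def cutoff (r t : ℕ) : ℝ := max 0 (min 1 (2 - t / r))

theorem cutoff_nonneg (r t : ℕ) : 0 ≤ cutoff r t := le_max_left _ _

theorem cutoff_le_one (r t : ℕ) : cutoff r t ≤ 1 := max_le zero_le_one (min_le_left _ _)

theorem cutoff_eq_one {r t : ℕ} (hr : 0 < r) (h : t ≤ r) : cutoff r t = 1 := by
  have : (t : ℝ) / r ≤ 1 := by
    rw [div_le_one (by exact_mod_cast hr)]; exact_mod_cast h
  unfold cutoff
  rw [min_eq_left (by linarith), max_eq_right zero_le_one]

theorem cutoff_eq_zero {r t : ℕ} (hr : 0 < r) (h : 2 * r ≤ t) : cutoff r t = 0 := by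
  have : 2 ≤ (t : ℝ) / r := by
    rw [le_div_iff₀ (by exact_mod_cast hr)]; exact_mod_cast h
  unfold cutoff
  exact max_eq_left ((min_le_right _ _).trans (by linarith))

theorem abs_cutoff_sub_le {r t t' : ℕ} (h : t ≤ t' + 1) (h' : t' ≤ t + 1) :
    |cutoff r t - cutoff r t'| ≤ 1 / r := by
  unfold cutoff
  refine (abs_max_sub_max_le_max _ _ _ _).trans (max_le ?_ ((abs_min_sub_min_le_max _ _ _ _).trans
    (max_le ?_ ?_)))
  · rw [sub_self, abs_zero]; positivity
  · rw [sub_self, abs_zero]; positivity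
  rw [show (2 - (t : ℝ) / r) - (2 - t' / r) = (t' - t) / r by ring, abs_div, Nat.abs_cast]
  gcongr
  rw [abs_le]
  have h1 : (t : ℝ) ≤ t' + 1 := by exact_mod_cast h
  have h2 : (t' : ℝ) ≤ t + 1 := by exact_mod_cast h'
  constructor <;> linarith

theorem cutoff_sub_sq_le {o x y : Vertex} {r : ℕ} (hr : 0 < r) (h : Adj x y) :
    (cutoff r (hexNorm (x - o)) - cutoff r (hexNorm (y - o))) ^ 2 ≤
      if hexNorm (x - o) ∈ Finset.Icc r (2 * r) then 1 / (r : ℝ) ^ 2 else 0 := by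
  have h1 := hexNorm_le_succ_of_adj (o := o) h
  have h2 := hexNorm_le_succ_of_adj (o := o) h.symm
  split_ifs with hx
  · have := abs_cutoff_sub_le (r := r) h2 h1
    rw [← sq_abs, show 1 / (r : ℝ) ^ 2 = (1 / r) ^ 2 by ring]
    gcongr
  · rw [Finset.mem_Icc, not_and_or, not_le, not_le] at hx
    rcases hx with hx | hx
    · rw [cutoff_eq_one hr hx.le, cutoff_eq_one hr (by omega)]; simp
    · rw [cutoff_eq_zero hr hx.le, cutoff_eq_zero hr (by omega)]; simp

/-- The Dirichlet energy is scale invariant in dimension two: at most `(5 * r) ^ 2` vertices, six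
neighbours each, squared gradient `1 / r ^ 2`. -/
theorem sum_cutoff_sub_sq_le (Z : Finset Vertex) (o : Vertex) {r : ℕ} (hr : 0 < r) :
    ∑ x ∈ Z, ∑ y ∈ Z, (if Adj x y then
      (cutoff r (hexNorm (x - o)) - cutoff r (hexNorm (y - o))) ^ 2 else 0) ≤ 150 := by
  have hr' : (1 : ℝ) ≤ r := by exact_mod_cast hr
  calc ∑ x ∈ Z, ∑ y ∈ Z, (if Adj x y then
      (cutoff r (hexNorm (x - o)) - cutoff r (hexNorm (y - o))) ^ 2 else 0)
      ≤ ∑ x ∈ Z, if hexNorm (x - o) ≤ 2 * r then 6 * (1 / (r : ℝ) ^ 2) else 0 := by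
        refine Finset.sum_le_sum fun x _ => ?_
        have h1 : ∀ y ∈ Z, (if Adj x y then
            (cutoff r (hexNorm (x - o)) - cutoff r (hexNorm (y - o))) ^ 2 else 0) ≤
            if Adj x y then (if hexNorm (x - o) ≤ 2 * r then 1 / (r : ℝ) ^ 2 else 0) else 0 := by
          intro y _
          split_ifs with h h'
          · refine (cutoff_sub_sq_le hr h).trans ?_
            split_ifs
            exacts [le_rfl, by positivity]
          · refine (cutoff_sub_sq_le hr h).trans ?_
            rw [if_neg (by rw [Finset.mem_Icc]; omega)]
          · exact le_rfl
        refine (Finset.sum_le_sum h1).trans ((sum_adj_le _ fun y => ?_).trans ?_)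
        · split_ifs
          exacts [by positivity, le_rfl]
        · rw [Finset.sum_const, card_dirs]
          split_ifs <;> simp
    _ ≤ ∑ x ∈ hexBall o (2 * r), 6 * (1 / (r : ℝ) ^ 2) := by
        rw [← Finset.sum_filter]
        refine Finset.sum_le_sum_of_subset_of_nonneg (fun x hx => ?_) fun _ _ _ => by positivity
        exact mem_hexBall.2 (Finset.mem_filter.1 hx).2
    _ = (hexBall o (2 * r)).card * (6 * (1 / (r : ℝ) ^ 2)) := by
        rw [Finset.sum_const, nsmul_eq_mul]
    _ ≤ (5 * r) ^ 2 * (6 * (1 / (r : ℝ) ^ 2)) := by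
        gcongr
        have := card_hexBall_le o (2 * r)
        have h2 : (2 * (2 * r) + 1) ^ 2 ≤ (5 * r) ^ 2 := Nat.pow_le_pow_left (by omega) 2
        exact_mod_cast this.trans h2
    _ = 150 := by field_simp; norm_num

/-- The energy of a function on a path is at least the square of the increment over the length. -/
theorem sq_sub_le_mul_sum_sq (f : ℕ → ℝ) (k : ℕ) :
    (f k - f 0) ^ 2 ≤ k * ∑ j ∈ Finset.range k, (f j - f (j + 1)) ^ 2 := by
  rw [← Finset.sum_range_sub f k]
  refine (sq_sum_le_card_mul_sum_sq).trans (le_of_eq ?_)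
  rw [Finset.card_range]
  congr 1
  exact Finset.sum_congr rfl fun j _ => by ring

/-- Each of `J` dyadic blocks contributes at least `1 / 2`; the choice of `K` does not depend on
`m`, that is, on the scale. -/
theorem exists_harmonic_block (J : ℕ) : ∃ K : ℕ, 2 ≤ K ∧ ∀ m : ℕ, 0 < m →
    (J : ℝ) / 2 ≤ ∑ s ∈ Finset.Ico (2 * m) (K * m), 1 / (s : ℝ) := by
  refine ⟨2 ^ (J + 1), by rw [pow_succ]; have := Nat.one_le_two_pow (n := J); omega, fun m hm => ?_⟩
  induction J with
  | zero => simp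
  | succ J ih =>
    have h1 : 2 * m ≤ 2 ^ (J + 1) * m := by
      rw [pow_succ]; have := Nat.one_le_two_pow (n := J); nlinarith
    have h2 : 2 ^ (J + 1) * m ≤ 2 ^ (J + 1 + 1) * m := by rw [pow_succ 2 (J + 1)]; nlinarith
    rw [← Finset.sum_Ico_consecutive _ h1 h2]
    have h3 : (1 : ℝ) / 2 ≤ ∑ s ∈ Finset.Ico (2 ^ (J + 1) * m) (2 ^ (J + 1 + 1) * m), 1 / (s : ℝ) := by
      set N := 2 ^ (J + 1) * m with hN
      have hN0 : 0 < N := by positivity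
      have e : 2 ^ (J + 1 + 1) * m = N + N := by rw [hN]; ring
      rw [e]
      calc (1 : ℝ) / 2 = ∑ s ∈ Finset.Ico N (N + N), 1 / (2 * N : ℝ) := by
            rw [Finset.sum_const, Nat.card_Ico, add_tsub_cancel_left, nsmul_eq_mul]
            have : (N : ℝ) ≠ 0 := by positivity
            field_simp
        _ ≤ _ := by
            refine Finset.sum_le_sum fun s hs => ?_
            rw [Finset.mem_Ico] at hs
            have hs0 : (0 : ℝ) < s := by exact_mod_cast lt_of_lt_of_le hN0 hs.1
            apply one_div_le_one_div_of_le hs0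
            have : (s : ℝ) ≤ (N + N : ℕ) := by exact_mod_cast hs.2.le
            push_cast at this
            linarith
    push_cast
    linarith

/-! ### The flux is large when the path comes close -/

open Classical in
/-- The flux of `g` through the edges from `Q` to the vertices of `Bd` in a ball. -/
noncomputable def flux (o : Vertex) (ρ : ℕ) (Q Bd : Set Vertex) (g : Vertex → ℝ) : ℝ :=
  ∑ x ∈ hexBall o ρ, if x ∈ Bd then ∑ d ∈ dirs, if x + d ∈ Q then g (x + d) else 0 else 0

/-- The cutoff function of the annulus between the radii `r` and `2 * ρ`. -/
noncomputable def annulusCutoff (r ρ t : ℕ) : ℝ := (1 - cutoff r t) * cutoff ρ t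

theorem annulusCutoff_sub_sq_le (r ρ t t' : ℕ) : (annulusCutoff r ρ t - annulusCutoff r ρ t') ^ 2 ≤
    2 * (cutoff r t - cutoff r t') ^ 2 + 2 * (cutoff ρ t - cutoff ρ t') ^ 2 := by
  unfold annulusCutoff
  have h1 := cutoff_nonneg r t
  have h2 := cutoff_le_one r t
  have h3 := cutoff_nonneg ρ t'
  have h4 := cutoff_le_one ρ t'
  generalize cutoff r t = A at *
  generalize cutoff r t' = A' at *
  generalize cutoff ρ t = B at *
  generalize cutoff ρ t' = B' at *
  have e : (1 - A) * B - (1 - A') * B' = (1 - A) * (B - B') - B' * (A - A') := by ring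
  rw [e]
  have h5 : (1 - A) ^ 2 * (B - B') ^ 2 ≤ 1 * (B - B') ^ 2 := by
    gcongr
    nlinarith
  have h6 : B' ^ 2 * (A - A') ^ 2 ≤ 1 * (A - A') ^ 2 := by
    gcongr
    nlinarith
  nlinarith [sq_nonneg ((1 - A) * (B - B') + (A - A') * B')]

/-- If a path explores the neighbourhood of a boundary point, then the flux of any function that is
harmonic off the path, equal to `1` on its far side and to `0` on the boundary, is large. -/
theorem exists_flux_lower_bound : ∃ K : ℕ, 2 ≤ K ∧ ∀ {o : Vertex} {m R n : ℕ} {a b c : ℕ → Vertex}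
    {Q Bd : Set Vertex} (_ : Crossing o m R n a b c Q Bd) (_ : 2 * (K * (m + 1)) ≤ R)
    {g : Vertex → ℝ} (_ : ∀ x ∈ Q, 0 ≤ g x ∧ g x ≤ 1) (_ : ∀ x ∈ Bd, g x = 0)
    (_ : ∀ i ≤ n, g (a i) = 1)
    (_ : ∀ x ∈ Q, (∀ i ≤ n, x ≠ a i ∧ x ≠ b i) → g x = (∑ d ∈ dirs, g (x + d)) / 6),
    1 ≤ flux o (2 * (K * (m + 1))) Q Bd g := by
  classical
  -- `7224 / 2 / 6 = 602`: the upper bound `600` for the cutoff term, plus the `2` that remains for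
  -- twice the flux.
  obtain ⟨K, hK2, hK⟩ := exists_harmonic_block 7224
  refine ⟨K, hK2, ?_⟩
  intro o m R n a b c Q Bd Kr hR g g01 gBd ga gh
  obtain ⟨H, Ha, Hb, He⟩ := Kr.exists_potential
  set r := m + 1 with hr
  set ρ := K * r with hρ
  have hρr : 2 * r ≤ ρ := Nat.mul_le_mul_right _ hK2
  let N : Vertex → ℕ := fun x => hexNorm (x - o)
  let Z := hexBall o (2 * ρ + 1)
  -- `L` is the far side of the path in `Q`. Only edges that touch `L` carry conductance, which
  -- decouples it from the near side.
  let L : Set Vertex := {x | x ∈ Q ∧ m < N x ∧ H x = 0}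
  let κ : Vertex → Vertex → ℝ := fun x y => if Adj x y ∧ (x ∈ L ∨ y ∈ L) then 1 else 0
  let φ : Vertex → ℝ := fun x => annulusCutoff r ρ (N x)
  let u : Vertex → ℝ := fun x => if x ∈ L then 1 - g x else if x ∈ Bd then 1 else 0
  have hκ : ∀ x y, κ x y = κ y x := by
    intro x y
    simp only [κ]
    exact if_congr (by rw [adj_comm, or_comm]) rfl rfl
  have hκ0 : ∀ x y, 0 ≤ κ x y := by intro x y; simp only [κ]; split_ifs <;> norm_num
  have hu : ∀ x, 0 ≤ u x ∧ u x ≤ 1 := by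
    intro x
    simp only [u]
    split_ifs with h
    · have := g01 x h.1; constructor <;> linarith
    all_goals norm_num
  have huBd : ∀ x ∈ Bd, u x = 1 := by
    intro x hx
    simp only [u]
    rw [if_neg (fun h : x ∈ L => Kr.Q_disj x h.1 hx), if_pos hx]
  have haL : ∀ i ≤ n, a i ∈ Q → a i ∈ L := fun i hi h => ⟨h, Kr.lt_a i hi, Ha i hi⟩
  have hφ0 : ∀ x, (N x ≤ r ∨ 2 * ρ ≤ N x) → φ x = 0 := by
    rintro x (h | h) <;> simp only [φ, annulusCutoff]
    · rw [cutoff_eq_one (by omega) h]; ring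
    · rw [cutoff_eq_zero (by omega) h]; ring
  have hφ1 : ∀ x, 2 * r ≤ N x → N x ≤ ρ → φ x = 1 := by
    intro x h1 h2
    simp only [φ, annulusCutoff]
    rw [cutoff_eq_zero (by omega) h1, cutoff_eq_one (by omega) h2]; ring
  have hφle : ∀ x, φ x ^ 2 ≤ 1 := by
    intro x
    simp only [φ, annulusCutoff]
    have h1 := cutoff_nonneg r (N x)
    have h2 := cutoff_le_one r (N x)
    have h3 := cutoff_nonneg ρ (N x)
    have h4 := cutoff_le_one ρ (N x)
    have h5 : 0 ≤ (1 - cutoff r (N x)) * cutoff ρ (N x) := mul_nonneg (by linarith) h3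
    have h6 : (1 - cutoff r (N x)) * cutoff ρ (N x) ≤ 1 := by nlinarith
    nlinarith
  have main := caccioppoli Z κ hκ φ u
  -- On an arc from `Bd` to some `a i`, `u` falls from `1` to `0` in at most `6 * s` steps, so each
  -- hexagon contributes `1 / (6 * s)`. Arcs on different hexagons have different starting vertices
  -- of their edges, hence the contributions add up.
  have low : (7224 : ℝ) / 2 / 6 ≤ ∑ x ∈ Z, ∑ y ∈ Z, κ x y * (φ x * u x - φ y * u y) ^ 2 := by
    have hs : ∀ s ∈ Finset.Ico (2 * r) ρ, 1 / (s : ℝ) / 6 ≤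
        ∑ x ∈ Z, if N x = s then ∑ y ∈ Z, κ x y * (φ x * u x - φ y * u y) ^ 2 else 0 := by
      intro s hs
      rw [Finset.mem_Ico] at hs
      obtain ⟨C, k, hk1, hk6, C0, CL, ⟨i, hi, Ck⟩, Cadj, CN, Cinj⟩ :=
        Kr.exists_arc Ha Hb He (s := s) (by omega) (by omega)
      have hφC : ∀ j ≤ k, φ (C j) = 1 := fun j hj =>
        hφ1 _ (by simp only [N]; rw [CN j hj]; omega) (by simp only [N]; rw [CN j hj]; omega)
      have hCL : ∀ j, 1 ≤ j → j ≤ k → C j ∈ L := fun j h1 h2 =>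
        ⟨(CL j h1 h2).1, by simp only [N]; rw [CN j h2]; omega, (CL j h1 h2).2⟩
      have hCZ : ∀ j ≤ k, C j ∈ Z := fun j hj => mem_hexBall.2 (by rw [CN j hj]; omega)
      have huk : u (C k) = 0 := by
        simp only [u]
        rw [if_pos (hCL k hk1 le_rfl), Ck, ga i hi, sub_self]
      have h1 := sq_sub_le_mul_sum_sq (fun j => u (C j)) k
      simp only [huk, huBd _ C0] at h1
      have h2 : ∑ j ∈ Finset.range k, (u (C j) - u (C (j + 1))) ^ 2 ≤
          ∑ x ∈ Z, if N x = s then ∑ y ∈ Z, κ x y * (φ x * u x - φ y * u y) ^ 2 else 0 := by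
        calc ∑ j ∈ Finset.range k, (u (C j) - u (C (j + 1))) ^ 2
            ≤ ∑ j ∈ Finset.range k, ∑ y ∈ Z, κ (C j) y * (φ (C j) * u (C j) - φ y * u y) ^ 2 := by
              refine Finset.sum_le_sum fun j hj => ?_
              rw [Finset.mem_range] at hj
              refine le_trans (le_of_eq ?_) (Finset.single_le_sum
                (f := fun y => κ (C j) y * (φ (C j) * u (C j) - φ y * u y) ^ 2)
                (fun y _ => mul_nonneg (hκ0 _ _) (sq_nonneg _)) (hCZ (j + 1) hj))
              simp only [κ]
              rw [if_pos ⟨Cadj j hj, Or.inr (hCL _ (by omega) hj)⟩, hφC j hj.le, hφC _ hj]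
              ring
          _ = ∑ x ∈ (Finset.range k).image C, ∑ y ∈ Z, κ x y * (φ x * u x - φ y * u y) ^ 2 := by
              rw [Finset.sum_image]
              intro i hi j hj h
              rw [Finset.mem_coe, Finset.mem_range] at hi hj
              exact Cinj i hi.le j hj.le h
          _ ≤ _ := by
              rw [← Finset.sum_filter]
              refine Finset.sum_le_sum_of_subset_of_nonneg (fun x hx => ?_) fun x _ _ =>
                Finset.sum_nonneg fun y _ => mul_nonneg (hκ0 _ _) (sq_nonneg _)
              obtain ⟨j, hj, rfl⟩ := Finset.mem_image.1 hx
              rw [Finset.mem_range] at hj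
              exact Finset.mem_filter.2 ⟨hCZ j hj.le, CN j hj.le⟩
      refine le_trans ?_ h2
      set E := ∑ j ∈ Finset.range k, (u (C j) - u (C (j + 1))) ^ 2
      have hE : 0 ≤ E := Finset.sum_nonneg fun _ _ => sq_nonneg _
      have hs0 : (0 : ℝ) < s := by exact_mod_cast (by omega : 0 < s)
      have hk6' : (k : ℝ) ≤ 6 * s := by exact_mod_cast hk6
      rw [div_div, div_le_iff₀ (by positivity)]
      nlinarith
    calc (7224 : ℝ) / 2 / 6 ≤ (∑ s ∈ Finset.Ico (2 * r) ρ, 1 / (s : ℝ)) / 6 := by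
          have := hK r (by omega)
          push_cast at this
          linarith
      _ ≤ ∑ s ∈ Finset.Ico (2 * r) ρ, ∑ x ∈ Z,
          if N x = s then ∑ y ∈ Z, κ x y * (φ x * u x - φ y * u y) ^ 2 else 0 := by
          rw [Finset.sum_div]
          exact Finset.sum_le_sum hs
      _ ≤ _ := by
          rw [Finset.sum_comm]
          refine Finset.sum_le_sum fun x _ => ?_
          rw [Finset.sum_ite_eq]
          split_ifs
          · exact le_rfl
          · exact Finset.sum_nonneg fun y _ => mul_nonneg (hκ0 _ _) (sq_nonneg _)
  -- Each of the two cutoffs contributes twice `150`.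
  have up : ∑ x ∈ Z, ∑ y ∈ Z, κ x y * (u x * u y * (φ x - φ y) ^ 2) ≤ 600 := by
    calc ∑ x ∈ Z, ∑ y ∈ Z, κ x y * (u x * u y * (φ x - φ y) ^ 2)
        ≤ ∑ x ∈ Z, ∑ y ∈ Z, (2 * (if Adj x y then (cutoff r (hexNorm (x - o)) -
              cutoff r (hexNorm (y - o))) ^ 2 else 0) + 2 * (if Adj x y then
              (cutoff ρ (hexNorm (x - o)) - cutoff ρ (hexNorm (y - o))) ^ 2 else 0)) := by
          refine Finset.sum_le_sum fun x _ => Finset.sum_le_sum fun y _ => ?_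
          by_cases h : Adj x y
          · rw [if_pos h, if_pos h]
            refine le_trans ?_ (annulusCutoff_sub_sq_le r ρ _ _)
            have h1 : κ x y ≤ 1 := by simp only [κ]; split_ifs <;> norm_num
            have h2 : u x * u y ≤ 1 := mul_le_one₀ (hu x).2 (hu y).1 (hu y).2
            have h3 : κ x y * (u x * u y) ≤ 1 :=
              mul_le_one₀ h1 (mul_nonneg (hu x).1 (hu y).1) h2
            have h4 := mul_le_mul_of_nonneg_right h3 (sq_nonneg (φ x - φ y))
            rw [one_mul, mul_assoc] at h4
            exact h4
          · simp only [κ]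
            rw [if_neg h, if_neg h, if_neg (fun h' => h h'.1)]
            simp
      _ ≤ 600 := by
          simp only [Finset.sum_add_distrib, ← Finset.mul_sum]
          have h1 := sum_cutoff_sub_sq_le Z o (r := r) (by omega)
          have h2 := sum_cutoff_sub_sq_le Z o (r := ρ) (by omega)
          linarith
  -- The Laplacian term is supported on `Bd`: `u` vanishes at the `a i`, the other vertices of `L`
  -- where `φ` is not zero are harmonic, and elsewhere `u = 0`.
  have fl : ∑ x ∈ Z, φ x ^ 2 * (u x * ∑ y ∈ Z, κ x y * (u x - u y)) ≤ flux o (2 * ρ) Q Bd g := by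
    unfold flux
    have hsub : hexBall o (2 * ρ) ⊆ Z := fun x hx => mem_hexBall.2 ((mem_hexBall.1 hx).trans (by omega))
    rw [← Finset.sum_subset hsub (f := fun x => φ x ^ 2 * (u x * ∑ y ∈ Z, κ x y * (u x - u y)))]
    · refine Finset.sum_le_sum fun x hx => ?_
      rw [mem_hexBall] at hx
      have hnb : ∀ d ∈ dirs, x + d ∈ Z := by
        intro d hd
        have := hexNorm_le_succ_of_adj (o := o) (adj_add (x := x) hd)
        exact mem_hexBall.2 (by omega)
      by_cases hxB : x ∈ Bd
      · rw [if_pos hxB, huBd x hxB, one_mul]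
        have h1 : ∑ y ∈ Z, κ x y * (1 - u y) =
            ∑ d ∈ dirs, if x + d ∈ L then g (x + d) else 0 := by
          rw [← sum_adj_eq hnb (fun y => if y ∈ L then g y else 0)]
          refine Finset.sum_congr rfl fun y _ => ?_
          have hxL : x ∉ L := fun h => Kr.Q_disj x h.1 hxB
          simp only [κ, u, hxL, false_or]
          by_cases h1 : Adj x y <;> by_cases h2 : y ∈ L <;> simp [h1, h2]
        rw [h1]
        have h2 : ∑ d ∈ dirs, (if x + d ∈ L then g (x + d) else 0) ≤
            ∑ d ∈ dirs, if x + d ∈ Q then g (x + d) else 0 := by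
          refine Finset.sum_le_sum fun d _ => ?_
          by_cases h : x + d ∈ L
          · rw [if_pos h, if_pos h.1]
          · rw [if_neg h]
            split_ifs with h'
            exacts [(g01 _ h').1, le_rfl]
        have h3 : 0 ≤ ∑ d ∈ dirs, (if x + d ∈ L then g (x + d) else 0) := by
          refine Finset.sum_nonneg fun d _ => ?_
          split_ifs with h
          exacts [(g01 _ h.1).1, le_rfl]
        exact (mul_le_of_le_one_left h3 (hφle x)).trans h2
      · rw [if_neg hxB]
        refine le_of_eq ?_
        by_cases hxL : x ∈ L
        swap
        · have : u x = 0 := by simp only [u]; rw [if_neg hxL, if_neg hxB]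
          rw [this]; ring
        by_cases hφx : φ x = 0
        · rw [hφx]; ring
        have hN : r < N x ∧ N x < 2 * ρ := by
          by_contra hcon
          exact hφx (hφ0 x (by omega))
        have hux : u x = 1 - g x := by simp only [u]; rw [if_pos hxL]
        by_cases hxa : ∃ i ≤ n, x = a i
        · obtain ⟨i, hi, rfl⟩ := hxa
          rw [hux, ga i hi]; ring
        have hxb : ∀ i ≤ n, x ≠ b i := by
          rintro i hi rfl
          have h1 := Hb i hi hxB
          rw [hxL.2.2] at h1
          exact absurd h1 (by decide)
        push Not at hxa
        have hharm := gh x hxL.1 fun i hi => ⟨hxa i hi, hxb i hi⟩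
        have h1 : ∑ y ∈ Z, κ x y * (u x - u y) = ∑ d ∈ dirs, (g (x + d) - g x) := by
          rw [← sum_adj_eq hnb (fun y => g y - g x)]
          refine Finset.sum_congr rfl fun y _ => ?_
          simp only [κ, hxL, true_or, and_true]
          by_cases hadj : Adj x y
          swap
          · rw [if_neg hadj, if_neg hadj, zero_mul]
          rw [if_pos hadj, if_pos hadj, one_mul, hux]
          have hy1 := hexNorm_le_succ_of_adj (o := o) hadj
          have hy2 := hexNorm_le_succ_of_adj (o := o) hadj.symm
          simp only [N] at hN
          -- A neighbour in `Q` with the other colour would be joined to `x` by a path edge, making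
          -- `x` one of the `a i` or `b i`.
          have huy : u y = 1 - g y := by
            by_cases hyB : y ∈ Bd
            · rw [huBd y hyB, gBd y hyB, sub_zero]
            · have hyQ := (Kr.Q_step x hxL.1 y hadj (by omega)).resolve_right hyB
              have hyL : y ∈ L := by
                refine ⟨hyQ, by simp only [N]; omega, ?_⟩
                by_contra hne
                obtain ⟨i, hi, ⟨h, -⟩ | ⟨h, -⟩⟩ := He x y hadj hxB hyB (by omega) (by omega)
                  (by rw [hxL.2.2]; exact fun h => hne h.symm)
                exacts [hxa i hi h, hxb i hi h]
              simp only [u]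
              rw [if_pos hyL]
          rw [huy]; ring
        rw [h1, Finset.sum_sub_distrib, Finset.sum_const, card_dirs, nsmul_eq_mul, hharm]
        push_cast
        ring
    · intro x hx hx'
      rw [mem_hexBall] at hx'
      rw [hφ0 x (Or.inr (by simp only [N]; omega))]
      ring
  linarith

/-! ### Decay of the energy and of the flux towards a boundary point -/

/-- The Dirichlet energy of `f` in a ball (each edge is counted twice). -/
noncomputable def energy (o : Vertex) (f : Vertex → ℝ) (k : ℕ) : ℝ :=
  ∑ x ∈ hexBall o k, ∑ y ∈ hexBall o k, if Adj x y then (f x - f y) ^ 2 else 0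

/-- `f` takes values in `[0, 1]`, vanishes off `Q` and is harmonic in `Q` up to distance `R`. -/
structure HarmonicOn (o : Vertex) (R : ℕ) (Q : Set Vertex) (f : Vertex → ℝ) : Prop where
  nonneg : ∀ x, 0 ≤ f x
  le_one : ∀ x, f x ≤ 1
  zero : ∀ x ∉ Q, f x = 0
  harm : ∀ x ∈ Q, hexNorm (x - o) < R → f x = (∑ d ∈ dirs, f (x + d)) / 6

theorem ite_sq_nonneg {p : Prop} [Decidable p] (a : ℝ) : 0 ≤ if p then a ^ 2 else 0 := by
  split_ifs
  exacts [sq_nonneg _, le_rfl]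

theorem hexBall_subset {o : Vertex} {j k : ℕ} (h : j ≤ k) : hexBall o j ⊆ hexBall o k :=
  fun _ hx => mem_hexBall.2 ((mem_hexBall.1 hx).trans h)

theorem energy_mono (o : Vertex) (f : Vertex → ℝ) {j k : ℕ} (h : j ≤ k) :
    energy o f j ≤ energy o f k := by
  unfold energy
  refine (Finset.sum_le_sum fun x _ => Finset.sum_le_sum_of_subset_of_nonneg (hexBall_subset h)
    fun y _ _ => ite_sq_nonneg _).trans ?_
  exact Finset.sum_le_sum_of_subset_of_nonneg (hexBall_subset h) fun x _ _ =>
    Finset.sum_nonneg fun y _ => ite_sq_nonneg _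

theorem hexBall_nb {o x d : Vertex} {k l : ℕ} (hx : hexNorm (x - o) ≤ k) (hk : k < l)
    (hd : d ∈ dirs) : x + d ∈ hexBall o l := by
  have := hexNorm_le_succ_of_adj (o := o) (adj_add (x := x) hd)
  exact mem_hexBall.2 (by omega)

namespace HarmonicOn

variable {o : Vertex} {R : ℕ} {Q : Set Vertex} {f : Vertex → ℝ}

theorem sum_sub_eq_zero (h : HarmonicOn o R Q f) {x : Vertex} {l : ℕ} (hx : x ∈ Q)
    (hxR : hexNorm (x - o) < R) (hl : hexNorm (x - o) < l) :
    ∑ y ∈ hexBall o l, (if Adj x y then f x - f y else 0) = 0 := by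
  rw [sum_adj_eq (fun d hd => hexBall_nb le_rfl hl hd) (fun y => f x - f y),
    Finset.sum_sub_distrib, Finset.sum_const, card_dirs, nsmul_eq_mul, h.harm x hx hxR]
  push_cast
  ring

/-- Caccioppoli's identity with a cutoff at scale `k`: the Laplacian term vanishes because `f` is
zero off `Q` and harmonic in `Q` on the support of the cutoff. -/
theorem energy_le_aux (h : HarmonicOn o R Q f) {k : ℕ} (hk : 0 < k) (hkR : 2 * k ≤ R) :
    energy o f k ≤ ∑ x ∈ hexBall o (2 * k + 1), ∑ y ∈ hexBall o (2 * k + 1), if Adj x y then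
      f x * f y * (cutoff k (hexNorm (x - o)) - cutoff k (hexNorm (y - o))) ^ 2 else 0 := by
  set Z := hexBall o (2 * k + 1) with hZ
  let κ : Vertex → Vertex → ℝ := fun x y => if Adj x y then 1 else 0
  let ψ : Vertex → ℝ := fun x => cutoff k (hexNorm (x - o))
  have main := caccioppoli Z κ (fun x y => by simp only [κ]; exact if_congr adj_comm rfl rfl) ψ f
  have h0 : ∑ x ∈ Z, ψ x ^ 2 * (f x * ∑ y ∈ Z, κ x y * (f x - f y)) = 0 := by
    refine Finset.sum_eq_zero fun x _ => ?_
    by_cases hxQ : x ∈ Q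
    swap
    · rw [h.zero x hxQ]; ring
    by_cases hx : hexNorm (x - o) < 2 * k
    · have := h.sum_sub_eq_zero hxQ (l := 2 * k + 1) (by omega) (by omega)
      simp only [κ, ite_mul, one_mul, zero_mul]
      rw [this]; ring
    · simp only [ψ]
      rw [cutoff_eq_zero hk (by omega)]; ring
  rw [h0, mul_zero, add_zero] at main
  have e : ∑ x ∈ Z, ∑ y ∈ Z, (if Adj x y then
      f x * f y * (cutoff k (hexNorm (x - o)) - cutoff k (hexNorm (y - o))) ^ 2 else 0) =
      ∑ x ∈ Z, ∑ y ∈ Z, κ x y * (f x * f y * (ψ x - ψ y) ^ 2) := by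
    simp only [κ, ψ, ite_mul, one_mul, zero_mul]
  rw [e, ← main]
  have hsub : hexBall o k ⊆ Z := hexBall_subset (by omega)
  have hκ : ∀ x y, 0 ≤ κ x y := by intro x y; simp only [κ]; split_ifs <;> norm_num
  calc energy o f k = ∑ x ∈ hexBall o k, ∑ y ∈ hexBall o k, κ x y * (ψ x * f x - ψ y * f y) ^ 2 := by
        refine Finset.sum_congr rfl fun x hx => Finset.sum_congr rfl fun y hy => ?_
        simp only [κ, ψ]
        rw [cutoff_eq_one hk (mem_hexBall.1 hx), cutoff_eq_one hk (mem_hexBall.1 hy)]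
        simp only [ite_mul, one_mul, zero_mul]
    _ ≤ ∑ x ∈ hexBall o k, ∑ y ∈ Z, κ x y * (ψ x * f x - ψ y * f y) ^ 2 :=
        Finset.sum_le_sum fun x _ => Finset.sum_le_sum_of_subset_of_nonneg hsub
          fun y _ _ => mul_nonneg (hκ x y) (sq_nonneg _)
    _ ≤ _ := Finset.sum_le_sum_of_subset_of_nonneg hsub fun x _ _ => Finset.sum_nonneg
          fun y _ => mul_nonneg (hκ x y) (sq_nonneg _)

theorem energy_le (h : HarmonicOn o R Q f) {k : ℕ} (hk : 0 < k) (hkR : 2 * k ≤ R) :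
    energy o f k ≤ 150 := by
  refine (h.energy_le_aux hk hkR).trans (le_trans ?_ (sum_cutoff_sub_sq_le (hexBall o (2 * k + 1)) o hk))
  refine Finset.sum_le_sum fun x _ => Finset.sum_le_sum fun y _ => ?_
  split_ifs
  · exact mul_le_of_le_one_left (sq_nonneg _) (mul_le_one₀ (h.le_one x) (h.nonneg y) (h.le_one y))
  · exact le_rfl

end HarmonicOn

/-- Poincaré's inequality on a hexagon on which the function has a zero. -/
theorem sum_sq_hexagon_le {o y : Vertex} {f : Vertex → ℝ} {s l : ℕ} (hs : 0 < s) (hsl : s ≤ l)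
    (hy : hexNorm (y - o) = s) (hfy : f y = 0) :
    ∑ x ∈ hexBall o l, (if hexNorm (x - o) = s then f x ^ 2 else 0) ≤
      36 * (s : ℝ) ^ 2 * ∑ x ∈ hexBall o l, if hexNorm (x - o) = s then
        ∑ y ∈ hexBall o l, (if hexNorm (y - o) = s then
          if Adj x y then (f x - f y) ^ 2 else 0 else 0) else 0 := by
  classical
  obtain ⟨C, C0, C6, Cadj, Cnorm, Cinj, Csurj, -⟩ := exists_hexCycle hs hy
  set e := ∑ j ∈ Finset.range (6 * s), (f (C j) - f (C (j + 1))) ^ 2 with he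
  have he0 : 0 ≤ e := Finset.sum_nonneg fun _ _ => sq_nonneg _
  have hinj : Set.InjOn C (Finset.range (6 * s)) := by
    intro i hi j hj h
    rw [Finset.mem_coe, Finset.mem_range] at hi hj
    exact Cinj i j hi hj h
  -- The cycle starts at the zero `y`, so every value is bounded by the increments along a path of
  -- length at most `6 * s`; summing over the cycle gives the factor `(6 * s) ^ 2`.
  have h1 : ∀ j < 6 * s, f (C j) ^ 2 ≤ 6 * s * e := by
    intro j hj
    have h := sq_sub_le_mul_sum_sq (fun j => f (C j)) j
    simp only [C0, hfy, sub_zero] at h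
    refine h.trans ?_
    gcongr
    · exact_mod_cast hj.le
    · exact Finset.sum_le_sum_of_subset_of_nonneg (Finset.range_subset_range.2 hj.le)
        fun _ _ _ => sq_nonneg _
  have h2 : ∑ x ∈ hexBall o l, (if hexNorm (x - o) = s then f x ^ 2 else 0) ≤
      36 * (s : ℝ) ^ 2 * e := by
    rw [← Finset.sum_filter]
    calc ∑ x ∈ hexBall o l with hexNorm (x - o) = s, f x ^ 2
        ≤ ∑ x ∈ (Finset.range (6 * s)).image C, f x ^ 2 := by
          refine Finset.sum_le_sum_of_subset_of_nonneg (fun x hx => ?_) fun _ _ _ => sq_nonneg _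
          obtain ⟨j, hj, rfl⟩ := Csurj x (Finset.mem_filter.1 hx).2
          exact Finset.mem_image_of_mem _ (Finset.mem_range.2 hj)
      _ = ∑ j ∈ Finset.range (6 * s), f (C j) ^ 2 := Finset.sum_image hinj
      _ ≤ ∑ j ∈ Finset.range (6 * s), 6 * s * e :=
          Finset.sum_le_sum fun j hj => h1 j (Finset.mem_range.1 hj)
      _ = 36 * (s : ℝ) ^ 2 * e := by
          rw [Finset.sum_const, Finset.card_range, nsmul_eq_mul]
          push_cast
          ring
  refine h2.trans (mul_le_mul_of_nonneg_left ?_ (by positivity))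
  have hCl : ∀ j ≤ 6 * s, C j ∈ hexBall o l := fun j hj => mem_hexBall.2 (by rw [Cnorm j hj]; exact hsl)
  let B : Vertex → Vertex → ℝ := fun x y => if hexNorm (y - o) = s then
          if Adj x y then (f x - f y) ^ 2 else 0 else 0
  have hnn : ∀ x y : Vertex, 0 ≤ B x y := by
    intro x y
    simp only [B]
    split_ifs
    exacts [sq_nonneg _, le_rfl, le_rfl]
  have hB : ∀ j < 6 * s, (f (C j) - f (C (j + 1))) ^ 2 = B (C j) (C (j + 1)) := by
    intro j hj
    simp only [B]
    rw [if_pos (Cnorm _ hj), if_pos (Cadj j hj)]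
  have h3 : e ≤ ∑ x ∈ hexBall o l with hexNorm (x - o) = s, ∑ y ∈ hexBall o l, B x y := by
    calc e ≤ ∑ j ∈ Finset.range (6 * s), ∑ y ∈ hexBall o l, B (C j) y := by
          refine Finset.sum_le_sum fun j hj => ?_
          rw [Finset.mem_range] at hj
          rw [hB j hj]
          exact Finset.single_le_sum (f := B (C j)) (fun y _ => hnn _ _) (hCl (j + 1) hj)
      _ = ∑ x ∈ (Finset.range (6 * s)).image C, ∑ y ∈ hexBall o l, B x y :=
          (Finset.sum_image (f := fun x => ∑ y ∈ hexBall o l, B x y) hinj).symm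
      _ ≤ _ := by
          refine Finset.sum_le_sum_of_subset_of_nonneg (fun x hx => ?_) fun _ _ _ =>
            Finset.sum_nonneg fun _ _ => hnn _ _
          obtain ⟨j, hj, rfl⟩ := Finset.mem_image.1 hx
          rw [Finset.mem_range] at hj
          exact Finset.mem_filter.2 ⟨hCl j hj.le, Cnorm j hj.le⟩
  rw [← Finset.sum_filter]
  exact h3

namespace HarmonicOn

variable {o : Vertex} {R : ℕ} {Q : Set Vertex} {f : Vertex → ℝ}

/-- Widman's hole filling: the energy inside is at most `864` times the energy in the annulus
outside the ball of radius `k`, and adding `864` times the inner energy to both sides gives the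
ratio `864 / 865`. -/
theorem energy_hole_filling (h : HarmonicOn o R Q f) {k : ℕ} (hk : 0 < k) (hkR : 2 * (k + 1) ≤ R)
    (hz : ∀ s, k ≤ s → s ≤ 2 * (k + 1) → ∃ y, hexNorm (y - o) = s ∧ f y = 0) :
    energy o f k ≤ 864 / 865 * energy o f (2 * (k + 1)) := by
  -- With `r = k + 1`, the edges along hexagons of radius at least `r` are not counted in `energy o
  -- f k`.
  set r := k + 1 with hr
  set Z := hexBall o (2 * r + 1) with hZ
  have hrpos : (0 : ℝ) < r := by exact_mod_cast (by omega : 0 < r)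
  have h1 := h.energy_le_aux (k := r) (by omega) hkR
  -- `2 * f x * f y ≤ f x ^ 2 + f y ^ 2`, and the two squares have equal sums by symmetry.
  have h2 : ∑ x ∈ Z, ∑ y ∈ Z, (if Adj x y then
      f x * f y * (cutoff r (hexNorm (x - o)) - cutoff r (hexNorm (y - o))) ^ 2 else 0) ≤
      ∑ x ∈ Z, ∑ y ∈ Z, (if Adj x y then
      f x ^ 2 * (cutoff r (hexNorm (x - o)) - cutoff r (hexNorm (y - o))) ^ 2 else 0) := by
    set A := ∑ x ∈ Z, ∑ y ∈ Z, (if Adj x y then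
      f x ^ 2 * (cutoff r (hexNorm (x - o)) - cutoff r (hexNorm (y - o))) ^ 2 else 0) with hA
    have hA' : A = ∑ x ∈ Z, ∑ y ∈ Z, (if Adj x y then
        f y ^ 2 * (cutoff r (hexNorm (x - o)) - cutoff r (hexNorm (y - o))) ^ 2 else 0) := by
      rw [hA, Finset.sum_comm]
      refine Finset.sum_congr rfl fun x _ => Finset.sum_congr rfl fun y _ => ?_
      refine if_congr adj_comm ?_ rfl
      ring
    have : 2 * ∑ x ∈ Z, ∑ y ∈ Z, (if Adj x y then
        f x * f y * (cutoff r (hexNorm (x - o)) - cutoff r (hexNorm (y - o))) ^ 2 else 0) ≤ A + A := by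
      nth_rewrite 2 [hA']
      rw [hA, ← Finset.sum_add_distrib, Finset.mul_sum]
      refine Finset.sum_le_sum fun x _ => ?_
      rw [← Finset.sum_add_distrib, Finset.mul_sum]
      refine Finset.sum_le_sum fun y _ => ?_
      split_ifs
      · have := mul_nonneg (sq_nonneg (f x - f y))
          (sq_nonneg (cutoff r (hexNorm (x - o)) - cutoff r (hexNorm (y - o))))
        linarith
      · simp
    linarith
  have h3 : ∑ x ∈ Z, ∑ y ∈ Z, (if Adj x y then
      f x ^ 2 * (cutoff r (hexNorm (x - o)) - cutoff r (hexNorm (y - o))) ^ 2 else 0) ≤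
      6 / (r : ℝ) ^ 2 * ∑ x ∈ Z, if hexNorm (x - o) ∈ Finset.Icc r (2 * r) then f x ^ 2 else 0 := by
    rw [Finset.mul_sum]
    refine Finset.sum_le_sum fun x _ => ?_
    have h4 : ∀ y ∈ Z, (if Adj x y then
        f x ^ 2 * (cutoff r (hexNorm (x - o)) - cutoff r (hexNorm (y - o))) ^ 2 else 0) ≤
        if Adj x y then (f x ^ 2 * if hexNorm (x - o) ∈ Finset.Icc r (2 * r)
          then 1 / (r : ℝ) ^ 2 else 0) else 0 := by
      intro y _
      split_ifs with hxy hx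
      · have := cutoff_sub_sq_le (o := o) (r := r) (by omega) hxy
        rw [if_pos hx] at this
        exact mul_le_mul_of_nonneg_left this (sq_nonneg _)
      · have := cutoff_sub_sq_le (o := o) (r := r) (by omega) hxy
        rw [if_neg hx] at this
        exact mul_le_mul_of_nonneg_left this (sq_nonneg _)
      · exact le_rfl
    refine (Finset.sum_le_sum h4).trans ((sum_adj_le _ fun y => ?_).trans (le_of_eq ?_))
    · split_ifs
      exacts [by positivity, by simp]
    · rw [Finset.sum_const, card_dirs, nsmul_eq_mul]
      split_ifs
      · push_cast; ring
      · simp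
  -- Poincaré's inequality on each hexagon with `s ≤ 2 * r`, where `36 * s ^ 2 ≤ 144 * r ^ 2`. Only
  -- tangential edges are needed.
  have h5 : ∑ x ∈ Z, (if hexNorm (x - o) ∈ Finset.Icc r (2 * r) then f x ^ 2 else 0) ≤
      144 * (r : ℝ) ^ 2 * (energy o f (2 * r) - energy o f k) := by
    let W := hexBall o (2 * r)
    let D : ℕ → ℝ := fun s => ∑ x ∈ W, if hexNorm (x - o) = s then
        ∑ y ∈ W, (if hexNorm (y - o) = s then
          if Adj x y then (f x - f y) ^ 2 else 0 else 0) else 0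
    have h6 : ∑ x ∈ Z, (if hexNorm (x - o) ∈ Finset.Icc r (2 * r) then f x ^ 2 else 0) =
        ∑ s ∈ Finset.Icc r (2 * r), ∑ x ∈ W, if hexNorm (x - o) = s then f x ^ 2 else 0 := by
      rw [Finset.sum_comm]
      rw [← Finset.sum_subset (hexBall_subset (by omega) : W ⊆ Z)]
      · refine Finset.sum_congr rfl fun x _ => ?_
        rw [Finset.sum_ite_eq]
      · intro x _ hx
        rw [mem_hexBall] at hx
        rw [if_neg (by rw [Finset.mem_Icc]; omega)]
    have h7 : ∑ s ∈ Finset.Icc r (2 * r), D s ≤ energy o f (2 * r) - energy o f k := by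
      have hsub : hexBall o k ⊆ W := hexBall_subset (by omega)
      have e1 : energy o f k = ∑ x ∈ W, ∑ y ∈ W, if hexNorm (x - o) ≤ k ∧ hexNorm (y - o) ≤ k then
          (if Adj x y then (f x - f y) ^ 2 else 0) else 0 := by
        unfold energy
        rw [← Finset.sum_subset hsub]
        · refine Finset.sum_congr rfl fun x hx => ?_
          rw [← Finset.sum_subset hsub]
          · refine Finset.sum_congr rfl fun y hy => ?_
            rw [if_pos (show hexNorm (x - o) ≤ k ∧ hexNorm (y - o) ≤ k from
              ⟨mem_hexBall.1 hx, mem_hexBall.1 hy⟩)]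
          · intro y _ hy
            rw [mem_hexBall] at hy
            rw [if_neg (fun h => hy h.2)]
        · intro x _ hx
          rw [mem_hexBall] at hx
          exact Finset.sum_eq_zero fun y _ => if_neg (fun h => hx h.1)
      have e2 : ∑ s ∈ Finset.Icc r (2 * r), D s = ∑ x ∈ W, ∑ y ∈ W,
          if hexNorm (x - o) ∈ Finset.Icc r (2 * r) ∧ hexNorm (y - o) = hexNorm (x - o) then
          (if Adj x y then (f x - f y) ^ 2 else 0) else 0 := by
        simp only [D]
        rw [Finset.sum_comm]
        refine Finset.sum_congr rfl fun x _ => ?_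
        rw [Finset.sum_ite_eq]
        split_ifs with hx
        · refine Finset.sum_congr rfl fun y _ => ?_
          simp only [hx, true_and]
        · rw [Finset.sum_eq_zero]
          intro y _
          simp only [hx, false_and, if_false]
      have e3 : energy o f (2 * r) = ∑ x ∈ W, ∑ y ∈ W, if Adj x y then (f x - f y) ^ 2 else 0 := rfl
      rw [le_sub_iff_add_le, e1, e2, e3, ← Finset.sum_add_distrib]
      refine Finset.sum_le_sum fun x _ => ?_
      rw [← Finset.sum_add_distrib]
      refine Finset.sum_le_sum fun y _ => ?_
      have := ite_sq_nonneg (p := Adj x y) (f x - f y)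
      generalize (if Adj x y then (f x - f y) ^ 2 else 0) = t at *
      simp only [Finset.mem_Icc]
      split_ifs
      · omega
      · linarith
      · linarith
      · linarith
    rw [h6]
    calc ∑ s ∈ Finset.Icc r (2 * r), ∑ x ∈ W, (if hexNorm (x - o) = s then f x ^ 2 else 0)
        ≤ ∑ s ∈ Finset.Icc r (2 * r), 144 * (r : ℝ) ^ 2 * D s := by
          refine Finset.sum_le_sum fun s hs => ?_
          rw [Finset.mem_Icc] at hs
          obtain ⟨y, hy, hfy⟩ := hz s (by omega) hs.2
          refine (sum_sq_hexagon_le (by omega) hs.2 hy hfy).trans ?_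
          have hD : 0 ≤ D s := by
            refine Finset.sum_nonneg fun x _ => ?_
            split_ifs
            · refine Finset.sum_nonneg fun y _ => ?_
              split_ifs
              exacts [sq_nonneg _, le_rfl, le_rfl]
            · exact le_rfl
          refine mul_le_mul_of_nonneg_right ?_ hD
          have : (s : ℝ) ≤ 2 * r := by exact_mod_cast hs.2
          nlinarith
      _ = 144 * (r : ℝ) ^ 2 * ∑ s ∈ Finset.Icc r (2 * r), D s := by rw [Finset.mul_sum]
      _ ≤ _ := mul_le_mul_of_nonneg_left h7 (by positivity)
  have h8 : energy o f r ≤ 864 * (energy o f (2 * r) - energy o f k) := by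
    refine h1.trans (h2.trans (h3.trans ((mul_le_mul_of_nonneg_left h5 (by positivity)).trans
      (le_of_eq ?_))))
    field_simp
    ring
  have h9 := energy_mono o f (show k ≤ r by omega)
  linarith

theorem energy_decay (h : HarmonicOn o R Q f) {k : ℕ} (hk : 0 < k)
    (hz : ∀ s, k ≤ s → s ≤ R → ∃ y, hexNorm (y - o) = s ∧ f y = 0) (i : ℕ)
    (hi : 2 * (4 ^ i * k) ≤ R) : energy o f k ≤ 150 * (864 / 865) ^ i := by
  have key : ∀ j ≤ i, energy o f k ≤ (864 / 865) ^ j * energy o f (4 ^ j * k) := by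
    intro j hj
    induction j with
    | zero => simp
    | succ j ih =>
      have h1 : 4 ^ (j + 1) ≤ 4 ^ i := Nat.pow_le_pow_right (by norm_num) hj
      have h2 : 4 ^ (j + 1) * k ≤ 4 ^ i * k := Nat.mul_le_mul_right _ h1
      have h3 : 4 ^ (j + 1) * k = 4 * (4 ^ j * k) := by ring
      have h4 : 0 < 4 ^ j * k := by positivity
      have h5 : k ≤ 4 ^ j * k := Nat.le_mul_of_pos_left _ (by positivity)
      have := h.energy_hole_filling h4 (by omega) fun s hs hs' => hz s (by omega) (by omega)
      -- Scales grow by `4` instead of `2` to absorb the added `1` in the hole-filling radius.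
      have h6 := energy_mono o f (show 2 * (4 ^ j * k + 1) ≤ 4 ^ (j + 1) * k by omega)
      calc energy o f k ≤ (864 / 865) ^ j * energy o f (4 ^ j * k) := ih (by omega)
        _ ≤ (864 / 865) ^ j * (864 / 865 * energy o f (4 ^ (j + 1) * k)) := by
            gcongr
            linarith
        _ = _ := by ring
  calc energy o f k ≤ (864 / 865) ^ i * energy o f (4 ^ i * k) := key i le_rfl
    _ ≤ (864 / 865) ^ i * 150 := by
        gcongr
        exact h.energy_le (by positivity) hi
    _ = _ := by ring

/-- The flux into a small ball decays like a power of its radius. -/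
theorem flux_le {g : Vertex → ℝ} {Bd : Set Vertex} (h : HarmonicOn o R Q f)
    (hfg : ∀ x ∈ Q, f x = g x) (hd : ∀ x ∈ Q, x ∉ Bd) {ρ : ℕ} (hρ : 0 < ρ)
    (hz : ∀ s, ρ ≤ s → s ≤ R → ∃ y, hexNorm (y - o) = s ∧ f y = 0) (i : ℕ)
    (hi : 2 * (4 ^ i * (2 * ρ + 1)) ≤ R) :
    flux o ρ Q Bd g ≤ 75 * √(864 / 865) ^ i := by
  classical
  have h4 : 1 ≤ 4 ^ i := Nat.one_le_pow _ _ (by norm_num)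
  have hρR : 2 * ρ + 1 ≤ 4 ^ i * (2 * ρ + 1) := Nat.le_mul_of_pos_left _ h4
  set Z := hexBall o (2 * ρ + 1) with hZ
  let ψ : Vertex → ℝ := fun x => cutoff ρ (hexNorm (x - o))
  let A : Vertex → Vertex → ℝ := fun x y => if Adj x y then 1 else 0
  -- The Laplacian of `f` is tested against a cutoff. It vanishes at the vertices of `Q` where the
  -- cutoff is nonzero and is nonnegative off `Q`, where `f` has its minimum `0`; so all terms other
  -- than those of the flux can be added.
  have h1 : flux o ρ Q Bd g ≤ ∑ x ∈ Z, ∑ y ∈ Z, A x y * (ψ x * (f y - f x)) := by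
    unfold flux
    have hsub : hexBall o ρ ⊆ Z := hexBall_subset (by omega)
    have hterm : ∀ x, hexNorm (x - o) ≤ 2 * ρ → x ∉ Q →
        ∑ y ∈ Z, A x y * (ψ x * (f y - f x)) = ψ x * ∑ d ∈ dirs, f (x + d) := by
      intro x hx hxQ
      rw [← sum_adj_eq (fun d hd => hexBall_nb hx (Nat.lt_succ_self _) hd) f, Finset.mul_sum]
      refine Finset.sum_congr rfl fun y _ => ?_
      simp only [A]
      rw [h.zero x hxQ]
      split_ifs <;> ring
    have hnn : ∀ x ∈ Z, 0 ≤ ∑ y ∈ Z, A x y * (ψ x * (f y - f x)) := by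
      intro x _
      by_cases hx : hexNorm (x - o) < 2 * ρ
      · by_cases hxQ : x ∈ Q
        · have := h.sum_sub_eq_zero hxQ (l := 2 * ρ + 1) (by omega) (by omega)
          refine le_of_eq ?_
          calc (0 : ℝ) = -ψ x * ∑ y ∈ Z, (if Adj x y then f x - f y else 0) := by rw [this, mul_zero]
            _ = _ := by
              rw [Finset.mul_sum]
              refine Finset.sum_congr rfl fun y _ => ?_
              simp only [A]
              split_ifs <;> ring
        · rw [hterm x hx.le hxQ]
          exact mul_nonneg (cutoff_nonneg _ _) (Finset.sum_nonneg fun d _ => h.nonneg _)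
      · refine le_of_eq (Finset.sum_eq_zero fun y _ => ?_).symm
        simp only [ψ]
        rw [cutoff_eq_zero hρ (by omega)]; ring
    refine le_trans (Finset.sum_le_sum fun x hx => ?_)
      (Finset.sum_le_sum_of_subset_of_nonneg hsub fun x hx _ => hnn x hx)
    rw [mem_hexBall] at hx
    split_ifs with hxB
    · rw [hterm x (by omega) (fun hq => hd x hq hxB)]
      simp only [ψ]
      rw [cutoff_eq_one hρ hx, one_mul]
      refine Finset.sum_le_sum fun d _ => ?_
      split_ifs with hq
      · rw [hfg _ hq]
      · exact h.nonneg _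
    · exact hnn x (hsub (mem_hexBall.2 hx))
  -- Summation by parts. Cauchy–Schwarz then gives half of `√(150 * 150 * (864 / 865) ^ i)`.
  have h2 : ∑ x ∈ Z, ∑ y ∈ Z, A x y * (ψ x * (f y - f x)) =
      (∑ p ∈ Z ×ˢ Z, (A p.1 p.2 * (ψ p.1 - ψ p.2)) * (A p.1 p.2 * (f p.2 - f p.1))) / 2 := by
    have e : ∑ x ∈ Z, ∑ y ∈ Z, A x y * (ψ x * (f y - f x)) =
        ∑ x ∈ Z, ∑ y ∈ Z, A x y * (ψ y * (f x - f y)) := by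
      rw [Finset.sum_comm]
      refine Finset.sum_congr rfl fun x _ => Finset.sum_congr rfl fun y _ => ?_
      simp only [A]
      rw [if_congr adj_comm rfl rfl]
    rw [eq_div_iff two_ne_zero, mul_two]
    nth_rewrite 2 [e]
    rw [← Finset.sum_add_distrib, Finset.sum_product]
    refine Finset.sum_congr rfl fun x _ => ?_
    rw [← Finset.sum_add_distrib]
    refine Finset.sum_congr rfl fun y _ => ?_
    simp only [A]
    split_ifs <;> ring
  have h3 := Finset.sum_mul_sq_le_sq_mul_sq (Z ×ˢ Z) (fun p => A p.1 p.2 * (ψ p.1 - ψ p.2))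
    (fun p => A p.1 p.2 * (f p.2 - f p.1))
  have e1 : ∑ p ∈ Z ×ˢ Z, (A p.1 p.2 * (ψ p.1 - ψ p.2)) ^ 2 ≤ 150 := by
    rw [Finset.sum_product]
    refine le_trans (le_of_eq ?_) (sum_cutoff_sub_sq_le Z o hρ)
    refine Finset.sum_congr rfl fun x _ => Finset.sum_congr rfl fun y _ => ?_
    simp only [A, ψ]
    split_ifs <;> ring
  have e2 : ∑ p ∈ Z ×ˢ Z, (A p.1 p.2 * (f p.2 - f p.1)) ^ 2 ≤ 150 * (864 / 865) ^ i := by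
    rw [Finset.sum_product]
    refine le_trans (le_of_eq ?_) (h.energy_decay (k := 2 * ρ + 1) (by omega)
      (fun s hs hs' => hz s (by omega) hs') i hi)
    refine Finset.sum_congr rfl fun x _ => Finset.sum_congr rfl fun y _ => ?_
    simp only [A]
    split_ifs <;> ring
  rw [h2] at h1
  refine h1.trans ?_
  rw [div_le_iff₀ two_pos]
  refine le_of_sq_le_sq ?_ (by positivity)
  calc _ ≤ _ := h3
      _ ≤ 150 * (150 * (864 / 865) ^ i) := by
          gcongr
      _ = (75 * √(864 / 865) ^ i * 2) ^ 2 := by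
          rw [mul_pow, mul_pow, ← pow_mul, mul_comm i 2, pow_mul, Real.sq_sqrt (by norm_num)]
          ring

end HarmonicOn

/-! ### Harmonic extensions and their martingale property -/

/-- Maximum principle for the average over the six neighbours on a finite set of vertices. -/
lemma le_of_forall_finite {I : Set Vertex} (hI : I.Finite) {f : Vertex → ℝ} {c : ℝ}
    (hf : ∀ x ∈ I, f x = (∑ d ∈ dirs, f (x + d)) / 6 ∨ f x ≤ c)
    (hb : ∀ x ∈ I, ∀ d ∈ dirs, x + d ∈ I ∨ f (x + d) ≤ c) : ∀ x ∈ I, f x ≤ c := by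
  by_contra! hcon
  obtain ⟨x₀, hx₀, hc₀⟩ := hcon
  obtain ⟨x₁, hx₁, hmax⟩ := Set.exists_max_image I f hI ⟨x₀, hx₀⟩
  have hc₁ : c < f x₁ := hc₀.trans_le (hmax _ hx₀)
  -- Among the maximum points, take one with the largest first coordinate: its right neighbour would
  -- also be a maximum point.
  obtain ⟨x, ⟨hx, hxm⟩, hcoord⟩ := Set.exists_max_image {x ∈ I | f x = f x₁} Prod.fst
    (hI.subset (Set.sep_subset _ _)) ⟨x₁, hx₁, rfl⟩
  have hle : ∀ d ∈ dirs, f (x + d) ≤ f x₁ := by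
    intro d hd
    rcases hb x hx d hd with h | h
    · exact hmax _ h
    · exact h.trans hc₁.le
  have havg : f x = (∑ d ∈ dirs, f (x + d)) / 6 := (hf x hx).resolve_right (by rw [hxm]; exact hc₁.not_ge)
  have hmem : ((1, 0) : Vertex) ∈ dirs := by decide
  have heq : f (x + (1, 0)) = f x₁ := by
    by_contra hne
    have hlt : ∑ d ∈ dirs, f (x + d) < ∑ d ∈ dirs, f x₁ :=
      Finset.sum_lt_sum hle ⟨_, hmem, lt_of_le_of_ne (hle _ hmem) hne⟩
    rw [Finset.sum_const, card_dirs, nsmul_eq_mul] at hlt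
    push_cast at hlt
    linarith
  have hin : x + (1, 0) ∈ I := (hb x hx _ hmem).resolve_right (by rw [heq]; exact hc₁.not_ge)
  have := hcoord _ ⟨hin, heq⟩
  simp at this

/-- Averaging off `V` is a monotone operator on the complete lattice of functions with values in
`[0, 1]`, so it has a fixed point by Knaster–Tarski. -/
lemma exists_isHarmonicExtension (V : Set Vertex) {h : Vertex → ℝ}
    (h01 : ∀ v ∈ V, 0 ≤ h v ∧ h v ≤ 1) :
    ∃ f, IsHarmonicExtension V h f ∧ ∀ v, 0 ≤ f v ∧ f v ≤ 1 := by
  classical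
  have : Fact ((0 : ℝ) ≤ 1) := ⟨zero_le_one⟩
  let T : (Vertex → Set.Icc (0 : ℝ) 1) →o (Vertex → Set.Icc (0 : ℝ) 1) :=
    { toFun := fun f v => if hv : v ∈ V then ⟨h v, h01 v hv⟩ else
        ⟨(∑ d ∈ dirs, (f (v + d) : ℝ)) / 6,
          div_nonneg (Finset.sum_nonneg fun d _ => (f (v + d)).2.1) (by norm_num), by
          rw [div_le_one (by norm_num)]
          refine (Finset.sum_le_sum fun d _ => (f (v + d)).2.2).trans ?_
          rw [Finset.sum_const, card_dirs]; norm_num⟩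
      monotone' := by
        intro f g hfg v
        by_cases hv : v ∈ V
        · simp [hv]
        · simp only [hv, dite_false]
          refine Subtype.mk_le_mk.2 ?_
          gcongr with d _
          exact hfg _ }
  have hfix := T.map_lfp
  set f := OrderHom.lfp T
  refine ⟨fun v => f v, ⟨⟨1, fun v => abs_le.2 ⟨by linarith [(f v).2.1], (f v).2.2⟩⟩, ?_, ?_⟩,
    fun v => (f v).2⟩
  · intro v hv
    refine (congrArg Subtype.val (congrFun hfix v)).symm.trans ?_
    exact congrArg Subtype.val (dif_pos hv)
  · intro v hv
    refine (congrArg Subtype.val (congrFun hfix v)).symm.trans ?_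
    exact congrArg Subtype.val (dif_neg hv)

lemma harmonicExtension_spec {V : Set Vertex} {h : Vertex → ℝ}
    (h01 : ∀ v ∈ V, 0 ≤ h v ∧ h v ≤ 1) : IsHarmonicExtension V h (harmonicExtension V h) := by
  have hex : ∃ f, IsHarmonicExtension V h f :=
    (exists_isHarmonicExtension V h01).imp fun _ hf => hf.1
  rw [harmonicExtension, dif_pos hex]
  exact hex.choose_spec

/-- `I` is a finite set of vertices that is separated by `V` from the other vertices. -/
structure Encloses (V I : Set Vertex) : Prop where
  finite : I.Finite
  closed : ∀ x ∈ I, ∀ d ∈ dirs, x + d ∈ I ∨ x + d ∈ V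

lemma Encloses.mono {V V' I : Set Vertex} (h : Encloses V I) (hV : V ⊆ V') : Encloses V' I :=
  ⟨h.finite, fun x hx d hd => (h.closed x hx d hd).imp_right (@hV _)⟩

/-- Uniqueness is needed only on finite sets cut off by `V`, such as the vertices in `D`; there the
maximum principle applies to the difference. -/
lemma IsHarmonicExtension.le_of_encloses {V I : Set Vertex} {h f g : Vertex → ℝ}
    (hf : IsHarmonicExtension V h f) (hg : IsHarmonicExtension V h g) (hI : Encloses V I)
    {x : Vertex} (hx : x ∈ I) : f x ≤ g x := by
  have := le_of_forall_finite (f := fun x => f x - g x) (c := 0) hI.finite ?_ ?_ x hx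
  · simpa using this
  · intro x _
    by_cases hxV : x ∈ V
    · right; simp [hf.2.1 x hxV, hg.2.1 x hxV]
    · left
      simp only [hf.2.2 x hxV, hg.2.2 x hxV, Finset.sum_sub_distrib]
      ring
  · intro x hx d hd
    refine (hI.closed x hx d hd).imp_right fun hxV => ?_
    simp [hf.2.1 _ hxV, hg.2.1 _ hxV]

lemma IsHarmonicExtension.eq_of_encloses {V I : Set Vertex} {h f g : Vertex → ℝ}
    (hf : IsHarmonicExtension V h f) (hg : IsHarmonicExtension V h g) (hI : Encloses V I)
    {x : Vertex} (hx : x ∈ I ∪ V) : f x = g x := by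
  rcases hx with hx | hx
  · exact le_antisymm (hf.le_of_encloses hg hI hx) (hg.le_of_encloses hf hI hx)
  · rw [hf.2.1 x hx, hg.2.1 x hx]

namespace State

/-- The harmonic extension of the current colors. -/
noncomputable def ext (s : State) : Vertex → ℝ := harmonicExtension s.known s.color

/-- All known colors are `0` or `1`. -/
def Colored (s : State) : Prop := ∀ v ∈ s.known, s.color v = 0 ∨ s.color v = 1

lemma Colored.mem {s : State} (hs : s.Colored) : ∀ v ∈ s.known, 0 ≤ s.color v ∧ s.color v ≤ 1 := by
  intro v hv
  rcases hs v hv with h | h <;> norm_num [h]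

lemma Colored.step {s : State} (hs : s.Colored) (x : ℝ) : (s.step x).Colored := by
  intro v hv
  simp only [State.step] at hv ⊢
  by_cases hn : s.next ∈ s.known
  · rw [if_pos hn]
    rcases hv with rfl | hv
    exacts [hs _ hn, hs _ hv]
  · rw [if_neg hn]
    by_cases hvn : v = s.next
    · subst hvn
      rw [Function.update_self]
      split_ifs <;> simp
    · rw [Function.update_of_ne hvn]
      exact hs _ (hv.resolve_left hvn)

lemma Colored.ext_spec {s : State} (hs : s.Colored) :
    IsHarmonicExtension s.known s.color s.ext := harmonicExtension_spec hs.mem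

/-- `harmonicExtension` is an arbitrary choice of extension, but on an enclosed set it agrees with
one that has values in `[0, 1]`. -/
lemma Colored.ext_mem {s : State} (hs : s.Colored) {I : Set Vertex} (hI : Encloses s.known I)
    {x : Vertex} (hx : x ∈ I ∪ s.known) : 0 ≤ s.ext x ∧ s.ext x ≤ 1 := by
  obtain ⟨f, hf, hf01⟩ := exists_isHarmonicExtension s.known hs.mem
  rw [hs.ext_spec.eq_of_encloses hf hI hx]
  exact hf01 x

/-- The harmonic extension of the colors is a martingale. -/
lemma Colored.ext_eq {s : State} (hs : s.Colored) {I : Set Vertex} (hI : Encloses s.known I)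
    (hn' : s.next ∈ I ∪ s.known) {x₀ x₁ : ℝ} (h₁ : x₁ ≤ s.prob) (h₀ : s.prob < 1 → s.prob < x₀)
    {y : Vertex} (hy : y ∈ I ∪ s.known) :
    s.ext y = s.prob * (s.step x₁).ext y + (1 - s.prob) * (s.step x₀).ext y := by
  by_cases hn : s.next ∈ s.known
  · have : ∀ x, (s.step x).ext = s.ext := by
      intro x
      simp [State.ext, State.step, hn]
    rw [this, this]
    ring
  · have hI' : Encloses (insert s.next s.known) I := hI.mono (Set.subset_insert _ _)
    have e₁ := (hs.step x₁).ext_spec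
    have e₀ := (hs.step x₀).ext_spec
    have e := hs.ext_spec
    have k : ∀ x, (s.step x).known = insert s.next s.known := fun _ => rfl
    have c₁ : (s.step x₁).color = Function.update s.color s.next 1 := by
      simp [State.step, hn, h₁]
    rw [k, c₁] at e₁
    rw [k] at e₀
    have hp : s.ext s.next = s.prob := rfl
    -- The old extension is also the extension of its own values on the enlarged set, so it suffices
    -- to compare the two sides on that set.
    have l : IsHarmonicExtension (insert s.next s.known) s.ext s.ext :=
      ⟨e.1, fun _ _ => rfl, fun v hv => e.2.2 v fun h => hv (Or.inr h)⟩
    refine l.eq_of_encloses (g := fun y => s.prob * (s.step x₁).ext y + (1 - s.prob) * (s.step x₀).ext y)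
      ⟨?_, ?_, ?_⟩ hI' (hy.imp_right Or.inr)
    · obtain ⟨M₁, hM₁⟩ := e₁.1
      obtain ⟨M₀, hM₀⟩ := e₀.1
      refine ⟨|s.prob| * M₁ + |1 - s.prob| * M₀, fun v => (abs_add_le _ _).trans ?_⟩
      rw [abs_mul, abs_mul]
      gcongr
      exacts [hM₁ v, hM₀ v]
    · intro v hv
      simp only [e₁.2.1 v hv, e₀.2.1 v hv]
      by_cases hvn : v = s.next
      · subst hvn
        rw [hp, Function.update_self]
        by_cases hlt : s.prob < 1
        · have := (h₀ hlt).not_ge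
          simp [State.step, hn, this]
        · have hle : s.prob ≤ 1 := (hs.ext_mem hI hn').2
          -- Here `x₀` need not represent a failure, but its weight `1 - s.prob` is zero.
          have : s.prob = 1 := le_antisymm hle (not_lt.1 hlt)
          simp [this]
      · have hvk := hv.resolve_left hvn
        have : (s.step x₀).color v = s.color v := by
          simp [State.step, hn, hvn]
        rw [Function.update_of_ne hvn, this, e.2.1 v hvk]
        ring
    · intro v hv
      simp only [e₁.2.2 v hv, e₀.2.2 v hv]
      rw [Finset.sum_add_distrib, ← Finset.mul_sum, ← Finset.mul_sum]
      ring

end State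

/-! ### Planar geometry of edges and triangles -/

/-- The first coordinate of a point of the plane in the basis `1, exp (2πi/6)`. -/
noncomputable def coordFst (w : ℂ) : ℝ := w.re - w.im / √3

/-- The second coordinate of a point of the plane in the basis `1, exp (2πi/6)`. -/
noncomputable def coordSnd (w : ℂ) : ℝ := 2 * w.im / √3

lemma pt_eq (v : Vertex) : pt v = (v.1 + v.2 / 2 : ℝ) + (v.2 * √3 / 2 : ℝ) * Complex.I := by
  have : (2 * Real.pi * Complex.I / 6 : ℂ) = ((Real.pi / 3 : ℝ) : ℂ) * Complex.I := by
    push_cast; ring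
  rw [pt, this, Complex.exp_mul_I, ← Complex.ofReal_cos, ← Complex.ofReal_sin, Real.cos_pi_div_three,
    Real.sin_pi_div_three]
  push_cast
  ring

@[simp] lemma coordFst_pt (v : Vertex) : coordFst (pt v) = v.1 := by
  rw [coordFst, pt_eq]
  simp only [Complex.add_re, Complex.add_im, Complex.ofReal_re, Complex.ofReal_im,
    Complex.re_ofReal_mul, Complex.im_ofReal_mul, Complex.I_re, Complex.I_im]
  field_simp
  ring

@[simp] lemma coordSnd_pt (v : Vertex) : coordSnd (pt v) = v.2 := by
  rw [coordSnd, pt_eq]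
  simp only [Complex.add_im, Complex.ofReal_im, Complex.im_ofReal_mul, Complex.I_im]
  field_simp
  ring

lemma coordFst_add (w w' : ℂ) : coordFst (w + w') = coordFst w + coordFst w' := by
  simp [coordFst]; ring

lemma coordSnd_add (w w' : ℂ) : coordSnd (w + w') = coordSnd w + coordSnd w' := by
  simp [coordSnd]; ring

lemma coordFst_sub (w w' : ℂ) : coordFst (w - w') = coordFst w - coordFst w' := by
  simp [coordFst]; ring

lemma coordSnd_sub (w w' : ℂ) : coordSnd (w - w') = coordSnd w - coordSnd w' := by
  simp [coordSnd]; ring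

lemma coordFst_smul (t : ℝ) (w : ℂ) : coordFst (t • w) = t * coordFst w := by
  simp [coordFst]; ring

lemma coordSnd_smul (t : ℝ) (w : ℂ) : coordSnd (t • w) = t * coordSnd w := by
  simp [coordSnd]; ring

lemma norm_sq_eq_coord (w : ℂ) :
    ‖w‖ ^ 2 = coordFst w ^ 2 + coordFst w * coordSnd w + coordSnd w ^ 2 := by
  rw [← Complex.normSq_eq_norm_sq, Complex.normSq_apply, coordFst, coordSnd]
  have h3 : √3 ^ 2 = 3 := Real.sq_sqrt (by norm_num)
  field_simp
  linear_combination w.im ^ 2 * h3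

lemma abs_coordFst_le (w : ℂ) : |coordFst w| ≤ 2 * ‖w‖ := by
  refine abs_le_of_sq_le_sq ?_ (by positivity)
  rw [mul_pow, norm_sq_eq_coord]
  nlinarith [sq_nonneg (coordFst w + 2 * coordSnd w), sq_nonneg (coordFst w)]

lemma abs_coordSnd_le (w : ℂ) : |coordSnd w| ≤ 2 * ‖w‖ := by
  refine abs_le_of_sq_le_sq ?_ (by positivity)
  rw [mul_pow, norm_sq_eq_coord]
  nlinarith [sq_nonneg (2 * coordFst w + coordSnd w), sq_nonneg (coordSnd w)]

lemma coordFst_pt_sub (u v : Vertex) : coordFst (pt u - pt v) = ((u - v).1 : ℤ) := by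
  simp [coordFst_sub]

lemma coordSnd_pt_sub (u v : Vertex) : coordSnd (pt u - pt v) = ((u - v).2 : ℤ) := by
  simp [coordSnd_sub]

lemma norm_pt_sub_le (u v : Vertex) : ‖pt u - pt v‖ ≤ hexNorm (u - v) := by
  refine le_of_sq_le_sq ?_ (by positivity)
  rw [norm_sq_eq_coord, coordFst_pt_sub, coordSnd_pt_sub]
  obtain ⟨⟨h₁, h₂⟩, ⟨h₃, h₄⟩, h₅, h₆⟩ := hexNorm_le_iff.1 (le_refl (hexNorm (u - v)))
  generalize (u - v).1 = a at *
  generalize (u - v).2 = b at *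
  generalize hexNorm (u - v) = k at *
  have : a ^ 2 + a * b + b ^ 2 ≤ (k : ℤ) ^ 2 := by
    rcases le_total 0 a with ha | ha <;> rcases le_total 0 b with hb | hb <;>
      rcases le_total 0 (a + b) with hc | hc <;> nlinarith
  exact_mod_cast this

lemma hexNorm_le_norm_pt_sub (u v : Vertex) : (hexNorm (u - v) : ℝ) ≤ 2 * ‖pt u - pt v‖ := by
  refine le_of_sq_le_sq ?_ (by positivity)
  rw [mul_pow, norm_sq_eq_coord, coordFst_pt_sub, coordSnd_pt_sub]
  obtain ⟨-, h⟩ := hexNorm_eq_iff.1 (rfl : hexNorm (u - v) = _)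
  generalize (u - v).1 = a at *
  generalize (u - v).2 = b at *
  generalize hexNorm (u - v) = k at *
  have : (k : ℤ) ^ 2 ≤ 2 ^ 2 * (a ^ 2 + a * b + b ^ 2) := by
    have : (k : ℤ) ^ 2 = a ^ 2 ∨ (k : ℤ) ^ 2 = b ^ 2 ∨ (k : ℤ) ^ 2 = (a + b) ^ 2 := by
      rcases h with h | h | h | h | h | h <;> simp [h]
    rcases this with h | h | h <;> rw [h] <;>
      nlinarith [sq_nonneg (a + 2 * b), sq_nonneg (2 * a + b), sq_nonneg (a - b), sq_nonneg a,
        sq_nonneg b, sq_nonneg (a + b)]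
  exact_mod_cast this

lemma Adj.norm_pt_sub {u v : Vertex} (h : Adj u v) : ‖pt v - pt u‖ = 1 := by
  have : ‖pt v - pt u‖ ^ 2 = 1 := by
    rw [norm_sq_eq_coord, coordFst_pt_sub, coordSnd_pt_sub]
    have h' : v - u ∈ dirs := h
    generalize v - u = d at h'
    revert d
    simp only [dirs, Finset.mem_insert, Finset.mem_singleton]
    rintro d (rfl | rfl | rfl | rfl | rfl | rfl) <;> norm_num
  nlinarith [norm_nonneg (pt v - pt u)]

lemma segment_coord {p q w : ℂ} (hw : w ∈ segment ℝ p q) : ∃ t : ℝ, 0 ≤ t ∧ t ≤ 1 ∧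
    coordFst w = coordFst p + t * (coordFst q - coordFst p) ∧
    coordSnd w = coordSnd p + t * (coordSnd q - coordSnd p) := by
  rw [segment_eq_image'] at hw
  obtain ⟨t, ht, rfl⟩ := hw
  refine ⟨t, ht.1, ht.2, ?_, ?_⟩
  · rw [coordFst_add, coordFst_smul, coordFst_sub]
  · rw [coordSnd_add, coordSnd_smul, coordSnd_sub]

/-- Two grid directions are parallel or form a basis of the lattice. This turns questions about
intersecting edges into questions about integers in short intervals. -/
lemma det_mem_of_mem_dirs {d e : Vertex} (hd : d ∈ dirs) (he : e ∈ dirs) :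
    (e = d ∨ e = -d) ∨ (d.1 * e.2 - d.2 * e.1 = 1 ∨ d.1 * e.2 - d.2 * e.1 = -1) := by
  have : ∀ d ∈ dirs, ∀ e ∈ dirs, (e = d ∨ e = -d) ∨
      (d.1 * e.2 - d.2 * e.1 = 1 ∨ d.1 * e.2 - d.2 * e.1 = -1) := by decide
  exact this d hd e he

lemma exists_dual_of_mem_dirs {d : Vertex} (hd : d ∈ dirs) : ∃ e₁ e₂ : ℤ, e₁ * d.1 + e₂ * d.2 = 1 := by
  simp only [dirs, Finset.mem_insert, Finset.mem_singleton] at hd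
  rcases hd with rfl | rfl | rfl | rfl | rfl | rfl
  exacts [⟨1, 0, rfl⟩, ⟨0, 1, rfl⟩, ⟨0, 1, rfl⟩, ⟨-1, 0, rfl⟩, ⟨0, -1, rfl⟩, ⟨0, -1, rfl⟩]

/-- Two edges of the grid are equal if one meets the interior of the other. -/
lemma edge_eq_of_mem {u v p q : Vertex} (huv : Adj u v) (hpq : Adj p q) {w : ℂ} {t : ℝ}
    (h₀ : 0 < t) (h₁ : t < 1) (hw₁ : coordFst w = u.1 + t * (v.1 - u.1))
    (hw₂ : coordSnd w = u.2 + t * (v.2 - u.2)) (hw : w ∈ segment ℝ (pt p) (pt q)) :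
    (p = u ∧ q = v) ∨ (p = v ∧ q = u) := by
  obtain ⟨s, hs₀, hs₁, hs₂, hs₃⟩ := segment_coord hw
  rw [hw₁, coordFst_pt, coordFst_pt] at hs₂
  rw [hw₂, coordSnd_pt, coordSnd_pt] at hs₃
  obtain ⟨d, hd, rfl⟩ : ∃ d ∈ dirs, v = u + d := ⟨v - u, huv, by abel⟩
  obtain ⟨e, he, rfl⟩ : ∃ e ∈ dirs, q = p + e := ⟨q - p, hpq, by abel⟩
  simp only [Prod.fst_add, Prod.snd_add, Int.cast_add, add_sub_cancel_left] at hs₂ hs₃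
  obtain ⟨e₁, e₂, hdual⟩ := exists_dual_of_mem_dirs hd
  have hdual' : (e₁ : ℝ) * d.1 + e₂ * d.2 = 1 := by exact_mod_cast hdual
  rcases det_mem_of_mem_dirs hd he with (rfl | rfl) | h
  · have hk : ((e₁ * (p.1 - u.1) + e₂ * (p.2 - u.2) : ℤ) : ℝ) = t - s := by
      push_cast
      -- On parallel edges, the dual functional of `d` takes the integer value `t - s` at `p - u`;
      -- this number is strictly between `-1` and `1`.
      linear_combination (-e₁) * hs₂ - e₂ * hs₃ + (t - s) * hdual'
    have hts : t = s := by
      generalize e₁ * (p.1 - u.1) + e₂ * (p.2 - u.2) = k at hk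
      have h1 : (-1 : ℝ) < k := by linarith
      have h2 : (k : ℝ) < 1 := by linarith
      have h3 : k = 0 := by
        have h1' : -1 < k := by exact_mod_cast h1
        have h2' : k < 1 := by exact_mod_cast h2
        omega
      rw [h3] at hk
      push_cast at hk
      linarith
    rw [hts] at hs₂ hs₃
    have hp : p = u := Prod.ext (by exact_mod_cast (add_right_cancel hs₂).symm)
      (by exact_mod_cast (add_right_cancel hs₃).symm)
    simp [hp]
  · simp only [Prod.fst_neg, Prod.snd_neg, Int.cast_neg] at hs₂ hs₃
    have hk : ((e₁ * (p.1 - u.1) + e₂ * (p.2 - u.2) : ℤ) : ℝ) = t + s := by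
      push_cast
      linear_combination (-e₁) * hs₂ - e₂ * hs₃ + (t + s) * hdual'
    have hts : s = 1 - t := by
      generalize e₁ * (p.1 - u.1) + e₂ * (p.2 - u.2) = k at hk
      have h1 : (0 : ℝ) < k := by linarith
      have h2 : (k : ℝ) < 2 := by linarith
      have h3 : k = 1 := by
        have h1' : 0 < k := by exact_mod_cast h1
        have h2' : k < 2 := by exact_mod_cast h2
        omega
      rw [h3] at hk
      push_cast at hk
      linarith
    rw [hts] at hs₂ hs₃
    have hp₁ : (p.1 : ℝ) = u.1 + d.1 := by linarith
    have hp₂ : (p.2 : ℝ) = u.2 + d.2 := by linarith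
    have hp : p = u + d := Prod.ext (by exact_mod_cast hp₁) (by exact_mod_cast hp₂)
    simp [hp]
  · exfalso
    have hdet : (d.1 * e.2 - d.2 * e.1 : ℝ) = 1 ∨ (d.1 * e.2 - d.2 * e.1 : ℝ) = -1 := by
      exact_mod_cast h
    have hk : ((e.2 * (p.1 - u.1) - e.1 * (p.2 - u.2) : ℤ) : ℝ) = t * (d.1 * e.2 - d.2 * e.1) := by
      push_cast
      linear_combination (-e.2) * hs₂ + e.1 * hs₃
    generalize e.2 * (p.1 - u.1) - e.1 * (p.2 - u.2) = k at hk
    rcases hdet with hdet | hdet <;> rw [hdet] at hk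
    · have h1 : (0 : ℝ) < k := by linarith
      have h2 : (k : ℝ) < 1 := by linarith
      have h1' : 0 < k := by exact_mod_cast h1
      have h2' : k < 1 := by exact_mod_cast h2
      omega
    · have h1 : (-1 : ℝ) < k := by linarith
      have h2 : (k : ℝ) < 0 := by linarith
      have h1' : -1 < k := by exact_mod_cast h1
      have h2' : k < 0 := by exact_mod_cast h2
      omega

/-- A vertex that lies on an edge is one of its ends. -/
lemma eq_or_eq_of_pt_mem_segment {x u v : Vertex} (h : Adj u v)
    (hx : pt x ∈ segment ℝ (pt u) (pt v)) : x = u ∨ x = v := by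
  obtain ⟨t, h₀, h₁, h₂, h₃⟩ := segment_coord hx
  obtain ⟨d, hd, rfl⟩ : ∃ d ∈ dirs, v = u + d := ⟨v - u, h, by abel⟩
  simp only [coordFst_pt, coordSnd_pt, Prod.fst_add, Prod.snd_add, Int.cast_add,
    add_sub_cancel_left] at h₂ h₃
  obtain ⟨e₁, e₂, hdual⟩ := exists_dual_of_mem_dirs hd
  have hdual' : (e₁ : ℝ) * d.1 + e₂ * d.2 = 1 := by exact_mod_cast hdual
  have hk : ((e₁ * (x.1 - u.1) + e₂ * (x.2 - u.2) : ℤ) : ℝ) = t := by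
    push_cast
    linear_combination e₁ * h₂ + e₂ * h₃ + t * hdual'
  generalize e₁ * (x.1 - u.1) + e₂ * (x.2 - u.2) = k at hk
  have h1 : (0 : ℝ) ≤ k := by linarith
  have h2 : (k : ℝ) ≤ 1 := by linarith
  have h1' : 0 ≤ k := by exact_mod_cast h1
  have h2' : k ≤ 1 := by exact_mod_cast h2
  obtain rfl | rfl : k = 0 ∨ k = 1 := by omega
  · left
    rw [← hk] at h₂ h₃
    exact Prod.ext (by exact_mod_cast (by simpa using h₂ : (x.1 : ℝ) = u.1))
      (by exact_mod_cast (by simpa using h₃ : (x.2 : ℝ) = u.2))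
  · right
    rw [← hk] at h₂ h₃
    exact Prod.ext (by exact_mod_cast (by simpa using h₂ : (x.1 : ℝ) = u.1 + d.1))
      (by exact_mod_cast (by simpa using h₃ : (x.2 : ℝ) = u.2 + d.2))

/-- The point with barycentric coordinates `1 - β - γ, β, γ` in the triangle to the left of the
directed edge from `u` to `v`. -/
noncomputable def triPt (u v : Vertex) (p : ℝ × ℝ) : ℂ :=
  pt u + p.1 • (pt v - pt u) + p.2 • (pt (apex u v) - pt u)

lemma coordFst_triPt (u v : Vertex) (p : ℝ × ℝ) :
    coordFst (triPt u v p) = u.1 + p.1 * (v.1 - u.1) - p.2 * (v.2 - u.2) := by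
  simp only [triPt, coordFst_add, coordFst_smul, coordFst_sub, coordFst_pt, apex_fst]
  push_cast
  ring

lemma coordSnd_triPt (u v : Vertex) (p : ℝ × ℝ) :
    coordSnd (triPt u v p) = u.2 + p.1 * (v.2 - u.2) + p.2 * (v.1 - u.1 + (v.2 - u.2)) := by
  simp only [triPt, coordSnd_add, coordSnd_smul, coordSnd_sub, coordSnd_pt, apex_snd]
  push_cast
  ring

lemma triPt_combo (u v : Vertex) (p q : ℝ × ℝ) {a b : ℝ} (h : a + b = 1) :
    triPt u v (a • p + b • q) = a • triPt u v p + b • triPt u v q := by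
  obtain rfl : b = 1 - a := by linarith
  simp only [triPt, Prod.fst_add, Prod.snd_add, Prod.smul_fst, Prod.smul_snd, smul_eq_mul,
    Complex.real_smul]
  push_cast
  ring

lemma triPt_zero (u v : Vertex) : triPt u v (0, 0) = pt u := by simp [triPt]
lemma triPt_one_zero (u v : Vertex) : triPt u v (1, 0) = pt v := by simp [triPt]
lemma triPt_zero_one (u v : Vertex) : triPt u v (0, 1) = pt (apex u v) := by simp [triPt]

lemma triPt_mid (u v : Vertex) : triPt u v (1 / 2, 0) = mid u v := by
  simp [triPt, mid]; ring

lemma triPt_center (u v : Vertex) : triPt u v (1 / 3, 1 / 3) = center u v := by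
  simp [triPt, center]; ring

/-- Barycentric coordinates of the points inside a triangle. -/
def openSimplex : Set (ℝ × ℝ) := {p | 0 < p.1 ∧ 0 < p.2 ∧ p.1 + p.2 < 1}

/-- Barycentric coordinates of the points of a triangle. -/
def closedSimplex : Set (ℝ × ℝ) := {p | 0 ≤ p.1 ∧ 0 ≤ p.2 ∧ p.1 + p.2 ≤ 1}

/-- The interior of a triangle of the grid. -/
def openTriangle (u v : Vertex) : Set ℂ := triPt u v '' openSimplex

lemma convex_openSimplex : Convex ℝ openSimplex := by
  rintro ⟨a, b⟩ ⟨h₁, h₂, h₃⟩ ⟨c, d⟩ ⟨h₄, h₅, h₆⟩ s t hs ht hst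
  simp only [openSimplex, Set.mem_ofPred_eq, Prod.fst_add, Prod.snd_add, Prod.smul_fst, Prod.smul_snd,
    smul_eq_mul] at *
  rcases hs.eq_or_lt with rfl | hs
  · obtain rfl : t = 1 := by linarith
    simp; tauto
  · refine ⟨by positivity, by positivity, ?_⟩
    nlinarith

lemma continuous_triPt (u v : Vertex) : Continuous (triPt u v) := by
  unfold triPt
  fun_prop

lemma isPreconnected_openTriangle (u v : Vertex) : IsPreconnected (openTriangle u v) :=
  convex_openSimplex.isPreconnected.image _ (continuous_triPt u v).continuousOn

lemma center_mem_openTriangle (u v : Vertex) : center u v ∈ openTriangle u v :=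
  ⟨(1 / 3, 1 / 3), by norm_num [openSimplex], triPt_center u v⟩

lemma closedSimplex_subset_closure : closedSimplex ⊆ closure openSimplex := by
  rintro p ⟨h₁, h₂, h₃⟩
  have h : openSegment ℝ ((1 / 3, 1 / 3) : ℝ × ℝ) p ⊆ openSimplex := by
    rintro _ ⟨a, b, ha, hb, hab, rfl⟩
    simp only [openSimplex, Set.mem_ofPred_eq, Prod.fst_add, Prod.snd_add, Prod.smul_fst,
      Prod.smul_snd, smul_eq_mul]
    refine ⟨by positivity, by positivity, ?_⟩
    nlinarith
  have := closure_mono h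
  rw [closure_openSegment] at this
  exact this (right_mem_segment _ _ _)

lemma triPt_mem_closure (u v : Vertex) {p : ℝ × ℝ} (hp : p ∈ closedSimplex) :
    triPt u v p ∈ closure (openTriangle u v) :=
  image_closure_subset_closure_image (continuous_triPt u v)
    ⟨p, closedSimplex_subset_closure hp, rfl⟩

lemma center_apex_left (u v : Vertex) : center (apex u v) u = center u v := by
  rw [center, center, apex_apex']; ring

lemma center_apex_right (u v : Vertex) : center v (apex u v) = center u v := by
  rw [center, center, apex_apex]; ring

lemma mid_comm (u v : Vertex) : mid u v = mid v u := by rw [mid, mid, add_comm]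

/-- The expressions are the determinants of `e` with the two sides of a triangle from its first
vertex. A primitive functional that is constant in a grid direction takes only two consecutive
integer values at the vertices of a triangle. -/
lemma det_mem_of_mem_dirs' {d e : Vertex} (hd : d ∈ dirs) (he : e ∈ dirs) :
    ∃ σ : ℤ, (σ = 1 ∨ σ = -1) ∧
    ((e.1 * d.2 - e.2 * d.1 = 0 ∧ e.1 * (d.1 + d.2) + e.2 * d.2 = σ) ∨
      (e.1 * d.2 - e.2 * d.1 = σ ∧ e.1 * (d.1 + d.2) + e.2 * d.2 = 0) ∨
      (e.1 * d.2 - e.2 * d.1 = σ ∧ e.1 * (d.1 + d.2) + e.2 * d.2 = σ)) := by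
  have : ∀ d ∈ dirs, ∀ e ∈ dirs, ∃ σ ∈ ({1, -1} : Finset ℤ),
    ((e.1 * d.2 - e.2 * d.1 = 0 ∧ e.1 * (d.1 + d.2) + e.2 * d.2 = σ) ∨
      (e.1 * d.2 - e.2 * d.1 = σ ∧ e.1 * (d.1 + d.2) + e.2 * d.2 = 0) ∨
      (e.1 * d.2 - e.2 * d.1 = σ ∧ e.1 * (d.1 + d.2) + e.2 * d.2 = σ)) := by decide
  simpa using this d hd e he

/-- In the direction of any edge, the open triangle lies strictly between two consecutive lattice
lines, while the edge lies on one of them. -/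
lemma disjoint_openTriangle_segment {u v p q : Vertex} (huv : Adj u v) (hpq : Adj p q) :
    Disjoint (openTriangle u v) (segment ℝ (pt p) (pt q)) := by
  rw [Set.disjoint_left]
  rintro _ ⟨x, ⟨h₁, h₂, h₃⟩, rfl⟩ hw
  obtain ⟨t, ht₀, ht₁, ht₂, ht₃⟩ := segment_coord hw
  rw [coordFst_triPt, coordFst_pt, coordFst_pt] at ht₂
  rw [coordSnd_triPt, coordSnd_pt, coordSnd_pt] at ht₃
  obtain ⟨d, hd, rfl⟩ : ∃ d ∈ dirs, v = u + d := ⟨v - u, huv, by abel⟩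
  obtain ⟨e, he, rfl⟩ : ∃ e ∈ dirs, q = p + e := ⟨q - p, hpq, by abel⟩
  simp only [Prod.fst_add, Prod.snd_add, Int.cast_add, add_sub_cancel_left] at ht₂ ht₃
  obtain ⟨σ, hσ, h⟩ := det_mem_of_mem_dirs' hd he
  have hσ2 : σ * σ = 1 := by rcases hσ with rfl | rfl <;> rfl
  have hσ2' : (σ : ℝ) * σ = 1 := by exact_mod_cast hσ2
  set k : ℤ := σ * (e.1 * (p.2 - u.2) - e.2 * (p.1 - u.1)) with hk
  have hkr : (k : ℝ) = σ * (e.1 * (p.2 - u.2) - e.2 * (p.1 - u.1)) := by rw [hk]; push_cast; ring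
  have key : (k : ℝ) = σ * (x.1 * ((e.1 * d.2 - e.2 * d.1 : ℤ) : ℝ) +
      x.2 * ((e.1 * (d.1 + d.2) + e.2 * d.2 : ℤ) : ℝ)) := by
    rw [hkr]
    push_cast
    linear_combination σ * (e.2 * ht₂ - e.1 * ht₃)
  have fin : ∀ y : ℝ, 0 < y → y < 1 → (k : ℝ) = y → False := by
    intro y hy₀ hy₁ hky
    rw [← hky] at hy₀ hy₁
    have a : 0 < k := by exact_mod_cast hy₀
    have b : k < 1 := by exact_mod_cast hy₁
    omega
  rcases h with ⟨h, h'⟩ | ⟨h, h'⟩ | ⟨h, h'⟩ <;> rw [h, h'] at key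
  · exact fin x.2 h₂ (by linarith) (by rw [key]; push_cast; linear_combination x.2 * hσ2')
  · exact fin x.1 h₁ (by linarith) (by rw [key]; push_cast; linear_combination x.1 * hσ2')
  · exact fin (x.1 + x.2) (by linarith) (by linarith)
      (by rw [key]; linear_combination (x.1 + x.2) * hσ2')

lemma norm_sq_of_coord {d : Vertex} (hd : d ∈ dirs) {w : ℂ} {α γ : ℝ}
    (h₁ : coordFst w = α * d.1 - γ * d.2) (h₂ : coordSnd w = α * d.2 + γ * (d.1 + d.2)) :
    ‖w‖ ^ 2 = α ^ 2 + α * γ + γ ^ 2 := by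
  have hd' : d.1 ^ 2 + d.1 * d.2 + d.2 ^ 2 = 1 := by
    have : ∀ d ∈ dirs, d.1 ^ 2 + d.1 * d.2 + d.2 ^ 2 = 1 := by decide
    exact this d hd
  have hd'' : (d.1 : ℝ) ^ 2 + d.1 * d.2 + d.2 ^ 2 = 1 := by exact_mod_cast hd'
  rw [norm_sq_eq_coord, h₁, h₂]
  linear_combination (α ^ 2 + α * γ + γ ^ 2) * hd''

set_option maxHeartbeats 800000 in
/-- The only edge of the grid close to a point on the segment from the center of a triangle to the
midpoint of a side is this side. -/
lemma edge_eq_of_norm_sub_lt {u v p q : Vertex} (huv : Adj u v) (hpq : Adj p q) {w : ℂ}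
    (hw : w ∈ segment ℝ (pt p) (pt q)) {w' : ℂ} (hw' : w' ∈ segment ℝ (mid u v) (center u v))
    (hlt : ‖w - w'‖ < 1 / 12) :
    ((p = u ∧ q = v) ∨ (p = v ∧ q = u)) ∧ ‖mid u v - w'‖ ≤ ‖w - w'‖ := by
  obtain ⟨a, s, ha, hs₀, has, rfl⟩ := hw'
  rw [← triPt_mid, ← triPt_center, ← triPt_combo u v _ _ has] at *
  obtain rfl : a = 1 - s := by linarith
  have hs₁ : s ≤ 1 := by linarith
  set x : ℝ × ℝ := (1 - s) • (1 / 2, 0) + s • (1 / 3, 1 / 3) with hx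
  have hx₁ : x.1 = 1 / 2 - s / 6 := by simp [hx]; ring
  have hx₂ : x.2 = s / 3 := by simp [hx]; ring
  set y := w - triPt u v x with hy
  have hy₁ : coordFst y = coordFst w - (u.1 + x.1 * (v.1 - u.1) - x.2 * (v.2 - u.2)) := by
    rw [hy, coordFst_sub, coordFst_triPt]
  have hy₂ : coordSnd y = coordSnd w - (u.2 + x.1 * (v.2 - u.2) + x.2 * (v.1 - u.1 + (v.2 - u.2))) := by
    rw [hy, coordSnd_sub, coordSnd_triPt]
  have hmid₁ : coordFst (triPt u v (1 / 2, 0) - triPt u v x) = (1 / 2 - x.1) * (v.1 - u.1) + x.2 * (v.2 - u.2) := by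
    rw [coordFst_sub, coordFst_triPt, coordFst_triPt]; ring
  have hmid₂ : coordSnd (triPt u v (1 / 2, 0) - triPt u v x) = (1 / 2 - x.1) * (v.2 - u.2) - x.2 * (v.1 - u.1 + (v.2 - u.2)) := by
    rw [coordSnd_sub, coordSnd_triPt, coordSnd_triPt]; ring
  obtain ⟨t, ht₀, ht₁, ht₂, ht₃⟩ := segment_coord hw
  rw [coordFst_pt, coordFst_pt] at ht₂
  rw [coordSnd_pt, coordSnd_pt] at ht₃
  have hpq' := hpq
  have huv' := huv
  obtain ⟨d, hd, rfl⟩ : ∃ d ∈ dirs, v = u + d := ⟨v - u, huv, by abel⟩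
  obtain ⟨e, he, rfl⟩ : ∃ e ∈ dirs, q = p + e := ⟨q - p, hpq, by abel⟩
  simp only [Prod.fst_add, Prod.snd_add, Int.cast_add, add_sub_cancel_left] at ht₂ ht₃ hy₁ hy₂ hmid₁ hmid₂
  obtain ⟨σ, hσ, h⟩ := det_mem_of_mem_dirs' hd he
  have hσ2 : σ * σ = 1 := by rcases hσ with rfl | rfl <;> rfl
  have hσ2' : (σ : ℝ) * σ = 1 := by exact_mod_cast hσ2
  set k : ℤ := σ * (e.1 * (p.2 - u.2) - e.2 * (p.1 - u.1)) with hk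
  have hkr : (k : ℝ) = σ * (e.1 * (p.2 - u.2) - e.2 * (p.1 - u.1)) := by rw [hk]; push_cast; ring
  have key : (k : ℝ) = σ * (x.1 * ((e.1 * d.2 - e.2 * d.1 : ℤ) : ℝ) +
      x.2 * ((e.1 * (d.1 + d.2) + e.2 * d.2 : ℤ) : ℝ)) +
      σ * (e.1 * coordSnd y - e.2 * coordFst y) := by
    rw [hkr, hy₁, hy₂]
    push_cast
    linear_combination σ * (e.2 * ht₂ - e.1 * ht₃)
  -- The coordinates are at most twice the norm, so the displacement changes the functional by less
  -- than `4 / 12`.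
  have herr : |σ * (e.1 * coordSnd y - e.2 * coordFst y)| < 1 / 3 := by
    have he' : |(e.1 : ℝ)| ≤ 1 ∧ |(e.2 : ℝ)| ≤ 1 := by
      have : ∀ e ∈ dirs, |e.1| ≤ 1 ∧ |e.2| ≤ 1 := by decide
      exact_mod_cast this e he
    have hσ' : |(σ : ℝ)| = 1 := by rcases hσ with rfl | rfl <;> simp
    rw [abs_mul, hσ', one_mul]
    calc _ ≤ |e.1 * coordSnd y| + |e.2 * coordFst y| := abs_sub _ _
      _ = |(e.1 : ℝ)| * |coordSnd y| + |(e.2 : ℝ)| * |coordFst y| := by rw [abs_mul, abs_mul]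
      _ ≤ 1 * (2 * ‖y‖) + 1 * (2 * ‖y‖) := by
          gcongr
          exacts [he'.1, abs_coordSnd_le y, he'.2, abs_coordFst_le y]
      _ < 1 / 3 := by linarith
  generalize hη : σ * (e.1 * coordSnd y - e.2 * coordFst y) = η at key herr
  rw [abs_lt] at herr
  -- If the edge is not parallel to the side `uv`, the functional at the point of the triangle is in
  -- `[1/3, 2/3]`, too far from any integer for the edge to be that close.
  have fin : ∀ z : ℝ, 1 / 3 ≤ z → z ≤ 2 / 3 → (k : ℝ) = z + η → False := by
    intro z hz₀ hz₁ hkz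
    have a : (0 : ℝ) < k := by linarith
    have b : (k : ℝ) < 1 := by linarith
    have a : 0 < k := by exact_mod_cast a
    have b : k < 1 := by exact_mod_cast b
    omega
  rcases h with ⟨h, h'⟩ | ⟨h, h'⟩ | ⟨h, h'⟩ <;> rw [h, h'] at key
  rotate_left
  · exact (fin x.1 (by linarith) (by linarith) (by rw [key]; push_cast; linear_combination x.1 * hσ2')).elim
  · exact (fin (x.1 + x.2) (by linarith) (by linarith)
      (by rw [key]; linear_combination (x.1 + x.2) * hσ2')).elim
  have hk0 : k = 0 := by
    have hkz : (k : ℝ) = x.2 + η := by rw [key]; push_cast; linear_combination x.2 * hσ2'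
    have a : (-1 : ℝ) < k := by linarith
    have b : (k : ℝ) < 1 := by linarith
    have a : -1 < k := by exact_mod_cast a
    have b : k < 1 := by exact_mod_cast b
    omega
  have hed : e = d ∨ e = -d := by
    rcases det_mem_of_mem_dirs hd he with h1 | h1
    · exact h1
    · have : d.1 * e.2 - d.2 * e.1 = -(e.1 * d.2 - e.2 * d.1) := by ring
      omega
  have hdet : (e.1 * (p.2 - u.2) - e.2 * (p.1 - u.1) : ℤ) = 0 := by
    have : σ * k = e.1 * (p.2 - u.2) - e.2 * (p.1 - u.1) := by
      rw [hk, ← mul_assoc, hσ2, one_mul]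
    rw [← this, hk0, mul_zero]
  have hdet' : (d.1 * (coordSnd w - u.2) : ℝ) = d.2 * (coordFst w - u.1) := by
    have hdet : (e.1 * (p.2 - u.2) - e.2 * (p.1 - u.1) : ℝ) = 0 := by exact_mod_cast hdet
    rw [ht₂, ht₃]
    rcases hed with rfl | rfl
    · linear_combination hdet
    · simp only [Prod.fst_neg, Prod.snd_neg, Int.cast_neg] at hdet ⊢
      linear_combination -hdet
  obtain ⟨e₁, e₂, hdual⟩ := exists_dual_of_mem_dirs hd
  have hdual' : (e₁ : ℝ) * d.1 + e₂ * d.2 = 1 := by exact_mod_cast hdual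
  set τ : ℝ := e₁ * (coordFst w - u.1) + e₂ * (coordSnd w - u.2) with hτ
  have hw₁ : coordFst w = u.1 + τ * d.1 := by
    rw [hτ]
    linear_combination (-e₂) * hdet' - (coordFst w - u.1) * hdual'
  have hw₂ : coordSnd w = u.2 + τ * d.2 := by
    rw [hτ]
    linear_combination e₁ * hdet' - (coordSnd w - u.2) * hdual'
  have hn := norm_sq_of_coord hd (w := y) (α := τ - x.1) (γ := -x.2)
    (by rw [hy₁, hw₁]; ring) (by rw [hy₂, hw₂]; ring)
  have hn' := norm_sq_of_coord hd (w := triPt u (u + d) (1 / 2, 0) - triPt u (u + d) x) (α := 1 / 2 - x.1)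
    (γ := -x.2) (by rw [hmid₁]; ring) (by rw [hmid₂]; ring)
  rw [hx₁, hx₂] at hn hn'
  -- Pythagoras: the segment from the midpoint to the center is perpendicular to the side, so the
  -- midpoint is the nearest point of the line.
  have hn₂ : ‖y‖ ^ 2 = (τ - 1 / 2) ^ 2 + s ^ 2 / 12 := by rw [hn]; ring
  have hlt2 : ‖y‖ ^ 2 < (1 / 12) ^ 2 := by gcongr
  have hτ' : |τ - 1 / 2| < 1 / 2 := by
    refine abs_lt_of_sq_lt_sq ?_ (by norm_num)
    linarith [sq_nonneg s]
  rw [abs_lt] at hτ'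
  refine ⟨edge_eq_of_mem huv' hpq' (t := τ) (by linarith) (by linarith) (by rw [hw₁]; simp)
    (by rw [hw₂]; simp) hw, ?_⟩
  refine le_of_sq_le_sq ?_ (norm_nonneg _)
  rw [hn₂, hn']
  linarith [sq_nonneg (τ - 1 / 2)]

/-- A connected set that misses the frontier is covered by the disjoint open sets `D` and the
complement of its closure. -/
lemma subset_of_disjoint_frontier {S D : Set ℂ} (hD : IsOpen D) (hS : IsPreconnected S)
    (hd : Disjoint S (frontier D)) (hne : (S ∩ D).Nonempty) : S ⊆ D := by
  refine hS.subset_left_of_subset_union hD isClosed_closure.isOpen_compl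
    (Set.disjoint_compl_right_iff_subset.2 subset_closure) (fun x hx => ?_) hne
  by_contra hcon
  simp only [Set.mem_union, Set.mem_compl_iff, not_or, not_not] at hcon
  refine Set.disjoint_left.1 hd hx ?_
  rw [hD.frontier_eq]
  exact ⟨hcon.2, hcon.1⟩

lemma convex_openTriangle (u v : Vertex) : Convex ℝ (openTriangle u v) := by
  rintro _ ⟨p, hp, rfl⟩ _ ⟨q, hq, rfl⟩ a b ha hb hab
  exact ⟨_, convex_openSimplex hp hq ha hb hab, triPt_combo u v p q hab⟩

lemma pt_left_mem_closure (u v : Vertex) : pt u ∈ closure (openTriangle u v) :=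
  triPt_zero u v ▸ triPt_mem_closure u v (by simp [closedSimplex])

lemma pt_right_mem_closure (u v : Vertex) : pt v ∈ closure (openTriangle u v) :=
  triPt_one_zero u v ▸ triPt_mem_closure u v (by simp [closedSimplex])

lemma pt_apex_mem_closure (u v : Vertex) : pt (apex u v) ∈ closure (openTriangle u v) :=
  triPt_zero_one u v ▸ triPt_mem_closure u v (by simp [closedSimplex])

lemma mid_mem_closure (u v : Vertex) : mid u v ∈ closure (openTriangle u v) :=
  triPt_mid u v ▸ triPt_mem_closure u v (by norm_num [closedSimplex])

lemma mid_mem_segment (u v : Vertex) : mid u v ∈ segment ℝ (pt u) (pt v) :=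
  ⟨1 / 2, 1 / 2, by norm_num, by norm_num, by norm_num, by simp [mid]; ring⟩

lemma eq_right_of_pt_mem_segment_mid {x u v : Vertex} (h : Adj u v)
    (hx : pt x ∈ segment ℝ (mid u v) (pt v)) : x = v := by
  refine (eq_or_eq_of_pt_mem_segment h ((convex_segment _ _).segment_subset (mid_mem_segment u v)
    (right_mem_segment _ _ _) hx)).resolve_left ?_
  rintro rfl
  have h1 : segment ℝ (mid x v) (pt v) ⊆ Metric.closedBall (pt v) (1 / 2) := by
    refine (convex_closedBall _ _).segment_subset ?_ (by simp)
    rw [mem_closedBall_iff_norm]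
    have : mid x v - pt v = (1 / 2 : ℝ) • (pt x - pt v) := by simp [mid]; ring
    rw [this, norm_smul, h.symm.norm_pt_sub]
    norm_num
  have h2 := h1 hx
  rw [mem_closedBall_iff_norm, h.symm.norm_pt_sub] at h2
  norm_num at h2

lemma eq_left_of_pt_mem_segment_mid {x u v : Vertex} (h : Adj u v)
    (hx : pt x ∈ segment ℝ (pt u) (mid u v)) : x = u := by
  rw [segment_symm, mid_comm] at hx
  exact eq_right_of_pt_mem_segment_mid h.symm hx

lemma edge_eq_of_mid_mem {u v p q : Vertex} (huv : Adj u v) (hpq : Adj p q)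
    (h : mid u v ∈ segment ℝ (pt p) (pt q)) : (p = u ∧ q = v) ∨ (p = v ∧ q = u) := by
  refine edge_eq_of_mem huv hpq (t := 1 / 2) (by norm_num) (by norm_num) ?_ ?_ h
  · rw [← triPt_mid, coordFst_triPt]; ring
  · rw [← triPt_mid, coordSnd_triPt]; ring

/-! ### Boundary arcs and components of the domain in a ball -/

namespace MarkedDomain

variable (M : MarkedDomain)

lemma segment_subset_frontier {i : ℕ} (hi : i < M.len) :
    segment ℝ (pt (M.vert i)) (pt (M.vert (i + 1))) ⊆ frontier M.D := by
  rw [M.frontier_eq]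
  exact Set.subset_biUnion_of_mem (u := fun i => segment ℝ (pt (M.vert i)) (pt (M.vert (i + 1)))) hi

lemma exists_edge {w : ℂ} (hw : w ∈ frontier M.D) :
    ∃ i < M.len, w ∈ segment ℝ (pt (M.vert i)) (pt (M.vert (i + 1))) := by
  rw [M.frontier_eq] at hw
  simpa using hw

lemma notMem_of_mem_frontier {w : ℂ} (hw : w ∈ frontier M.D) : w ∉ M.D := by
  rw [M.isOpen.frontier_eq] at hw
  exact hw.2

lemma vert_mem_frontier {i : ℕ} (hi : i ≤ M.len) : pt (M.vert i) ∈ frontier M.D := by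
  rcases hi.lt_or_eq with hi | rfl
  · exact M.segment_subset_frontier hi (left_mem_segment _ _ _)
  · rw [M.vert_len]
    exact M.segment_subset_frontier (by linarith [M.three_le_len]) (left_mem_segment _ _ _)

lemma pt_mem_frontier_iff {x : Vertex} : pt x ∈ frontier M.D ↔ ∃ i, 1 ≤ i ∧ i ≤ M.len ∧ x = M.vert i := by
  have h3 := M.three_le_len
  constructor
  · intro hx
    obtain ⟨i, hi, hx⟩ := M.exists_edge hx
    rcases eq_or_eq_of_pt_mem_segment (M.adj i hi) hx with rfl | rfl
    · rcases Nat.eq_zero_or_pos i with rfl | hi'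
      · exact ⟨M.len, by omega, le_rfl, M.vert_len.symm⟩
      · exact ⟨i, hi', hi.le, rfl⟩
    · exact ⟨i + 1, by omega, hi, rfl⟩
  · rintro ⟨i, -, hi, rfl⟩
    exact M.vert_mem_frontier hi

lemma mid_mem_frontier {i : ℕ} (hi : i < M.len) : mid (M.vert i) (M.vert (i + 1)) ∈ frontier M.D :=
  M.segment_subset_frontier hi (mid_mem_segment _ _)

/-- With `vert 0` listed as `vert len`, the indices `1, …, last` of `A₊` and `last + 1, …, len` of
`A₋` partition the boundary vertices; the marked midpoints are not vertices. -/
lemma pt_mem_arcPlus_iff {x : Vertex} : pt x ∈ M.arcPlus ↔ ∃ i, 1 ≤ i ∧ i ≤ M.last ∧ x = M.vert i := by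
  have h3 := M.three_le_len
  have h1 := M.one_le_last
  have h2 := M.last_lt
  constructor
  · rintro ((hx | hx) | hx)
    · exact ⟨1, le_rfl, h1, eq_right_of_pt_mem_segment_mid (M.adj 0 (by omega)) hx⟩
    · simp only [Set.mem_iUnion] at hx
      obtain ⟨i, ⟨hi₁, hi₂⟩, hx⟩ := hx
      rcases eq_or_eq_of_pt_mem_segment (M.adj i (by omega)) hx with rfl | rfl
      · exact ⟨i, hi₁, hi₂.le, rfl⟩
      · exact ⟨i + 1, by omega, hi₂, rfl⟩
    · exact ⟨M.last, h1, le_rfl, eq_left_of_pt_mem_segment_mid (M.adj _ h2) hx⟩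
  · rintro ⟨i, hi₁, hi₂, rfl⟩
    rcases hi₂.lt_or_eq with hi | rfl
    · exact Or.inl (Or.inr (Set.mem_biUnion (x := i) ⟨hi₁, hi⟩ (left_mem_segment _ _ _)))
    · exact Or.inr (left_mem_segment _ _ _)

lemma pt_mem_arcMinus_iff {x : Vertex} :
    pt x ∈ M.arcMinus ↔ ∃ i, M.last + 1 ≤ i ∧ i ≤ M.len ∧ x = M.vert i := by
  have h3 := M.three_le_len
  have h1 := M.one_le_last
  have h2 := M.last_lt
  constructor
  · rintro ((hx | hx) | hx)
    · exact ⟨M.last + 1, le_rfl, h2, eq_right_of_pt_mem_segment_mid (M.adj _ h2) hx⟩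
    · simp only [Set.mem_iUnion] at hx
      obtain ⟨i, ⟨hi₁, hi₂⟩, hx⟩ := hx
      rcases eq_or_eq_of_pt_mem_segment (M.adj i (by omega)) hx with rfl | rfl
      · exact ⟨i, hi₁, hi₂.le, rfl⟩
      · exact ⟨i + 1, by omega, hi₂, rfl⟩
    · rw [M.vert_len] at hx
      exact ⟨M.len, h2, le_rfl, (eq_left_of_pt_mem_segment_mid (M.adj 0 (by omega)) hx).trans
        M.vert_len.symm⟩
  · rintro ⟨i, hi₁, hi₂, rfl⟩
    rcases hi₂.lt_or_eq with hi | rfl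
    · exact Or.inl (Or.inr (Set.mem_biUnion (x := i) ⟨hi₁, hi⟩ (left_mem_segment _ _ _)))
    · exact Or.inr (left_mem_segment _ _ _)

lemma pt_mem_arc_or {x : Vertex} (hx : pt x ∈ frontier M.D) : pt x ∈ M.arcPlus ∨ pt x ∈ M.arcMinus := by
  obtain ⟨i, h₁, h₂, rfl⟩ := M.pt_mem_frontier_iff.1 hx
  rw [pt_mem_arcPlus_iff, pt_mem_arcMinus_iff]
  rcases le_or_gt i M.last with h | h
  exacts [Or.inl ⟨i, h₁, h, rfl⟩, Or.inr ⟨i, h, h₂, rfl⟩]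

lemma vert_eq_vert {i j : ℕ} (hi : 1 ≤ i) (hi' : i ≤ M.len) (hj : 1 ≤ j) (hj' : j ≤ M.len)
    (h : M.vert i = M.vert j) : i = j := by
  have hl : ∀ i, 1 ≤ i → i ≤ M.len → ∃ k, k < M.len ∧ M.vert i = M.vert k ∧
      (i = k ∨ (i = M.len ∧ k = 0)) := by
    intro i h1 h2
    rcases h2.lt_or_eq with h | rfl
    exacts [⟨i, h, rfl, Or.inl rfl⟩, ⟨0, by omega, M.vert_len, Or.inr ⟨rfl, rfl⟩⟩]
  obtain ⟨k, hk, hik, hk'⟩ := hl i hi hi'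
  obtain ⟨l, hl, hjl, hl'⟩ := hl j hj hj'
  have := M.injOn hk hl (by rw [← hik, ← hjl, h])
  omega

lemma notMem_arcMinus {x : Vertex} (hx : pt x ∈ M.arcPlus) : pt x ∉ M.arcMinus := by
  intro hx'
  obtain ⟨i, h₁, h₂, rfl⟩ := M.pt_mem_arcPlus_iff.1 hx
  obtain ⟨j, h₃, h₄, h⟩ := M.pt_mem_arcMinus_iff.1 hx'
  have := M.last_lt
  have := M.vert_eq_vert h₁ (by omega) (by omega) h₄ h
  omega

lemma mem_frontier_of_arcPlus {x : Vertex} (hx : pt x ∈ M.arcPlus) : pt x ∈ frontier M.D := by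
  obtain ⟨i, h₁, h₂, rfl⟩ := M.pt_mem_arcPlus_iff.1 hx
  exact M.vert_mem_frontier (h₂.trans M.last_lt.le)

lemma mem_frontier_of_arcMinus {x : Vertex} (hx : pt x ∈ M.arcMinus) : pt x ∈ frontier M.D := by
  obtain ⟨i, h₁, h₂, rfl⟩ := M.pt_mem_arcMinus_iff.1 hx
  exact M.vert_mem_frontier h₂

lemma disjoint_openTriangle_frontier {u v : Vertex} (h : Adj u v) :
    Disjoint (openTriangle u v) (frontier M.D) := by
  rw [M.frontier_eq, Set.disjoint_iUnion₂_right]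
  exact fun i hi => disjoint_openTriangle_segment h (M.adj i hi)

lemma openTriangle_subset {u v : Vertex} (h : Adj u v) (hc : center u v ∈ M.D) :
    openTriangle u v ⊆ M.D :=
  subset_of_disjoint_frontier M.isOpen (isPreconnected_openTriangle u v)
    (M.disjoint_openTriangle_frontier h) ⟨_, center_mem_openTriangle u v, hc⟩

/-- A side of a triangle in `D` that is not on the boundary of `D` bounds another triangle
in `D`. -/
lemma center_mem_swap {u v : Vertex} (h : Adj u v) (hc : center u v ∈ M.D)
    (hm : mid u v ∉ frontier M.D) : center v u ∈ M.D := by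
  have key : ∀ {a b : Vertex}, Adj a b → mid a b ∉ frontier M.D →
      (insert (mid a b) (openTriangle a b) ∩ M.D).Nonempty →
      insert (mid a b) (openTriangle a b) ⊆ M.D := by
    intro a b hab hm hne
    refine subset_of_disjoint_frontier M.isOpen ?_ ?_ hne
    · exact (isPreconnected_openTriangle a b).subset_closure (Set.subset_insert _ _)
        (Set.insert_subset (mid_mem_closure a b) subset_closure)
    · rw [Set.disjoint_insert_left]
      exact ⟨hm, M.disjoint_openTriangle_frontier hab⟩
  have h1 := key h hm ⟨center u v, Or.inr (center_mem_openTriangle u v), hc⟩ (Or.inl rfl)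
  rw [mid_comm] at h1 hm
  exact key h.symm hm ⟨mid v u, Or.inl rfl, h1⟩ (Or.inr (center_mem_openTriangle v u))

lemma mem_or_mem_frontier {u v x : Vertex} (h : Adj u v) (hc : center u v ∈ M.D)
    (hx : pt x ∈ closure (openTriangle u v)) : pt x ∈ M.D ∨ pt x ∈ frontier M.D := by
  have := closure_mono (M.openTriangle_subset h hc) hx
  rw [closure_eq_self_union_frontier] at this
  exact this

/-- The vertices in `B ∩ D` whose component does not see the part `A` of the boundary. -/
def pocket (B A : Set ℂ) : Set Vertex :=
  {x | pt x ∈ B ∩ M.D ∧ Disjoint (frontier (connectedComponentIn (B ∩ M.D) (pt x))) A}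

/-- A connected piece lies in a single component, and its limit points outside `D` cannot be
interior to that component. -/
lemma mem_frontier_component {B : Set ℂ} {S : Set ℂ} (hS : IsPreconnected S) (hSD : S ⊆ B ∩ M.D)
    {c : ℂ} (hc : c ∈ S) {w : ℂ} (hw : w ∈ closure S) (hwD : w ∉ M.D) :
    w ∈ frontier (connectedComponentIn (B ∩ M.D) c) := by
  refine ⟨closure_mono (hS.subset_connectedComponentIn hc hSD) hw, fun hi => hwD ?_⟩
  exact (connectedComponentIn_subset _ _ (interior_subset hi)).2

lemma mem_pocket_or {B A : Set ℂ} {u v x : Vertex} (h : Adj u v)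
    (hc : center u v ∈ M.D) (hT : openTriangle u v ⊆ B) (hx : pt x ∈ closure (openTriangle u v))
    (hxB : pt x ∈ B)
    (hA : Disjoint (frontier (connectedComponentIn (B ∩ M.D) (center u v))) A) :
    x ∈ M.pocket B A ∨ (pt x ∈ frontier M.D ∧ pt x ∉ A) := by
  have hTD : openTriangle u v ⊆ B ∩ M.D := Set.subset_inter hT (M.openTriangle_subset h hc)
  rcases M.mem_or_mem_frontier h hc hx with hxD | hxD
  · left
    refine ⟨⟨hxB, hxD⟩, ?_⟩
    have : pt x ∈ connectedComponentIn (B ∩ M.D) (center u v) := by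
      refine IsPreconnected.subset_connectedComponentIn (s := insert (pt x) (openTriangle u v)) ?_
        (Or.inr (center_mem_openTriangle u v)) ?_ (Or.inl rfl)
      · exact (isPreconnected_openTriangle u v).subset_closure (Set.subset_insert _ _)
          (Set.insert_subset hx subset_closure)
      · exact Set.insert_subset ⟨hxB, hxD⟩ hTD
    rwa [← connectedComponentIn_eq this]
  · refine Or.inr ⟨hxD, fun hxA => ?_⟩
    refine Set.disjoint_left.1 hA ?_ hxA
    exact M.mem_frontier_component (isPreconnected_openTriangle u v) hTD
      (center_mem_openTriangle u v) hx (M.notMem_of_mem_frontier hxD)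

/-- The open edge from a vertex in `D` avoids the boundary: a boundary edge meeting its interior
would be this very edge and would contain `x`. So the edge stays in the component of `x` until its
last point. -/
lemma pocket_step {B A : Set ℂ} (hB : Convex ℝ B) {x y : Vertex} (hx : x ∈ M.pocket B A)
    (hxy : Adj x y) (hy : pt y ∈ B) : y ∈ M.pocket B A ∨ (pt y ∈ frontier M.D ∧ pt y ∉ A) := by
  obtain ⟨⟨hxB, hxD⟩, hA⟩ := hx
  set S : Set ℂ := insert (pt x) (openSegment ℝ (pt x) (pt y)) with hS
  have hpre : IsPreconnected S := by
    refine (convex_openSegment (pt x) (pt y)).isPreconnected.subset_closure (Set.subset_insert _ _) ?_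
    rw [closure_openSegment]
    exact Set.insert_subset (left_mem_segment _ _ _) (openSegment_subset_segment _ _ _)
  have hcl : pt y ∈ closure S := by
    refine closure_mono (Set.subset_insert _ _) ?_
    rw [closure_openSegment]
    exact right_mem_segment _ _ _
  have hxF : pt x ∉ frontier M.D := fun h => M.notMem_of_mem_frontier h hxD
  have hSF : Disjoint S (frontier M.D) := by
    rw [hS, Set.disjoint_insert_left]
    refine ⟨hxF, Set.disjoint_left.2 fun w hw hwF => ?_⟩
    obtain ⟨i, hi, hwi⟩ := M.exists_edge hwF
    rw [openSegment_eq_image'] at hw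
    obtain ⟨t, ⟨ht₀, ht₁⟩, rfl⟩ := hw
    have := edge_eq_of_mem hxy (M.adj i hi) ht₀ ht₁
      (by rw [coordFst_add, coordFst_smul, coordFst_sub]; simp)
      (by rw [coordSnd_add, coordSnd_smul, coordSnd_sub]; simp) hwi
    rcases this with ⟨h, -⟩ | ⟨-, h⟩
    · exact hxF (h ▸ M.vert_mem_frontier hi.le)
    · exact hxF (h ▸ M.vert_mem_frontier hi)
  have hSD : S ⊆ M.D := subset_of_disjoint_frontier M.isOpen hpre hSF ⟨pt x, Or.inl rfl, hxD⟩
  have hSB : S ⊆ B := Set.insert_subset hxB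
    ((openSegment_subset_segment _ _ _).trans (hB.segment_subset hxB hy))
  have hyc := closure_mono hSD hcl
  rw [closure_eq_self_union_frontier] at hyc
  rcases hyc with hyD | hyF
  · left
    refine ⟨⟨hy, hyD⟩, ?_⟩
    have : pt y ∈ connectedComponentIn (B ∩ M.D) (pt x) := by
      refine IsPreconnected.subset_connectedComponentIn (s := insert (pt y) S) ?_
        (Or.inr (Or.inl rfl)) ?_ (Or.inl rfl)
      · exact hpre.subset_closure (Set.subset_insert _ _) (Set.insert_subset hcl subset_closure)
      · exact Set.insert_subset ⟨hy, hyD⟩ (Set.subset_inter hSB hSD)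
    rwa [← connectedComponentIn_eq this]
  · refine Or.inr ⟨hyF, fun hyA => Set.disjoint_left.1 hA ?_ hyA⟩
    exact M.mem_frontier_component hpre (Set.subset_inter hSB hSD) (Or.inl rfl) hcl
      (M.notMem_of_mem_frontier hyF)

lemma start_mem_arcPlus : M.start ∈ M.arcPlus := Or.inl (Or.inl (left_mem_segment _ _ _))
lemma start_mem_arcMinus : M.start ∈ M.arcMinus := Or.inr (right_mem_segment _ _ _)
lemma finish_mem_arcPlus : M.finish ∈ M.arcPlus := Or.inr (right_mem_segment _ _ _)
lemma finish_mem_arcMinus : M.finish ∈ M.arcMinus := Or.inl (Or.inl (left_mem_segment _ _ _))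

/-- No component of `B ∩ D` sees both boundary arcs. -/
def Separates (B : Set ℂ) : Prop :=
  ¬ ∃ w ∈ B ∩ M.D, (frontier (connectedComponentIn (B ∩ M.D) w) ∩ M.arcMinus).Nonempty ∧
    (frontier (connectedComponentIn (B ∩ M.D) w) ∩ M.arcPlus).Nonempty

/-- A marked midpoint belongs to both arcs. If it were in `B`, the part in `B` of the adjacent
triangle, connected by convexity, would lie in a component that sees both. -/
lemma Separates.mid_notMem {M : MarkedDomain} {B : Set ℂ} (h : M.Separates B) (hB : Convex ℝ B)
    (hBo : IsOpen B) {i : ℕ} (hi : i < M.len)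
    (hp : mid (M.vert i) (M.vert (i + 1)) ∈ M.arcPlus)
    (hm : mid (M.vert i) (M.vert (i + 1)) ∈ M.arcMinus) : mid (M.vert i) (M.vert (i + 1)) ∉ B := by
  intro hin
  set S := B ∩ openTriangle (M.vert i) (M.vert (i + 1))
  have hcl : mid (M.vert i) (M.vert (i + 1)) ∈ closure S :=
    hBo.inter_closure ⟨hin, mid_mem_closure _ _⟩
  have hS : IsPreconnected S := (hB.inter (convex_openTriangle _ _)).isPreconnected
  have hSD : S ⊆ B ∩ M.D :=
    Set.inter_subset_inter_right _ (M.openTriangle_subset (M.adj i hi) (M.center_mem i hi))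
  obtain ⟨w, hw⟩ : S.Nonempty := closure_nonempty_iff.1 ⟨_, hcl⟩
  have hf := M.mem_frontier_component hS hSD hw hcl (M.notMem_of_mem_frontier (M.mid_mem_frontier hi))
  exact h ⟨w, hSD hw, ⟨_, hf, hm⟩, ⟨_, hf, hp⟩⟩

lemma Separates.start_notMem {M : MarkedDomain} {B : Set ℂ} (h : M.Separates B) (hB : Convex ℝ B)
    (hBo : IsOpen B) : M.start ∉ B :=
  h.mid_notMem hB hBo (by linarith [M.three_le_len]) M.start_mem_arcPlus M.start_mem_arcMinus

lemma Separates.finish_notMem {M : MarkedDomain} {B : Set ℂ} (h : M.Separates B) (hB : Convex ℝ B)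
    (hBo : IsOpen B) : M.finish ∉ B :=
  h.mid_notMem hB hBo M.last_lt M.finish_mem_arcPlus M.finish_mem_arcMinus

/-- The vertices inside `D`. -/
def interiorVerts : Set Vertex := {v | pt v ∈ M.D}

lemma finite_interiorVerts : M.interiorVerts.Finite := by
  obtain ⟨C, hC⟩ := M.isBounded.exists_norm_le
  refine ((Set.finite_Icc (-⌈2 * C⌉) ⌈2 * C⌉).prod (Set.finite_Icc (-⌈2 * C⌉) ⌈2 * C⌉)).subset ?_
  intro v hv
  have h := hC _ hv
  have h₁ := abs_coordFst_le (pt v)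
  have h₂ := abs_coordSnd_le (pt v)
  rw [coordFst_pt] at h₁
  rw [coordSnd_pt] at h₂
  have h₁' : (|v.1| : ℤ) ≤ ⌈2 * C⌉ := by
    rw [Int.le_ceil_iff]; push_cast; linarith
  have h₂' : (|v.2| : ℤ) ≤ ⌈2 * C⌉ := by
    rw [Int.le_ceil_iff]; push_cast; linarith
  rw [abs_le] at h₁' h₂'
  exact ⟨h₁', h₂'⟩

lemma encloses : Encloses {v | pt v ∈ frontier M.D} M.interiorVerts := by
  refine ⟨M.finite_interiorVerts, fun x hx d hd => ?_⟩
  have hadj : Adj x (x + d) := by simpa [Adj] using hd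
  have := M.pocket_step (B := Set.univ) (A := ∅) convex_univ (x := x) ⟨⟨trivial, hx⟩, by simp⟩ hadj
    trivial
  exact this.imp (fun h => h.1.2) fun h => h.1

end MarkedDomain

/-! ### Invariants of the exploration process -/

namespace MarkedDomain

variable (M : MarkedDomain)

/-- The process has not stopped before or at step `n`. -/
def Running (x : ℕ → ℝ) (n : ℕ) : Prop := ¬ (1 ≤ n ∧ (M.run x n).pos ∈ frontier M.D)

variable {M} {x : ℕ → ℝ} {n : ℕ}

lemma run_succ (h : M.Running x n) : M.run x (n + 1) = (M.run x n).step (x n) := by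
  rw [run, if_neg h]

lemma run_succ_of_not_running (h : ¬ M.Running x n) : M.run x (n + 1) = M.run x n := by
  rw [run, if_pos (not_not.1 h)]

lemma Running.of_succ (h : M.Running x (n + 1)) : M.Running x n := by
  by_contra hn
  refine h ⟨by omega, ?_⟩
  rw [run_succ_of_not_running hn]
  exact (not_not.1 hn).2

lemma Running.of_le (h : M.Running x n) {k : ℕ} (hk : k ≤ n) : M.Running x k := by
  induction n with
  | zero => rwa [Nat.le_zero.1 hk]
  | succ n ih =>
    rcases hk.lt_or_eq with hk | rfl
    exacts [ih h.of_succ (by omega), h]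

variable (M) in
/-- The properties of the states of the process that are preserved in every step. -/
structure Consistent (s : State) : Prop where
  adj : Adj s.tail s.head
  colored : s.Colored
  frontier_subset : {v | pt v ∈ frontier M.D} ⊆ s.known
  tail_mem : s.tail ∈ s.known
  head_mem : s.head ∈ s.known
  color_tail : s.color s.tail = 0
  color_head : s.color s.head = 1
  color_plus : ∀ v, pt v ∈ M.arcPlus → s.color v = 1
  color_minus : ∀ v, pt v ∈ M.arcMinus → s.color v = 0

variable (M) in
lemma consistent_init : M.Consistent M.init := by
  have h3 := M.three_le_len
  have h1 := M.one_le_last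
  have h2 := M.last_lt
  have hp : ∀ v, pt v ∈ M.arcPlus → M.init.color v = 1 := fun v hv => if_pos hv
  have hm : ∀ v, pt v ∈ M.arcMinus → M.init.color v = 0 :=
    fun v hv => if_neg fun h => M.notMem_arcMinus h hv
  refine ⟨M.adj 0 (by omega), fun v _ => ?_, subset_rfl, M.vert_mem_frontier (by omega),
    M.vert_mem_frontier (by omega), hm _ ?_, hp _ ?_, hp, hm⟩
  · simp only [init]
    split_ifs <;> simp
  · exact M.pt_mem_arcMinus_iff.2 ⟨M.len, h2, le_rfl, M.vert_len.symm⟩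
  · exact M.pt_mem_arcPlus_iff.2 ⟨1, le_rfl, h1, rfl⟩

lemma _root_.HarmonicExplorer.State.color_step {s : State} {v : Vertex} (hv : v ∈ s.known) (y : ℝ) :
    (s.step y).color v = s.color v := by
  by_cases h : s.next ∈ s.known
  · simp [State.step, h]
  · have hne : v ≠ s.next := by
      rintro rfl
      exact h hv
    simp [State.step, h, hne]

/-- At a known vertex the probability is its colour, so the turn is forced and agrees with that
colour. The coin value `0` has to be excluded: at a vertex of colour `0` it would count as a
success. -/
lemma Consistent.le_prob_iff {s : State} (hs : M.Consistent s) {y : ℝ} (h0 : 0 < y) (h1 : y ≤ 1) :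
    (y ≤ s.prob ∧ (s.step y).color s.next = 1) ∨ (¬ y ≤ s.prob ∧ (s.step y).color s.next = 0) := by
  by_cases hn : s.next ∈ s.known
  · rw [State.color_step hn]
    have hp : s.prob = s.color s.next := hs.colored.ext_spec.2.1 _ hn
    rw [hp]
    rcases hs.colored _ hn with h | h <;> rw [h] <;> simp [h0, h1]
  · by_cases hy : y ≤ s.prob <;> simp [State.step, hn, hy]

lemma Consistent.step {s : State} (hs : M.Consistent s) {y : ℝ} (h0 : 0 < y) (h1 : y ≤ 1) :
    M.Consistent (s.step y) := by
  have hsub : s.known ⊆ (s.step y).known := Set.subset_insert _ _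
  have hnext : s.next ∈ (s.step y).known := Set.mem_insert _ _
  have hf := hs.frontier_subset
  have common : ∀ {v}, pt v ∈ M.arcPlus ∨ pt v ∈ M.arcMinus → (s.step y).color v = s.color v :=
    fun hv => State.color_step (hf (hv.elim M.mem_frontier_of_arcPlus M.mem_frontier_of_arcMinus)) y
  rcases hs.le_prob_iff h0 h1 with ⟨hy, hc⟩ | ⟨hy, hc⟩
  · have ht : (s.step y).tail = s.tail := if_pos hy
    have hh : (s.step y).head = s.next := if_pos hy
    refine ⟨?_, hs.colored.step y, hf.trans hsub, ?_, ?_, ?_, ?_, fun v hv => ?_, fun v hv => ?_⟩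
    · rw [ht, hh]; exact hs.adj.apex_left
    · rw [ht]; exact hsub hs.tail_mem
    · rw [hh]; exact hnext
    · rw [ht, State.color_step hs.tail_mem, hs.color_tail]
    · rw [hh, hc]
    · rw [common (Or.inl hv), hs.color_plus v hv]
    · rw [common (Or.inr hv), hs.color_minus v hv]
  · have ht : (s.step y).tail = s.next := if_neg hy
    have hh : (s.step y).head = s.head := if_neg hy
    refine ⟨?_, hs.colored.step y, hf.trans hsub, ?_, ?_, ?_, ?_, fun v hv => ?_, fun v hv => ?_⟩
    · rw [ht, hh]; exact hs.adj.apex_right.symm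
    · rw [ht]; exact hnext
    · rw [hh]; exact hsub hs.head_mem
    · rw [ht, hc]
    · rw [hh, State.color_step hs.head_mem, hs.color_head]
    · rw [common (Or.inl hv), hs.color_plus v hv]
    · rw [common (Or.inr hv), hs.color_minus v hv]

lemma consistent_run (hx : ∀ i, 0 < x i ∧ x i ≤ 1) (n : ℕ) : M.Consistent (M.run x n) := by
  induction n with
  | zero => exact M.consistent_init
  | succ n ih =>
    by_cases h : M.Running x n
    · rw [run_succ h]
      exact ih.step (hx n).1 (hx n).2
    · rwa [run_succ_of_not_running h]

lemma known_mono {k : ℕ} (hk : k ≤ n) : (M.run x k).known ⊆ (M.run x n).known := by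
  induction n with
  | zero => rw [Nat.le_zero.1 hk]
  | succ n ih =>
    rcases hk.lt_or_eq with hk | rfl
    · refine (ih (by omega)).trans ?_
      by_cases h : M.Running x n
      · rw [run_succ h]
        exact Set.subset_insert _ _
      · rw [run_succ_of_not_running h]
    · rfl

lemma color_run {k : ℕ} (hk : k ≤ n) {v : Vertex} (hv : v ∈ (M.run x k).known) :
    (M.run x n).color v = (M.run x k).color v := by
  induction n with
  | zero => rw [Nat.le_zero.1 hk]
  | succ n ih =>
    rcases hk.lt_or_eq with hk | rfl
    · rw [← ih (by omega)]
      by_cases h : M.Running x n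
      · rw [run_succ h]
        exact State.color_step (known_mono (by omega) hv) _
      · rw [run_succ_of_not_running h]
    · rfl

lemma step_cases (s : State) (y : ℝ) :
    ((s.step y).tail = s.tail ∧ (s.step y).head = s.next) ∨
      ((s.step y).tail = s.next ∧ (s.step y).head = s.head) := by
  simp only [State.step]
  split_ifs <;> simp

/-- Used to see that off the explored edges the extension is harmonic inside `D`. -/
lemma mem_known {v : Vertex} (hv : v ∈ (M.run x n).known) :
    pt v ∈ frontier M.D ∨ ∃ i ≤ n, v = (M.run x i).tail ∨ v = (M.run x i).head := by
  induction n with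
  | zero => exact Or.inl hv
  | succ n ih =>
    have lift : v ∈ (M.run x n).known →
        pt v ∈ frontier M.D ∨ ∃ i ≤ n + 1, v = (M.run x i).tail ∨ v = (M.run x i).head :=
      fun h => (ih h).imp_right fun ⟨i, hi, h⟩ => ⟨i, by omega, h⟩
    by_cases h : M.Running x n
    · rw [run_succ h] at hv
      rcases hv with rfl | hv
      · refine Or.inr ⟨n + 1, le_rfl, ?_⟩
        rw [run_succ h]
        rcases step_cases (M.run x n) (x n) with h | h <;> simp [h]
      · exact lift hv
    · rw [run_succ_of_not_running h] at hv
      exact lift hv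

/-- The next triangle is in `D`. -/
lemma Running.center_mem (hx : ∀ i, 0 < x i ∧ x i ≤ 1) (h : M.Running x n) :
    center (M.run x n).tail (M.run x n).head ∈ M.D := by
  induction n with
  | zero => exact M.center_mem 0 (by linarith [M.three_le_len])
  | succ n ih =>
    have hn := h.of_succ
    have hc := ih hn
    have hadj := (consistent_run (M := M) hx n).adj
    have hm : mid (M.run x (n + 1)).tail (M.run x (n + 1)).head ∉ frontier M.D :=
      fun hm => h ⟨by omega, hm⟩
    rw [run_succ hn] at hm ⊢
    rcases step_cases (M.run x n) (x n) with ⟨h₁, h₂⟩ | ⟨h₁, h₂⟩ <;> rw [h₁, h₂] at hm ⊢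
    · rw [mid_comm] at hm
      exact M.center_mem_swap hadj.apex_left.symm (by rwa [State.next, center_apex_left]) hm
    · rw [mid_comm] at hm
      exact M.center_mem_swap hadj.apex_right (by rwa [State.next, center_apex_right]) hm

/-- The only edges on the boundary whose ends have different colors are the two marked ones. -/
lemma Consistent.pos_eq {s : State} (hs : M.Consistent s) (h : s.pos ∈ frontier M.D) :
    s.pos = M.start ∨ s.pos = M.finish := by
  have h3 := M.three_le_len
  have h1 := M.one_le_last
  have h2 := M.last_lt
  obtain ⟨i, hi, hw⟩ := M.exists_edge h
  have he := edge_eq_of_mid_mem hs.adj (M.adj i hi) hw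
  have hpos : s.pos = mid (M.vert i) (M.vert (i + 1)) := by
    rcases he with ⟨h, h'⟩ | ⟨h, h'⟩ <;> rw [h, h']
    · rfl
    · exact mid_comm _ _
  have hne : s.color (M.vert i) ≠ s.color (M.vert (i + 1)) := by
    rcases he with ⟨h, h'⟩ | ⟨h, h'⟩ <;> rw [h, h', hs.color_tail, hs.color_head] <;> norm_num
  rcases Nat.eq_zero_or_pos i with rfl | hi0
  · exact Or.inl hpos
  rcases lt_trichotomy i M.last with hl | rfl | hl
  · refine (hne ?_).elim
    rw [hs.color_plus _ (M.pt_mem_arcPlus_iff.2 ⟨i, hi0, hl.le, rfl⟩),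
      hs.color_plus _ (M.pt_mem_arcPlus_iff.2 ⟨i + 1, by omega, hl, rfl⟩)]
  · exact Or.inr hpos
  · refine (hne ?_).elim
    rw [hs.color_minus _ (M.pt_mem_arcMinus_iff.2 ⟨i, hl, hi.le, rfl⟩),
      hs.color_minus _ (M.pt_mem_arcMinus_iff.2 ⟨i + 1, by omega, hi, rfl⟩)]

/-- The path does not use a directed edge twice. -/
lemma Running.ne_of_lt (hx : ∀ i, 0 < x i ∧ x i ≤ 1) (h : M.Running x n) {i j : ℕ} (hij : i < j)
    (hj : j ≤ n) : ¬ ((M.run x i).tail = (M.run x j).tail ∧ (M.run x i).head = (M.run x j).head) := by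
  -- A step can be undone from the resulting directed edge, so a repetition propagates back to the
  -- initial edge. That edge is on the boundary, where a second visit would have stopped the
  -- process.
  induction i generalizing j with
  | zero =>
    rintro ⟨h₁, h₂⟩
    refine h.of_le hj ⟨hij, ?_⟩
    rw [State.pos, ← h₁, ← h₂]
    exact M.mid_mem_frontier (by linarith [M.three_le_len])
  | succ i ih =>
    obtain ⟨j, rfl⟩ : ∃ k, j = k + 1 := ⟨j - 1, by omega⟩
    rintro ⟨h₁, h₂⟩
    refine ih (j := j) (by omega) (by omega) ?_
    have ct : ∀ k ≤ n, (M.run x n).color (M.run x k).tail = 0 := fun k hk => by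
      rw [color_run hk (consistent_run hx k).tail_mem, (consistent_run (M := M) hx k).color_tail]
    have ch : ∀ k ≤ n, (M.run x n).color (M.run x k).head = 1 := fun k hk => by
      rw [color_run hk (consistent_run hx k).head_mem, (consistent_run (M := M) hx k).color_head]
    have ci := ct i (by omega)
    have ci' := ch i (by omega)
    have cj := ct j (by omega)
    have cj' := ch j (by omega)
    rw [run_succ (h.of_le (k := i) (by omega)), run_succ (h.of_le (k := j) (by omega))] at h₁ h₂
    rcases step_cases (M.run x i) (x i) with ⟨e₁, e₂⟩ | ⟨e₁, e₂⟩ <;>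
      rcases step_cases (M.run x j) (x j) with ⟨f₁, f₂⟩ | ⟨f₁, f₂⟩ <;>
      rw [e₁, f₁] at h₁ <;> rw [e₂, f₂] at h₂
    · refine ⟨h₁, ?_⟩
      rw [← apex_apex' (M.run x i).tail (M.run x i).head, ← apex_apex' (M.run x j).tail (M.run x j).head]
      simp only [State.next] at h₂
      rw [h₂, h₁]
    -- Different turns leading to the same edge would identify a head with a tail, which have
    -- different colours.
    · exfalso
      have e := apex_apex' (M.run x i).tail (M.run x i).head
      have f := apex_apex (M.run x j).tail (M.run x j).head
      simp only [State.next] at h₁ h₂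
      rw [h₂, h₁, f] at e
      rw [← e, cj] at ci'
      norm_num at ci'
    · exfalso
      have e := apex_apex (M.run x i).tail (M.run x i).head
      have f := apex_apex' (M.run x j).tail (M.run x j).head
      simp only [State.next] at h₁ h₂
      rw [h₁, h₂, f] at e
      rw [← e, cj'] at ci
      norm_num at ci
    · refine ⟨?_, h₂⟩
      rw [← apex_apex (M.run x i).tail (M.run x i).head, ← apex_apex (M.run x j).tail (M.run x j).head]
      simp only [State.next] at h₁
      rw [h₁, h₂]

end MarkedDomain

/-! ### The two sides of the path and the flux martingale -/

namespace State

/-- The end of the current edge that has the color of `A₋` (if `σ`) or of `A₊` (otherwise). -/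
def far (σ : Bool) (s : State) : Vertex := if σ then s.tail else s.head

/-- The end of the current edge that has the color of `A₊` (if `σ`) or of `A₋` (otherwise). -/
def near (σ : Bool) (s : State) : Vertex := if σ then s.head else s.tail

/-- The harmonic extension, normalized to vanish on `A₊` (if `σ`) or on `A₋` (otherwise). -/
noncomputable def height (σ : Bool) (s : State) (v : Vertex) : ℝ :=
  if σ then 1 - s.ext v else s.ext v

end State

namespace MarkedDomain

variable (M : MarkedDomain)

/-- The arc `A₊` (if `σ`) or `A₋` (otherwise). -/
def arc (σ : Bool) : Set ℂ := if σ then M.arcPlus else M.arcMinus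

/-- The vertices on the arc `A₊` (if `σ`) or `A₋` (otherwise). -/
def arcVerts (σ : Bool) : Set Vertex := {v | pt v ∈ M.arc σ}

variable {M}

lemma mem_arcVerts_or {v : Vertex} (σ : Bool) (hv : pt v ∈ frontier M.D) (h : pt v ∉ M.arc (!σ)) :
    v ∈ M.arcVerts σ := by
  have := M.pt_mem_arc_or hv
  cases σ <;> simp_all [arc, arcVerts]

lemma mem_frontier_of_arcVerts {σ : Bool} {v : Vertex} (hv : v ∈ M.arcVerts σ) :
    pt v ∈ frontier M.D := by
  cases σ
  exacts [M.mem_frontier_of_arcMinus hv, M.mem_frontier_of_arcPlus hv]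

namespace Consistent

variable {s : State}

lemma height_eq_zero (hs : M.Consistent s) {σ : Bool} {v : Vertex} (hv : v ∈ M.arcVerts σ) :
    s.height σ v = 0 := by
  have h := hs.colored.ext_spec.2.1 v (hs.frontier_subset (mem_frontier_of_arcVerts hv))
  cases σ
  · rw [State.height, if_neg (by simp), h, hs.color_minus v hv]
  · rw [State.height, if_pos rfl, h, hs.color_plus v hv, sub_self]

lemma encloses (hs : M.Consistent s) : Encloses s.known M.interiorVerts :=
  M.encloses.mono hs.frontier_subset

lemma height_mem (hs : M.Consistent s) (σ : Bool) {v : Vertex} (hv : v ∈ M.interiorVerts) :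
    0 ≤ s.height σ v ∧ s.height σ v ≤ 1 := by
  have := hs.colored.ext_mem hs.encloses (Or.inl hv)
  cases σ
  · simpa [State.height] using this
  · simp only [State.height, if_true]
    constructor <;> linarith

lemma height_harm (hs : M.Consistent s) (σ : Bool) {v : Vertex} (hv : v ∉ s.known) :
    s.height σ v = (∑ d ∈ dirs, s.height σ (v + d)) / 6 := by
  have := hs.colored.ext_spec.2.2 v hv
  cases σ
  · simpa [State.height] using this
  · simp only [State.height, if_true, Finset.sum_sub_distrib, Finset.sum_const, card_dirs,
      nsmul_eq_mul, mul_one]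
    rw [this]
    push_cast
    ring

lemma next_mem (hs : M.Consistent s) (hc : center s.tail s.head ∈ M.D) :
    s.next ∈ M.interiorVerts ∪ s.known :=
  (M.mem_or_mem_frontier hs.adj hc (pt_apex_mem_closure _ _)).imp id (@hs.frontier_subset _)

lemma prob_mem (hs : M.Consistent s) (hc : center s.tail s.head ∈ M.D) :
    0 ≤ s.prob ∧ s.prob ≤ 1 :=
  hs.colored.ext_mem hs.encloses (hs.next_mem hc)

lemma height_eq (hs : M.Consistent s) (hc : center s.tail s.head ∈ M.D) (σ : Bool)
    {x₀ x₁ : ℝ} (h₁ : x₁ ≤ s.prob) (h₀ : s.prob < 1 → s.prob < x₀)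
    {v : Vertex} (hv : v ∈ M.interiorVerts) :
    s.height σ v = s.prob * (s.step x₁).height σ v + (1 - s.prob) * (s.step x₀).height σ v := by
  have := hs.colored.ext_eq hs.encloses (hs.next_mem hc) h₁ h₀ (Or.inl hv)
  cases σ
  · simpa [State.height] using this
  · simp only [State.height, if_true]
    rw [this]
    ring

end Consistent

/-- The vertices of a large ball `B` around `o` that see only the arc `A₊` (if `σ`) or only `A₋`
(otherwise). -/
def side (M : MarkedDomain) (B : Set ℂ) (σ : Bool) : Set Vertex := M.pocket B (M.arc (!σ))

lemma side_subset {B : Set ℂ} {σ : Bool} : M.side B σ ⊆ M.interiorVerts := fun _ h => h.1.2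

lemma interior_notMem_arcVerts {v : Vertex} {σ : Bool} (hv : v ∈ M.interiorVerts) :
    v ∉ M.arcVerts σ :=
  fun h => M.notMem_of_mem_frontier (mem_frontier_of_arcVerts h) hv

-- The flux involves only values at vertices of `Q`, which are inside `D`, and there the heights
-- satisfy the martingale identity.
open Classical in
lemma Consistent.flux_eq {s : State} (hs : M.Consistent s) (hc : center s.tail s.head ∈ M.D) (σ : Bool)
    {x₀ x₁ : ℝ} (h₁ : x₁ ≤ s.prob) (h₀ : s.prob < 1 → s.prob < x₀) {o : Vertex} {ρ : ℕ} {B : Set ℂ}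
    {Bd : Set Vertex} :
    flux o ρ (M.side B σ) Bd (s.height σ) =
      s.prob * flux o ρ (M.side B σ) Bd ((s.step x₁).height σ) +
      (1 - s.prob) * flux o ρ (M.side B σ) Bd ((s.step x₀).height σ) := by
  simp only [flux, Finset.mul_sum, ← Finset.sum_add_distrib]
  refine Finset.sum_congr rfl fun x _ => ?_
  split_ifs with hx
  · simp only [Finset.mul_sum, ← Finset.sum_add_distrib]
    refine Finset.sum_congr rfl fun d _ => ?_
    split_ifs with hd
    · exact hs.height_eq hc σ h₁ h₀ (side_subset hd)
    · simp
  · simp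

open Classical in
lemma Consistent.flux_nonneg {s : State} (hs : M.Consistent s) (σ : Bool)
    {o : Vertex} {ρ : ℕ} {B : Set ℂ} {Bd : Set Vertex} :
    0 ≤ flux o ρ (M.side B σ) Bd (s.height σ) := by
  refine Finset.sum_nonneg fun x _ => ?_
  split_ifs
  · refine Finset.sum_nonneg fun d _ => ?_
    split_ifs with hd
    exacts [(hs.height_mem σ (side_subset hd)).1, le_rfl]
  · exact le_rfl

/-! ### Approaching a boundary point -/

/-- A convex set `B` contains the hexagonal ball of radius `R` around `o`, no component of `B ∩ D`
sees both arcs, the marked edge at the start is outside the ball of radius `R`, and the boundary of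
`D` meets the ball of radius `m`. -/
structure Arena (M : MarkedDomain) (B : Set ℂ) (o : Vertex) (m R : ℕ) : Prop where
  convex : Convex ℝ B
  pt_mem : ∀ v, hexNorm (v - o) ≤ R → pt v ∈ B
  separates : M.Separates B
  lt_zero : R < hexNorm (M.vert 0 - o)
  lt_one : R < hexNorm (M.vert 1 - o)
  touch : ∃ v, pt v ∈ frontier M.D ∧ hexNorm (v - o) ≤ m
  lt : m < R

/-- The first triangle whose new vertex is in the ball of radius `m` around `o` is explored in the
step after `n`, and the process approaches it on the side `σ`. -/
structure HitAt (M : MarkedDomain) (B : Set ℂ) (o : Vertex) (m : ℕ) (σ : Bool) (x : ℕ → ℝ) (n : ℕ) :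
    Prop where
  running : M.Running x n
  lt : ∀ i < n, m < hexNorm ((M.run x i).next - o)
  le : hexNorm ((M.run x n).next - o) ≤ m
  far_mem : (M.run x n).far σ ∈ M.side B σ

lemma openTriangle_subset_of_convex {B : Set ℂ} (hB : Convex ℝ B) {u v : Vertex} (hu : pt u ∈ B)
    (hv : pt v ∈ B) (hw : pt (apex u v) ∈ B) : openTriangle u v ⊆ B := by
  rintro _ ⟨p, ⟨h₁, h₂, h₃⟩, rfl⟩
  have hs : 0 < p.1 + p.2 := by linarith
  have h := hB hv hw (a := p.1 / (p.1 + p.2)) (b := p.2 / (p.1 + p.2)) (by positivity)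
    (by positivity) (by field_simp)
  have h' := hB hu h (a := 1 - (p.1 + p.2)) (b := p.1 + p.2) (by linarith) hs.le (by ring)
  convert h' using 1
  rw [smul_add, smul_smul, smul_smul, mul_div_cancel₀ _ hs.ne', mul_div_cancel₀ _ hs.ne']
  simp only [triPt, Complex.real_smul]
  push_cast
  ring

namespace Arena

variable {B : Set ℂ} {o : Vertex} {m R : ℕ} {x : ℕ → ℝ} {n : ℕ}

/-- The component of the center of the first such triangle misses one arc, which determines `σ`. The
far vertex is not on that arc, nor on the other one, which has the wrong colour; so it is inside
`D`, in the same component. -/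
lemma exists_hitAt (A : M.Arena B o m R) (hx : ∀ i, 0 < x i ∧ x i ≤ 1) (hr : M.Running x n)
    (hle : hexNorm ((M.run x n).next - o) ≤ m) : ∃ σ k, M.HitAt B o m σ x k := by
  induction n using Nat.strong_induction_on with
  | _ n ih =>
  by_cases hlt : ∃ i < n, hexNorm ((M.run x i).next - o) ≤ m
  · obtain ⟨i, hi, hi'⟩ := hlt
    exact ih i hi (hr.of_le hi.le) hi'
  push Not at hlt
  set s := M.run x n with hs
  have hcons : M.Consistent s := consistent_run hx n
  have hc := hr.center_mem hx
  rw [← hs] at hc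
  have hadj := hcons.adj
  have ht : hexNorm (s.tail - o) ≤ R :=
    (hexNorm_le_succ_of_adj hadj.apex_left.symm).trans (by have := A.lt; simp only [State.next] at hle; omega)
  have hh : hexNorm (s.head - o) ≤ R :=
    (hexNorm_le_succ_of_adj hadj.apex_right.symm).trans (by have := A.lt; simp only [State.next] at hle; omega)
  have hT : openTriangle s.tail s.head ⊆ B :=
    openTriangle_subset_of_convex A.convex (A.pt_mem _ ht) (A.pt_mem _ hh)
      (A.pt_mem _ (hle.trans A.lt.le))
  have hcB : center s.tail s.head ∈ B := hT (center_mem_openTriangle _ _)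
  have key : ∀ σ, Disjoint (frontier (connectedComponentIn (B ∩ M.D) (center s.tail s.head)))
      (M.arc (!σ)) → ∃ σ k, M.HitAt B o m σ x k := by
    intro σ hσ
    refine ⟨σ, n, hr, hlt, hle, ?_⟩
    rw [← hs]
    have hcl : pt (s.far σ) ∈ closure (openTriangle s.tail s.head) := by
      cases σ
      exacts [pt_right_mem_closure _ _, pt_left_mem_closure _ _]
    have hfB : pt (s.far σ) ∈ B := by
      cases σ
      exacts [A.pt_mem _ hh, A.pt_mem _ ht]
    refine (M.mem_pocket_or hadj hc hT hcl hfB hσ).resolve_right ?_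
    rintro ⟨hf, hnot⟩
    have hmem := mem_arcVerts_or σ hf hnot
    cases σ
    · have := hcons.color_minus _ hmem
      simp [State.far, hcons.color_head] at this
    · have := hcons.color_plus _ hmem
      simp [State.far, hcons.color_tail] at this
  by_contra hcon
  refine A.separates ⟨_, ⟨hcB, hc⟩, ?_, ?_⟩
  · rw [← Set.not_disjoint_iff_nonempty_inter]
    exact fun h => hcon (key true h)
  · rw [← Set.not_disjoint_iff_nonempty_inter]
    exact fun h => hcon (key false h)

lemma side_step (A : M.Arena B o m R) {σ : Bool} {u v : Vertex} (hu : u ∈ M.side B σ) (huv : Adj u v)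
    (hv : hexNorm (v - o) ≤ R) : v ∈ M.side B σ ∨ v ∈ M.arcVerts σ :=
  (M.pocket_step A.convex hu huv (A.pt_mem _ hv)).imp_right fun h => mem_arcVerts_or σ h.1 h.2

/-- The ball contains a boundary vertex. Walking there from the new vertex, one stays in the side
until a vertex of its own arc is met, since the other arc is not seen. -/
lemma touch_arcVerts (A : M.Arena B o m R) {σ : Bool} (h : M.HitAt B o m σ x n)
    (hx : ∀ i, 0 < x i ∧ x i ≤ 1) : ∃ v ∈ M.arcVerts σ, hexNorm (v - o) ≤ m := by
  have hadj := (consistent_run (M := M) hx n).adj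
  have hadj' : Adj ((M.run x n).far σ) (M.run x n).next := by
    cases σ
    exacts [hadj.apex_right, hadj.apex_left]
  rcases A.side_step h.far_mem hadj' (h.le.trans A.lt.le) with h₁ | h₁
  swap
  · exact ⟨_, h₁, h.le⟩
  obtain ⟨v, hv, hvm⟩ := A.touch
  have hl := linkedIn_ball (S := {w | hexNorm (w - o) ≤ m}) (fun _ h => h) h.le hvm
  by_contra! hcon
  have : v ∈ M.side B σ := by
    clear hvm hv
    induction hl with
    | refl => exact h₁
    | tail _ hbc ih =>
      refine (A.side_step ih hbc.1 (le_trans hbc.2 A.lt.le)).resolve_right fun hmem => ?_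
      exact (hcon _ hmem).not_ge hbc.2
  exact M.notMem_of_mem_frontier hv (side_subset this)

/-- The arc is a lattice path that starts at the near end of the initial edge; `A₋` is traversed
backwards from `vert len = vert 0`. -/
lemma linked (σ : Bool) {v : Vertex} (hv : v ∈ M.arcVerts σ) :
    LinkedIn (M.arcVerts σ) (M.init.near σ) v := by
  have h3 := M.three_le_len
  cases σ
  · obtain ⟨i, h₁, h₂, rfl⟩ := M.pt_mem_arcMinus_iff.1 hv
    obtain ⟨k, rfl⟩ : ∃ k, i = M.len - k := ⟨M.len - i, by omega⟩
    clear hv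
    induction k with
    | zero =>
      have : M.vert (M.len - 0) = M.init.near false := M.vert_len
      rw [this]
      exact Relation.ReflTransGen.refl
    | succ k ih =>
      by_cases hk : k < M.len
      · refine (ih (by omega) (by omega)).tail ⟨?_, M.pt_mem_arcMinus_iff.2 ⟨_, h₁, h₂, rfl⟩⟩
        have := (M.adj (M.len - (k + 1)) (by omega)).symm
        rwa [show M.len - (k + 1) + 1 = M.len - k by omega] at this
      · omega
  · obtain ⟨i, h₁, h₂, rfl⟩ := M.pt_mem_arcPlus_iff.1 hv
    clear hv
    induction i, h₁ using Nat.le_induction with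
    | base => exact Relation.ReflTransGen.refl
    | succ i hi ih =>
      refine (ih (by omega)).tail ⟨M.adj i ?_, M.pt_mem_arcPlus_iff.2 ⟨_, by omega, h₂, rfl⟩⟩
      have := M.last_lt
      omega

lemma init_near_mem (σ : Bool) : M.init.near σ ∈ M.arcVerts σ := by
  cases σ
  · exact M.pt_mem_arcMinus_iff.2 ⟨M.len, M.last_lt, le_rfl, M.vert_len.symm⟩
  · exact M.pt_mem_arcPlus_iff.2 ⟨1, le_rfl, M.one_le_last, rfl⟩

lemma lt_init (A : M.Arena B o m R) (σ : Bool) :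
    R < hexNorm (M.init.near σ - o) ∧ R < hexNorm (M.init.far σ - o) := by
  cases σ
  exacts [⟨A.lt_zero, A.lt_one⟩, ⟨A.lt_one, A.lt_zero⟩]

lemma crossing (A : M.Arena B o m R) {σ : Bool} (h : M.HitAt B o m σ x n)
    (hx : ∀ i, 0 < x i ∧ x i ≤ 1) :
    Crossing o m R n (fun i => (M.run x i).far σ) (fun i => (M.run x i).near σ)
      (fun i => (M.run x i).next) (M.side B σ) (M.arcVerts σ) := by
  have hcons : ∀ i, M.Consistent (M.run x i) := consistent_run hx
  have hstep : ∀ i < n, ((M.run x (i + 1)).far σ = (M.run x i).far σ ∧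
      (M.run x (i + 1)).near σ = (M.run x i).next) ∨
      ((M.run x (i + 1)).far σ = (M.run x i).next ∧
      (M.run x (i + 1)).near σ = (M.run x i).near σ) := by
    intro i hi
    rw [run_succ (h.running.of_le hi.le)]
    rcases step_cases (M.run x i) (x i) with ⟨h₁, h₂⟩ | ⟨h₁, h₂⟩ <;> cases σ <;>
      simp [State.far, State.near, h₁, h₂]
  have hlt : ∀ i ≤ n, m < hexNorm ((M.run x i).far σ - o) ∧ m < hexNorm ((M.run x i).near σ - o) := by
    intro i hi
    induction i with
    | zero => exact ⟨A.lt.trans (A.lt_init σ).2, A.lt.trans (A.lt_init σ).1⟩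
    | succ i ih =>
      have := ih (by omega)
      have := h.lt i (by omega)
      rcases hstep i (by omega) with ⟨h₁, h₂⟩ | ⟨h₁, h₂⟩ <;> rw [h₁, h₂] <;> tauto
  have ct : ∀ k ≤ n, (M.run x n).color (M.run x k).tail = 0 := fun k hk => by
    rw [color_run hk (hcons k).tail_mem, (hcons k).color_tail]
  have ch : ∀ k ≤ n, (M.run x n).color (M.run x k).head = 1 := fun k hk => by
    rw [color_run hk (hcons k).head_mem, (hcons k).color_head]
  refine ⟨?_, ?_, hstep, ?_, ?_, ?_, fun i hi => (hlt i hi).1, fun i hi => (hlt i hi).2,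
    (A.lt_init σ).2, h.le, h.far_mem, fun v hv => interior_notMem_arcVerts (side_subset hv),
    fun u hu v huv hv => A.side_step hu huv hv, init_near_mem σ, (A.lt_init σ).1.le,
    fun v hv => linked σ hv, A.touch_arcVerts h hx⟩
  · intro i _
    cases σ
    exacts [(hcons i).adj.symm, (hcons i).adj]
  · cases σ
    exacts [Or.inr fun i => rfl, Or.inl fun i => rfl]
  · intro i hi j hj h₁ h₂
    have : (M.run x i).tail = (M.run x j).tail ∧ (M.run x i).head = (M.run x j).head := by
      cases σ
      exacts [⟨h₂, h₁⟩, ⟨h₁, h₂⟩]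
    rcases lt_trichotomy i j with hij | hij | hij
    · exact (h.running.ne_of_lt hx hij hj this).elim
    · exact hij
    · exact (h.running.ne_of_lt hx hij hi ⟨this.1.symm, this.2.symm⟩).elim
  · intro i hi hmem
    cases σ
    · have := (hcons i).color_minus _ hmem
      simp [State.far, (hcons i).color_head] at this
    · have := (hcons i).color_plus _ hmem
      simp [State.far, (hcons i).color_tail] at this
  · intro i hi j hj hij
    have h₁ := ct i hi
    have h₂ := ct j hj
    have h₃ := ch i hi
    have h₄ := ch j hj
    cases σ
    · simp only [State.far, State.near, Bool.false_eq_true, if_false] at hij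
      rw [hij, h₂] at h₃
      norm_num at h₃
    · simp only [State.far, State.near, if_true] at hij
      rw [hij, h₄] at h₁
      norm_num at h₁

end Arena

/-- The flux is bounded below when the process comes close to `o`. -/
lemma exists_le_flux : ∃ K : ℕ, 2 ≤ K ∧ ∀ {M : MarkedDomain} {B : Set ℂ} {o : Vertex} {m R : ℕ}
    (_ : M.Arena B o m R) (_ : 2 * (K * (m + 1)) ≤ R) {σ : Bool} {x : ℕ → ℝ} {n : ℕ}
    (_ : ∀ i, 0 < x i ∧ x i ≤ 1) (_ : M.HitAt B o m σ x n),
    1 ≤ flux o (2 * (K * (m + 1))) (M.side B σ) (M.arcVerts σ) ((M.run x n).height σ) := by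
  obtain ⟨K, hK, hlow⟩ := exists_flux_lower_bound
  refine ⟨K, hK, fun {M B o m R} A hR {σ x n} hx h => ?_⟩
  have hs := consistent_run (M := M) hx n
  refine hlow (A.crossing h hx) hR (fun v hv => hs.height_mem σ (side_subset hv))
    (fun v hv => hs.height_eq_zero hv) (fun i hi => ?_) fun v hv hne => hs.height_harm σ ?_
  · have hi' := consistent_run (M := M) hx i
    cases σ
    · have : (M.run x n).ext (M.run x i).head = 1 := by
        rw [hs.colored.ext_spec.2.1 _ (known_mono hi hi'.head_mem), color_run hi hi'.head_mem,
          hi'.color_head]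
      simpa [State.height, State.far] using this
    · have : (M.run x n).ext (M.run x i).tail = 0 := by
        rw [hs.colored.ext_spec.2.1 _ (known_mono hi hi'.tail_mem), color_run hi hi'.tail_mem,
          hi'.color_tail]
      simpa [State.height, State.far] using this
  -- A known vertex is on the boundary or an end of an explored edge; a vertex of the side is not on
  -- the boundary, and the explored edges are excluded by `hne`.
  · intro hk
    rcases mem_known hk with hf | ⟨i, hi, h'⟩
    · exact M.notMem_of_mem_frontier hf (side_subset hv)
    · have := hne i hi
      cases σ <;> simp only [State.far, State.near] at this <;> simp at this <;> tauto

/-- The initial flux is small. -/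
lemma Arena.flux_init_le {B : Set ℂ} {o : Vertex} {m R : ℕ} (A : M.Arena B o m R) {σ : Bool}
    (ht : ∃ v ∈ M.arcVerts σ, hexNorm (v - o) ≤ m) {ρ : ℕ} (hρ : 0 < ρ) (hmρ : m ≤ ρ) (i : ℕ)
    (hi : 2 * (4 ^ i * (2 * ρ + 1)) ≤ R) :
    flux o ρ (M.side B σ) (M.arcVerts σ) (M.init.height σ) ≤ 75 * √(864 / 865) ^ i := by
  classical
  have hs := M.consistent_init
  let f : Vertex → ℝ := fun v => if v ∈ M.side B σ then M.init.height σ v else 0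
  have hf : HarmonicOn o R (M.side B σ) f := by
    refine ⟨fun v => ?_, fun v => ?_, fun v hv => if_neg hv, fun v hv hvR => ?_⟩
    · simp only [f]
      split_ifs with hv
      exacts [(hs.height_mem σ (side_subset hv)).1, le_rfl]
    · simp only [f]
      split_ifs with hv
      exacts [(hs.height_mem σ (side_subset hv)).2, zero_le_one]
    · simp only [f]
      rw [if_pos hv, hs.height_harm σ fun hk => M.notMem_of_mem_frontier hk (side_subset hv)]
      congr 1
      refine Finset.sum_congr rfl fun d hd => ?_
      split_ifs with hd'
      · rfl
      · have hadj : Adj v (v + d) := by simpa [Adj] using hd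
        refine hs.height_eq_zero ((A.side_step hv hadj ?_).resolve_left hd')
        have := hexNorm_le_succ_of_adj (o := o) hadj
        omega
  refine hf.flux_le (fun v hv => if_pos hv)
    (fun v hv => interior_notMem_arcVerts (side_subset hv)) hρ (fun s hs₁ hs₂ => ?_) i hi
  obtain ⟨v, hv, hvm⟩ := ht
  -- The arc goes from beyond radius `R` to within `m ≤ ρ` of `o`, so it meets every hexagon in
  -- between.
  obtain ⟨y, hy, hys⟩ := exists_hexNorm_eq_of_linkedIn (o := o) (Arena.linked σ hv) (Arena.init_near_mem σ)
    (s := s) (by have := (A.lt_init σ).1; omega) (by omega)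
  exact ⟨y, hys, if_neg fun h => interior_notMem_arcVerts (side_subset h) hy⟩

end MarkedDomain

/-! ### The maximal inequality for the exploration -/

namespace MarkedDomain

variable {M : MarkedDomain} {Ω : Type*} {X : ℕ → Ω → ℝ}

lemma run_congr {x y : ℕ → ℝ} {n : ℕ} (h : ∀ i < n, x i = y i) : M.run x n = M.run y n := by
  induction n with
  | zero => rfl
  | succ n ih =>
    rw [run, run, ih fun i hi => h i (by omega), h n (by omega)]

lemma run_update {c : ℕ → ℝ} {n : ℕ} {y : ℝ} {i : ℕ} (hi : i ≤ n) :
    M.run (Function.update c n y) i = M.run c i :=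
  run_congr fun _ hj => Function.update_of_ne (by omega) _ _

lemma run_update_succ {c : ℕ → ℝ} {n : ℕ} {y : ℝ} (h : M.Running c n) :
    M.run (Function.update c n y) (n + 1) = (M.run c n).step y := by
  have h' : M.Running (Function.update c n y) n := by
    rwa [Running, run_update le_rfl]
  rw [run_succ h', run_update le_rfl, Function.update_self]

lemma _root_.HarmonicExplorer.State.step_congr {s : State} {x y : ℝ}
    (h : x ≤ s.prob ↔ y ≤ s.prob) : s.step x = s.step y := by
  by_cases hx : x ≤ s.prob
  · simp only [State.step, if_pos hx, if_pos (h.1 hx)]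
  · simp only [State.step, if_neg hx, if_neg fun h' => hx (h.2 h')]

variable (M X) in
/-- The event that the process, after the first `j` steps with the coins `c`, satisfies `H` within
at most `N` further steps with the coins `X`. -/
def hits (H : (ℕ → ℝ) → ℕ → Prop) : ℕ → (ℕ → ℝ) → ℕ → Set Ω
  | 0, c, j => {_ω | H c j}
  | N + 1, c, j => {_ω | H c j} ∪ ({_ω | M.Running c j} ∩
      ((X j ⁻¹' Set.Iic (M.run c j).prob ∩
        hits H N (Function.update c j (M.run c j).prob) (j + 1)) ∪
      (X j ⁻¹' Set.Ioi (M.run c j).prob ∩ hits H N (Function.update c j 1) (j + 1))))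

/-- Each coin matters only through its comparison with the current probability, so `hits` is a
finite binary tree of events. From step `j` on it uses only the coins with index at least `j`, which
gives the independence from earlier ones. -/
lemma measurable_hits (H : (ℕ → ℝ) → ℕ → Prop) (N : ℕ) (c : ℕ → ℝ) (j : ℕ) :
    MeasurableSet[⨆ i ∈ Set.Ici j, (inferInstance : MeasurableSpace ℝ).comap (X i)]
      (hits M X H N c j) := by
  induction N generalizing c j with
  | zero => exact MeasurableSet.const _
  | succ N ih =>
    have hle : (⨆ i ∈ Set.Ici (j + 1), (inferInstance : MeasurableSpace ℝ).comap (X i)) ≤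
        ⨆ i ∈ Set.Ici j, (inferInstance : MeasurableSpace ℝ).comap (X i) :=
      biSup_mono fun i hi => (Nat.le_succ j).trans hi
    have hj : ∀ {S : Set ℝ}, MeasurableSet S →
        MeasurableSet[⨆ i ∈ Set.Ici j, (inferInstance : MeasurableSpace ℝ).comap (X i)] (X j ⁻¹' S) :=
      fun hS => le_iSup₂ (f := fun i (_ : i ∈ Set.Ici j) =>
        (inferInstance : MeasurableSpace ℝ).comap (X i)) j (Set.mem_Ici.2 le_rfl) _ ⟨_, hS, rfl⟩
    refine MeasurableSet.union (MeasurableSet.const _) (MeasurableSet.inter (MeasurableSet.const _) ?_)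
    exact MeasurableSet.union (MeasurableSet.inter (hj measurableSet_Iic) (hle _ (ih _ _)))
      (MeasurableSet.inter (hj measurableSet_Ioi) (hle _ (ih _ _)))

lemma hits_mono (H : (ℕ → ℝ) → ℕ → Prop) (N : ℕ) (c : ℕ → ℝ) (j : ℕ) :
    hits M X H N c j ⊆ hits M X H (N + 1) c j := by
  induction N generalizing c j with
  | zero => exact Set.subset_union_left
  | succ N ih =>
    refine Set.union_subset_union_right _ (Set.inter_subset_inter_right _ ?_)
    exact Set.union_subset_union (Set.inter_subset_inter_right _ (ih _ _))
      (Set.inter_subset_inter_right _ (ih _ _))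

/-- The coins in `c` are representatives, `p` for success and `1` for failure. They lead to the same
states as the actual coins, and `H` depends only on the states. -/
lemma mem_hits {H : (ℕ → ℝ) → ℕ → Prop}
    (hH : ∀ {x y : ℕ → ℝ} {n : ℕ}, (∀ i ≤ n, M.run x i = M.run y i) → H x n → H y n)
    (hr : ∀ {x : ℕ → ℝ} {n : ℕ}, H x n → M.Running x n) {ω : Ω}
    (hX : ∀ i, 0 < X i ω ∧ X i ω ≤ 1) {N : ℕ} {c : ℕ → ℝ} {j : ℕ}
    (hc : ∀ i ≤ j, M.run (fun n => X n ω) i = M.run c i) (h : H (fun n => X n ω) (j + N)) :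
    ω ∈ hits M X H N c j := by
  induction N generalizing c j with
  | zero => exact hH hc h
  | succ N ih =>
    have hrun : M.Running (fun n => X n ω) j := (hr h).of_le (by omega)
    have hrun' : M.Running c j := by
      rwa [Running, ← hc j le_rfl]
    refine Or.inr ⟨hrun', ?_⟩
    have next : ∀ y : ℝ, (X j ω ≤ (M.run c j).prob ↔ y ≤ (M.run c j).prob) →
        ω ∈ hits M X H N (Function.update c j y) (j + 1) := by
      intro y hy
      refine ih (fun i hi => ?_) (by rwa [show j + 1 + N = j + (N + 1) by omega])
      rcases hi.lt_or_eq with hi | rfl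
      · rw [run_update (by omega), hc i (by omega)]
      · rw [run_update_succ hrun', run_succ hrun, hc j le_rfl]
        exact State.step_congr hy
    rcases le_or_gt (X j ω) (M.run c j).prob with hle | hlt
    · exact Or.inl ⟨hle, next _ (by simp [hle])⟩
    · refine Or.inr ⟨hlt, next _ ?_⟩
      simp [hlt.not_ge, (hlt.trans_le (hX j).2)]

variable [MeasurableSpace Ω] {P : Measure Ω}

lemma measureReal_le_prob [IsProbabilityMeasure P] (hm : ∀ n, Measurable (X n))
    (hu : ∀ n, P.map (X n) = volume.restrict (Set.Icc 0 1)) (n : ℕ) {p : ℝ} (h0 : 0 ≤ p)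
    (h1 : p ≤ 1) : P.real (X n ⁻¹' Set.Iic p) = p := by
  rw [measureReal_def, ← Measure.map_apply (hm n) measurableSet_Iic, hu n,
    Measure.restrict_apply measurableSet_Iic]
  have : Set.Iic p ∩ Set.Icc (0 : ℝ) 1 = Set.Icc 0 p := by
    ext y; simp only [Set.mem_inter_iff, Set.mem_Iic, Set.mem_Icc]; constructor
    · tauto
    · rintro ⟨a, b⟩; exact ⟨b, a, b.trans h1⟩
  rw [this, Real.volume_Icc, sub_zero, ENNReal.toReal_ofReal h0]

/-- Maximal inequality: the probability that the process ever satisfies `H` is at most the initial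
value of a nonnegative martingale which is at least `1` wherever `H` holds. -/
lemma measureReal_hits_le [IsProbabilityMeasure P] (hm : ∀ n, Measurable (X n)) (hi : iIndepFun X P)
    (hu : ∀ n, P.map (X n) = volume.restrict (Set.Icc 0 1)) {H : (ℕ → ℝ) → ℕ → Prop}
    {F : State → ℝ} (h0 : ∀ s, M.Consistent s → 0 ≤ F s)
    (h1 : ∀ c j, (∀ i, 0 < c i ∧ c i ≤ 1) → H c j → 1 ≤ F (M.run c j))
    (hF : ∀ s, M.Consistent s → center s.tail s.head ∈ M.D → ∀ x₁ x₀, x₁ ≤ s.prob →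
      (s.prob < 1 → s.prob < x₀) → F s = s.prob * F (s.step x₁) + (1 - s.prob) * F (s.step x₀))
    (N : ℕ) {c : ℕ → ℝ} (hc : ∀ i, 0 < c i ∧ c i ≤ 1) (j : ℕ) :
    P.real (hits M X H N c j) ≤ F (M.run c j) := by
  have hH : ∀ {S : Set Ω} {c : ℕ → ℝ} {j : ℕ}, (∀ i, 0 < c i ∧ c i ≤ 1) → H c j →
      P.real S ≤ F (M.run c j) := fun hc h => measureReal_le_one.trans (h1 _ _ hc h)
  induction N generalizing c j with
  | zero =>
    by_cases h : H c j
    · exact hH hc h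
    · simpa [hits, h] using h0 _ (consistent_run hc j)
  | succ N ih =>
    by_cases h : H c j
    · exact hH hc h
    by_cases hr : M.Running c j
    swap
    · simpa [hits, h, hr] using h0 _ (consistent_run hc j)
    have hs := consistent_run (M := M) hc j
    have hcen := hr.center_mem hc
    set p := (M.run c j).prob with hp
    have hp01 : 0 ≤ p ∧ p ≤ 1 := hs.prob_mem hcen
    have hcup : ∀ y, 0 < y → y ≤ 1 → ∀ i, 0 < Function.update c j y i ∧ Function.update c j y i ≤ 1 := by
      intro y hy hy' i
      by_cases hij : i = j
      · subst hij; simp [hy, hy']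
      · simp [hij, hc i]
    -- The remaining event depends only on the coins after `j`.
    have hind : ∀ {S : Set ℝ} {c' : ℕ → ℝ}, MeasurableSet S →
        P.real (X j ⁻¹' S ∩ hits M X H N c' (j + 1)) =
          P.real (X j ⁻¹' S) * P.real (hits M X H N c' (j + 1)) := by
      intro S c' hS
      have := indep_iSup_of_disjoint (fun i => (hm i).comap_le) hi
        (S := {j}) (T := Set.Ici (j + 1)) (by simp)
      rw [measureReal_def, (Indep_iff _ _ _).1 this _ _ ?_ (measurable_hits H N c' (j + 1)), ENNReal.toReal_mul]
      · rfl
      · exact le_iSup₂ (f := fun i (_ : i ∈ ({j} : Set ℕ)) =>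
          (inferInstance : MeasurableSpace ℝ).comap (X i)) j rfl _ ⟨S, hS, rfl⟩
    have hIoi : P.real (X j ⁻¹' Set.Ioi p) = 1 - p := by
      have := probReal_compl_eq_one_sub (μ := P) (hm j (measurableSet_Iic (a := p)))
      rwa [← Set.preimage_compl, Set.compl_Iic, measureReal_le_prob hm hu j hp01.1 hp01.2] at this
    have hsplit : P.real (hits M X H (N + 1) c j) ≤
        p * P.real (hits M X H N (Function.update c j p) (j + 1)) +
          (1 - p) * P.real (hits M X H N (Function.update c j 1) (j + 1)) := by
      have : hits M X H (N + 1) c j = (X j ⁻¹' Set.Iic p ∩ hits M X H N (Function.update c j p) (j + 1)) ∪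
          (X j ⁻¹' Set.Ioi p ∩ hits M X H N (Function.update c j 1) (j + 1)) := by
        simp [hits, h, hr, hp]
      rw [this]
      refine (measureReal_union_le _ _).trans_eq ?_
      rw [hind measurableSet_Iic, hind measurableSet_Ioi, hIoi,
        measureReal_le_prob hm hu j hp01.1 hp01.2]
    refine hsplit.trans ?_
    rw [hF _ hs hcen p 1 le_rfl id]
    refine add_le_add ?_ (mul_le_mul_of_nonneg_left ?_ (by linarith))
    -- For `p = 0` the representative `p` is not an admissible coin, but the branch has weight zero.
    · rcases hp01.1.eq_or_lt with h0 | h0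
      · rw [← hp, ← h0]; simp
      · refine mul_le_mul_of_nonneg_left ?_ h0.le
        rw [← run_update_succ hr]
        exact ih (hcup p h0 hp01.2) _
    · rw [← run_update_succ hr]
      exact ih (hcup 1 one_pos le_rfl) _

end MarkedDomain

/-! ### From the path in the plane to the lattice estimate -/

lemma norm_mid_sub_left {u v : Vertex} (h : Adj u v) : ‖mid u v - pt u‖ = 1 / 2 := by
  have : mid u v - pt u = (1 / 2 : ℝ) • (pt v - pt u) := by simp [mid]; ring
  rw [this, norm_smul, h.norm_pt_sub]
  norm_num

lemma norm_mid_sub_right {u v : Vertex} (h : Adj u v) : ‖mid u v - pt v‖ = 1 / 2 := by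
  rw [mid_comm, norm_mid_sub_left h.symm]

lemma norm_center_sub_apex_le {u v : Vertex} (h : Adj u v) :
    ‖center u v - pt (apex u v)‖ ≤ 1 := by
  have : center u v - pt (apex u v) =
      (1 / 3 : ℝ) • (pt u - pt (apex u v)) + (1 / 3 : ℝ) • (pt v - pt (apex u v)) := by
    simp [center]; ring
  rw [this]
  refine (norm_add_le _ _).trans ?_
  rw [norm_smul, norm_smul, h.apex_left.symm.norm_pt_sub, h.apex_right.symm.norm_pt_sub]
  norm_num

lemma exists_pt_near (z : ℂ) : ∃ o : Vertex, ‖pt o - z‖ ≤ 2 := by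
  refine ⟨(⌊coordFst z⌋, ⌊coordSnd z⌋), le_of_sq_le_sq ?_ (by norm_num)⟩
  rw [norm_sq_eq_coord, coordFst_sub, coordSnd_sub, coordFst_pt, coordSnd_pt]
  have h₁ := Int.floor_le (coordFst z)
  have h₂ := Int.lt_floor_add_one (coordFst z)
  have h₃ := Int.floor_le (coordSnd z)
  have h₄ := Int.lt_floor_add_one (coordSnd z)
  generalize (⌊coordFst z⌋ : ℝ) = a at *
  generalize (⌊coordSnd z⌋ : ℝ) = b at *
  nlinarith

namespace MarkedDomain

variable {M : MarkedDomain} {x : ℕ → ℝ}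

/-- A point of the path lies on a segment from the center of an explored triangle to the midpoint
of one of its sides. -/
lemma exists_of_mem_trace (hx : ∀ i, 0 < x i ∧ x i ≤ 1) {w : ℂ} (hw : w ∈ M.trace x) :
    ∃ n, M.Running x n ∧ ‖w - pt (M.run x n).next‖ ≤ 1 ∧ ∃ u v k, Adj u v ∧
      w ∈ segment ℝ (mid u v) (center u v) ∧ mid u v = (M.run x k).pos := by
  simp only [trace, Set.mem_iUnion] at hw
  obtain ⟨n, hn, hw⟩ := hw
  have hn : M.Running x n := hn
  set s := M.run x n with hs
  have hadj : Adj s.tail s.head := (consistent_run (M := M) hx n).adj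
  have hseg : ∀ {p : ℂ}, ‖p - pt s.next‖ ≤ 1 → w ∈ segment ℝ p (center s.tail s.head) →
      ‖w - pt s.next‖ ≤ 1 := by
    intro p hp hw
    have := (convex_closedBall (pt s.next) 1).segment_subset (mem_closedBall_iff_norm.2 hp)
      (mem_closedBall_iff_norm.2 (norm_center_sub_apex_le hadj)) hw
    exact mem_closedBall_iff_norm.1 this
  rcases hw with hw | hw
  · refine ⟨n, hn, hseg ?_ hw, s.tail, s.head, n, hadj, hw, rfl⟩
    have : s.pos - pt s.next =
        (1 / 2 : ℝ) • (pt s.tail - pt s.next) + (1 / 2 : ℝ) • (pt s.head - pt s.next) := by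
      simp [State.pos, mid]; ring
    rw [this]
    refine (norm_add_le _ _).trans ?_
    rw [norm_smul, norm_smul, State.next, hadj.apex_left.symm.norm_pt_sub,
      hadj.apex_right.symm.norm_pt_sub]
    norm_num
  · rw [segment_symm] at hw
    have hpos : (M.run x (n + 1)).pos = mid s.next s.tail ∨ (M.run x (n + 1)).pos = mid s.head s.next := by
      rw [run_succ hn]
      rcases step_cases (M.run x n) (x n) with ⟨h₁, h₂⟩ | ⟨h₁, h₂⟩
      · left
        rw [State.pos, h₁, h₂, mid_comm]
      · right
        rw [State.pos, h₁, h₂, mid_comm]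
    rcases hpos with hp | hp
    · refine ⟨n, hn, hseg ?_ hw, s.next, s.tail, n + 1, hadj.apex_left.symm, ?_, hp.symm⟩
      · rw [hp]; exact (norm_mid_sub_left hadj.apex_left.symm).trans_le (by norm_num)
      · rwa [← hp, State.next, center_apex_left]
    · refine ⟨n, hn, hseg ?_ hw, s.head, s.next, n + 1, hadj.apex_right, ?_, hp.symm⟩
      · rw [hp]; exact (norm_mid_sub_right hadj.apex_right).trans_le (by norm_num)
      · rwa [← hp, State.next, center_apex_right]

/-- If the path comes very close to the boundary, then it is near one of its ends. -/
lemma le_three_mul (hx : ∀ i, 0 < x i ∧ x i ≤ 1) {z : ℂ} {r R : ℝ} (hr : r ≤ 1 / 24)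
    (hsep : M.Separates (Metric.ball z R)) (hF : (Metric.ball z r ∩ frontier M.D).Nonempty)
    (ht : (M.trace x ∩ Metric.ball z r).Nonempty) : R ≤ 3 * r := by
  obtain ⟨w, hw, hwz⟩ := ht
  obtain ⟨w', hw'z, hw'⟩ := hF
  obtain ⟨n, -, -, u, v, k, huv, hwuv, hk⟩ := exists_of_mem_trace hx hw
  obtain ⟨i, hi, hwi⟩ := M.exists_edge hw'
  rw [mem_ball_iff_norm] at hwz hw'z
  have hww : ‖w' - w‖ < 2 * r := by
    have : w' - w = (w' - z) - (w - z) := by ring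
    rw [this]
    linarith [norm_sub_le (w' - z) (w - z)]
  obtain ⟨he, hle⟩ := edge_eq_of_norm_sub_lt huv (M.adj i hi) hwi hwuv (by linarith)
  have hmid : mid u v ∈ frontier M.D := by
    rcases he with ⟨rfl, rfl⟩ | ⟨rfl, rfl⟩
    · exact M.mid_mem_frontier hi
    · rw [mid_comm]; exact M.mid_mem_frontier hi
  have hnot : mid u v ∉ Metric.ball z R := by
    rw [hk] at hmid ⊢
    rcases (consistent_run hx k).pos_eq hmid with h | h <;> rw [h]
    · exact hsep.start_notMem (convex_ball z R) Metric.isOpen_ball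
    · exact hsep.finish_notMem (convex_ball z R) Metric.isOpen_ball
  rw [mem_ball_iff_norm, not_lt] at hnot
  have : mid u v - z = (mid u v - w) + (w - z) := by ring
  rw [this] at hnot
  linarith [norm_add_le (mid u v - w) (w - z)]

/-- The lattice point `o` is within `2` of `z`, and `hexNorm` is at most twice the Euclidean
distance: this gives `2 * (r + 1 + 2) = 2 * r + 6`. The margin `3` on `R'` covers this `2` and half
an edge at the start. -/
lemma exists_arena {z : ℂ} {r R : ℝ} {m R' : ℕ} (hsep : M.Separates (Metric.ball z R))
    (hF : (Metric.ball z r ∩ frontier M.D).Nonempty) (hm : 2 * r + 6 ≤ m) (hR : (R' : ℝ) + 3 ≤ R)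
    (hmR : m < R') : ∃ o, M.Arena (Metric.ball z R) o m R' ∧
      ∀ v, ‖pt v - z‖ < r + 1 → hexNorm (v - o) ≤ m := by
  obtain ⟨o, ho⟩ := exists_pt_near z
  have hnear : ∀ v, ‖pt v - z‖ < r + 1 → hexNorm (v - o) ≤ m := by
    intro v hv
    have h₁ := hexNorm_le_norm_pt_sub v o
    have h₂ : ‖pt v - pt o‖ ≤ ‖pt v - z‖ + ‖pt o - z‖ := by
      have : pt v - pt o = (pt v - z) - (pt o - z) := by ring
      rw [this]
      exact norm_sub_le _ _
    have : (hexNorm (v - o) : ℝ) ≤ m := by linarith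
    exact_mod_cast this
  have hst : R ≤ ‖M.start - z‖ := by
    have := hsep.start_notMem (convex_ball z R) Metric.isOpen_ball
    rwa [mem_ball_iff_norm, not_lt] at this
  have hadj := M.adj 0 (by linarith [M.three_le_len])
  have hfar : ∀ v, ‖M.start - pt v‖ = 1 / 2 → R' < hexNorm (v - o) := by
    intro v hv
    have h₁ := norm_pt_sub_le v o
    have h₂ : M.start - z = (M.start - pt v) + (pt v - pt o) + (pt o - z) := by ring
    rw [h₂] at hst
    have h₃ := norm_add₃_le (a := M.start - pt v) (b := pt v - pt o) (c := pt o - z)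
    have : (R' : ℝ) < hexNorm (v - o) := by linarith
    exact_mod_cast this
  refine ⟨o, ⟨convex_ball z R, fun v hv => ?_, hsep, hfar _ (norm_mid_sub_left hadj),
    hfar _ (norm_mid_sub_right hadj), ?_, hmR⟩, hnear⟩
  · rw [mem_ball_iff_norm]
    have h₁ := norm_pt_sub_le v o
    have h₂ : pt v - z = (pt v - pt o) + (pt o - z) := by ring
    rw [h₂]
    have h₃ : (hexNorm (v - o) : ℝ) ≤ R' := by exact_mod_cast hv
    linarith [norm_add_le (pt v - pt o) (pt o - z)]
  · obtain ⟨w, hwz, hw⟩ := hF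
    obtain ⟨i, hi, hwi⟩ := M.exists_edge hw
    refine ⟨M.vert i, M.vert_mem_frontier hi.le, hnear _ ?_⟩
    rw [mem_ball_iff_norm] at hwz
    have : w ∈ Metric.closedBall (pt (M.vert i)) 1 := by
      refine (convex_closedBall _ _).segment_subset (by simp) ?_ hwi
      rw [mem_closedBall_iff_norm, (M.adj i hi).norm_pt_sub]
    rw [mem_closedBall_iff_norm'] at this
    have h₂ : pt (M.vert i) - z = (pt (M.vert i) - w) + (w - z) := by ring
    rw [h₂]
    linarith [norm_add_le (pt (M.vert i) - w) (w - z)]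

variable {Ω : Type*} [MeasurableSpace Ω] {P : Measure Ω} {X : ℕ → Ω → ℝ}

lemma ae_mem_Ioc (hm : ∀ n, Measurable (X n))
    (hu : ∀ n, P.map (X n) = volume.restrict (Set.Icc 0 1)) :
    ∀ᵐ ω ∂P, ∀ n, 0 < X n ω ∧ X n ω ≤ 1 := by
  rw [ae_all_iff]
  intro n
  have : ∀ᵐ y ∂(P.map (X n)), 0 < y ∧ y ≤ 1 := by
    rw [hu n, Measure.restrict_congr_set Ioc_ae_eq_Icc.symm]
    exact ae_restrict_mem measurableSet_Ioc
  exact ae_of_ae_map (hm n).aemeasurable this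

lemma HitAt.congr {B : Set ℂ} {o : Vertex} {m : ℕ} {σ : Bool} {x y : ℕ → ℝ} {n : ℕ}
    (hxy : ∀ i ≤ n, M.run x i = M.run y i) (h : M.HitAt B o m σ x n) : M.HitAt B o m σ y n := by
  refine ⟨?_, fun i hi => ?_, ?_, ?_⟩
  · rw [Running, ← hxy n le_rfl]; exact h.running
  · rw [← hxy i hi.le]; exact h.lt i hi
  · rw [← hxy n le_rfl]; exact h.le
  · rw [← hxy n le_rfl]; exact h.far_mem

/-- The probability that the path comes close to `o` on the side `σ`. -/
lemma exists_measure_hits_le : ∃ K : ℕ, 2 ≤ K ∧ ∀ {Ω : Type*} [MeasurableSpace Ω] {P : Measure Ω}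
    [IsProbabilityMeasure P] {X : ℕ → Ω → ℝ} (_ : ∀ n, Measurable (X n)) (_ : iIndepFun X P)
    (_ : ∀ n, P.map (X n) = volume.restrict (Set.Icc 0 1)) {M : MarkedDomain} {B : Set ℂ} {o : Vertex}
    {m R : ℕ} (_ : M.Arena B o m R) (σ : Bool) (i : ℕ)
    (_ : 2 * (4 ^ i * (2 * (2 * (K * (m + 1))) + 1)) ≤ R),
    P (⋃ N, hits M X (M.HitAt B o m σ) N (fun _ => 1) 0) ≤
      ENNReal.ofReal (75 * √(864 / 865) ^ i) := by
  obtain ⟨K, hK, hlow⟩ := exists_le_flux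
  refine ⟨K, hK, fun {Ω _ P _ X} hm hi hu {M B o m R} A σ i hiR => ?_⟩
  have hKm : m + 1 ≤ K * (m + 1) := Nat.le_mul_of_pos_left _ (by omega)
  have h4 : 1 ≤ 4 ^ i := Nat.one_le_pow _ _ (by norm_num)
  have hle : 2 * (K * (m + 1)) ≤ R := by
    have : 2 * (2 * (K * (m + 1))) + 1 ≤ 4 ^ i * (2 * (2 * (K * (m + 1))) + 1) :=
      Nat.le_mul_of_pos_left _ h4
    omega
  rw [(monotone_nat_of_le_succ fun N => hits_mono _ N _ 0).measure_iUnion]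
  refine iSup_le fun N => ?_
  rw [← ofReal_measureReal]
  refine ENNReal.ofReal_le_ofReal ?_
  have h11 : ∀ _ : ℕ, 0 < (1 : ℝ) ∧ (1 : ℝ) ≤ 1 := fun _ => by norm_num
  -- If the arc does not come near `o`, no approach on this side is possible, and the zero
  -- martingale suffices.
  by_cases ht : ∃ v ∈ M.arcVerts σ, hexNorm (v - o) ≤ m
  · refine le_trans (measureReal_hits_le hm hi hu
      (F := fun s => flux o (2 * (K * (m + 1))) (M.side B σ) (M.arcVerts σ) (s.height σ))
      (fun s hs => hs.flux_nonneg σ) (fun c j hc h => hlow A hle hc h)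
      (fun s hs hc x₁ x₀ h₁ h₀ => hs.flux_eq hc σ h₁ h₀) N h11 0) ?_
    exact A.flux_init_le ht (by positivity) (by omega) i hiR
  · refine le_trans (measureReal_hits_le hm hi hu (F := fun _ => 0)
      (fun s hs => le_rfl) (fun c j hc h => (ht (A.touch_arcVerts h hc)).elim)
      (fun s hs hc x₁ x₀ h₁ h₀ => by ring) N h11 0) ?_
    positivity

/-- The probability that the path comes close to `z`, if `r` is at least of the order of the mesh. -/
lemma exists_measureReal_trace_le : ∃ L : ℝ, 24 ≤ L ∧ ∀ {Ω : Type*} [MeasurableSpace Ω] {P : Measure Ω}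
    [IsProbabilityMeasure P] {X : ℕ → Ω → ℝ} (_ : ∀ n, Measurable (X n)) (_ : iIndepFun X P)
    (_ : ∀ n, P.map (X n) = volume.restrict (Set.Icc 0 1)) {M : MarkedDomain} {z : ℂ} {r R : ℝ}
    (_ : 1 / 24 ≤ r) (_ : (Metric.ball z r ∩ frontier M.D).Nonempty)
    (_ : M.Separates (Metric.ball z R)) (i : ℕ) (_ : 4 ^ i * (L * r) ≤ R),
    P.real {ω | (M.trace (fun n => X n ω) ∩ Metric.ball z r).Nonempty} ≤
      150 * √(864 / 865) ^ i := by
  obtain ⟨K, hK, hhits⟩ := exists_measure_hits_le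
  -- Since `K * r ≥ 1 / 12`, all additive constants are absorbed: `3000 * K * r` covers the radii,
  -- and the remaining `1000 * K * r` exceeds the `4` lost in rounding.
  refine ⟨4000 * K, by have : (2 : ℝ) ≤ K := by exact_mod_cast hK
                       linarith, fun {Ω _ P _ X} hm hi hu {M z r R} hr hF hsep i hiR => ?_⟩
  have hK' : (2 : ℝ) ≤ K := by exact_mod_cast hK
  set m := ⌈2 * r + 6⌉₊ with hmdef
  set R' := ⌊R - 3⌋₊ with hRdef
  have h4 : (1 : ℝ) ≤ 4 ^ i := one_le_pow₀ (by norm_num)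
  have hKr : (1 / 12 : ℝ) ≤ K * r := by nlinarith
  have hbig : 4000 * K * r ≤ R := by
    refine le_trans ?_ hiR
    exact le_mul_of_one_le_left (by positivity) h4
  have hR3 : 0 ≤ R - 3 := by linarith
  have hR' : (R' : ℝ) + 3 ≤ R := by linarith [Nat.floor_le hR3]
  have hR'' : R - 4 < R' := by linarith [Nat.lt_floor_add_one (R - 3)]
  have hm₁ : 2 * r + 6 ≤ m := Nat.le_ceil _
  have hm₂ : (m : ℝ) ≤ 2 * r + 7 := by linarith [Nat.ceil_lt_add_one (show 0 ≤ 2 * r + 6 by linarith)]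
  have hcond : 2 * (4 ^ i * (2 * (2 * (K * (m + 1))) + 1)) ≤ R' := by
    have : (2 * (4 ^ i * (2 * (2 * (K * (m + 1))) + 1)) : ℝ) ≤ R' := by
      have e₁ : (2 * (2 * (2 * (K * (m + 1))) + 1) : ℝ) ≤ 3000 * K * r := by
        have : (K : ℝ) * (m + 1) ≤ K * (2 * r + 8) :=
          mul_le_mul_of_nonneg_left (by linarith) (by positivity)
        nlinarith
      have e₂ : (4 : ℝ) ^ i * (3000 * K * r) + 1000 * K * r ≤ R := by
        have : 1000 * K * r ≤ 4 ^ i * (1000 * K * r) := le_mul_of_one_le_left (by positivity) h4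
        linarith
      calc (2 * (4 ^ i * (2 * (2 * (K * (m + 1))) + 1)) : ℝ)
          = 4 ^ i * (2 * (2 * (2 * (K * (m + 1))) + 1)) := by ring
        _ ≤ 4 ^ i * (3000 * K * r) := by gcongr
        _ ≤ R' := by linarith
    exact_mod_cast this
  have hmR : m < R' := by
    have h4' : 1 ≤ 4 ^ i := Nat.one_le_pow _ _ (by norm_num)
    have hKm : m + 1 ≤ K * (m + 1) := Nat.le_mul_of_pos_left _ (by omega)
    have : 2 * (2 * (K * (m + 1))) + 1 ≤ 4 ^ i * (2 * (2 * (K * (m + 1))) + 1) :=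
      Nat.le_mul_of_pos_left _ h4'
    omega
  obtain ⟨o, A, hnear⟩ := exists_arena hsep hF hm₁ hR' hmR
  have hsub : ∀ᵐ ω ∂P, ω ∈ {ω | (M.trace (fun n => X n ω) ∩ Metric.ball z r).Nonempty} →
      ω ∈ (⋃ N, hits M X (M.HitAt (Metric.ball z R) o m true) N (fun _ => 1) 0) ∪
        ⋃ N, hits M X (M.HitAt (Metric.ball z R) o m false) N (fun _ => 1) 0 := by
    filter_upwards [ae_mem_Ioc hm hu] with ω hω hne
    obtain ⟨w, hw, hwz⟩ := hne
    obtain ⟨n, hn, hwn, -⟩ := exists_of_mem_trace hω hw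
    have hle : hexNorm ((M.run (fun n => X n ω) n).next - o) ≤ m := by
      refine hnear _ ?_
      rw [mem_ball_iff_norm] at hwz
      rw [norm_sub_rev] at hwn
      have : pt (M.run (fun n => X n ω) n).next - z =
          (pt (M.run (fun n => X n ω) n).next - w) + (w - z) := by ring
      rw [this]
      linarith [norm_add_le (pt (M.run (fun n => X n ω) n).next - w) (w - z)]
    obtain ⟨σ, k, h⟩ := A.exists_hitAt hω hn hle
    have hmem : ω ∈ ⋃ N, hits M X (M.HitAt (Metric.ball z R) o m σ) N (fun _ => 1) 0 := by
      refine Set.mem_iUnion.2 ⟨k, mem_hits (fun hxy h => h.congr hxy) (fun h => h.running) hω ?_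
        (by rwa [zero_add])⟩
      intro i hi
      rw [Nat.le_zero.1 hi]
      rfl
    cases σ
    exacts [Or.inr hmem, Or.inl hmem]
  have hP := (measure_mono_ae hsub).trans (measure_union_le _ _)
  have hq : 0 ≤ 75 * √(864 / 865) ^ i := by positivity
  have := hP.trans (add_le_add (hhits hm hi hu A true i hcond) (hhits hm hi hu A false i hcond))
  rw [← ENNReal.ofReal_add hq hq] at this
  rw [measureReal_def]
  refine (ENNReal.toReal_le_of_le_ofReal (by positivity) this).trans_eq ?_
  ring

end MarkedDomain

end HarmonicExplorer


/-! ### Conversion of the scale count into a power -/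

theorem proposition6p3 :
    ∃ c : ℝ, 0 < c ∧ ∃ C : ℝ,
      ∀ (Ω : Type*) [MeasurableSpace Ω] (P : Measure Ω) [IsProbabilityMeasure P]
        (X : ℕ → Ω → ℝ),
        (∀ n, Measurable (X n)) →
        iIndepFun X P →
        (∀ n, P.map (X n) = volume.restrict (Set.Icc 0 1)) →
        ∀ (M : HarmonicExplorer.MarkedDomain) (z : ℂ) (r R : ℝ),
          0 < r → r < R →
          (Metric.ball z r ∩ frontier M.D).Nonempty →
          (¬ ∃ w ∈ Metric.ball z R ∩ M.D,
            (frontier (connectedComponentIn (Metric.ball z R ∩ M.D) w) ∩ M.arcMinus).Nonempty ∧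
            (frontier (connectedComponentIn (Metric.ball z R ∩ M.D) w) ∩ M.arcPlus).Nonempty) →
          P.real {ω | (M.trace (fun n => X n ω) ∩ Metric.ball z r).Nonempty}
            ≤ C * (r / R) ^ c := by
  obtain ⟨L, hL, hmain⟩ := HarmonicExplorer.MarkedDomain.exists_measureReal_trace_le
  set q : ℝ := √(864 / 865) with hq
  have hq0 : 0 < q := Real.sqrt_pos.2 (by norm_num)
  have hq1 : q < 1 := by
    rw [hq, Real.sqrt_lt' one_pos]
    norm_num
  -- The exponent with `4 ^ (-c) = q`: one factor `4` in scale costs one factor `q` in probability.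
  set c : ℝ := -Real.logb 4 q with hc
  have hc0 : 0 < c := by
    rw [hc, neg_pos]
    exact Real.logb_neg (by norm_num) hq0 hq1
  have hqc : ((4 : ℝ) ^ c) = q⁻¹ := by
    rw [hc, Real.rpow_neg (by norm_num), Real.rpow_logb (by norm_num) (by norm_num) hq0]
  have hL0 : 0 < L := by linarith
  have hq1' : 1 ≤ q⁻¹ := (one_le_inv₀ hq0).2 hq1.le
  refine ⟨c, hc0, 150 * q⁻¹ * L ^ c, ?_⟩
  intro Ω _ P _ X hm hi hu M z r R hr hrR hF hsep
  have hR : 0 < R := hr.trans hrR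
  have hrw : 150 * q⁻¹ * L ^ c * (r / R) ^ c = 150 * q⁻¹ * (L * r / R) ^ c := by
    rw [mul_assoc, ← Real.mul_rpow hL0.le (by positivity), mul_div_assoc]
  rw [hrw]
  -- For comparable radii the bound exceeds `1`.
  rcases lt_or_ge R (L * r) with hlt | hge
  · refine measureReal_le_one.trans ?_
    have : 1 ≤ (L * r / R) ^ c := Real.one_le_rpow ((one_le_div hR).2 hlt.le) hc0.le
    nlinarith
  -- Below the scale of the mesh, a visit would force `R ≤ 3 * r`, whereas `R ≥ L * r ≥ 24 * r`.
  rcases le_or_gt r (1 / 24) with hsmall | hlarge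
  · have h0 : P.real {ω | (M.trace (fun n => X n ω) ∩ Metric.ball z r).Nonempty} = 0 := by
      rw [measureReal_eq_zero_iff, ← compl_mem_ae_iff]
      filter_upwards [HarmonicExplorer.MarkedDomain.ae_mem_Ioc hm hu] with ω hω hne
      have := HarmonicExplorer.MarkedDomain.le_three_mul hω hsmall hsep hF hne
      nlinarith
    rw [h0]
    positivity
  -- The largest admissible number of scales. Rounding down loses one factor `q`, whence the `q⁻¹`
  -- in the constant.
  · obtain ⟨i, hi₁, hi₂⟩ := exists_nat_pow_near (x := R / (L * r)) (y := 4)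
      ((one_le_div (by positivity)).2 hge) (by norm_num)
    refine (hmain hm hi hu hlarge.le hF hsep i ((le_div_iff₀ (by positivity)).1 hi₁)).trans ?_
    have h₁ : ((4 : ℝ) ^ (i + 1))⁻¹ ≤ L * r / R := by
      rw [← inv_div R]
      exact inv_anti₀ (by positivity) hi₂.le
    have h₂ : q ^ (i + 1) ≤ (L * r / R) ^ c := by
      have h₃ : ((4 : ℝ) ^ (i + 1)) ^ c = q⁻¹ ^ (i + 1) := by
        rw [← hqc, ← Real.rpow_natCast, ← Real.rpow_natCast, ← Real.rpow_mul (by norm_num),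
          ← Real.rpow_mul (by norm_num), mul_comm]
      refine le_trans (le_of_eq ?_) (Real.rpow_le_rpow (by positivity) h₁ hc0.le)
      rw [Real.inv_rpow (by positivity), h₃, inv_pow, inv_inv]
    calc 150 * q ^ i = 150 * q⁻¹ * q ^ (i + 1) := by
          rw [pow_succ]; field_simp
      _ ≤ _ := by gcongr
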